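/- **Setting.** Let $P$ be a partial order $\preceq$ on a set of $n\ge 2$ items, let $L(P)$ be its number of linear extensions (arrangements of the items in positions $1,\dots,n$ in which $a\prec b$ implies that $a$ stands to the left of $b$), let $A=\ln L(P)$, and let $\mathrm{home}$ be a given linear extension. Write $h(a)$ for the position of item $a$ in $\mathrm{home}$. For $\beta\in(0,n]$ put $p_\beta=1+\beta-\lceil\beta\rceil$. An item $a$ at position $i$ *may advance* if $i+1-h(a)<\lceil\beta\rceil$, or if $i+1-h(a)=\lceil\beta\rceil$ and $C_2=1$. *Chain.* A step with position $i\in\{1,\dots,n-1\}$ and coins $C_1,C_2$ transposes the items $\sigma(i),\sigma(i+1)$ of a linear extension $\sigma$ if $C_1=1$, $\sigma(i)\not\preceq\sigma(i+1)$ and $\sigma(i)$ may advance. *Bounding chain.* Its state $B$ is a vector of items and symbols $\theta$, at first $(\theta,\dots,\theta,\mathrm{home}(1))$. A step with $i$, $C_3$, $C_2$ transposes $B(i),B(i+1)$ if $C_3=1$, $B(i)\not\preceq B(i+1)$ and $B(i)$ may advance ($\theta$ is comparable to no item and may always advance); then, if $B(n)=\theta$ and $q$ entries of $B$ are not $\theta$,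 it sets $B(n)=\mathrm{home}(q+1)$. The chain is coupled to it by $C_1=1-C_3$ if $\sigma(i)=B(i+1)$ and $C_1=C_3$ otherwise. *Generate$(t)$* (non-Markovian coupling from the past). Draw $t$ independent triples ($i$ uniform on $\{1,\dots,n-1\}$, $C_3$ a fair coin, $C_2$ Bernoulli with parameter $p_\beta$) and run the bounding chain with them. If no $\theta$ is left, return $B$. Otherwise call Generate$(2t)$, with fresh randomness, to get $\sigma$, run the coupled chain from $\sigma$ with the $t$ recorded triples, and return the result. *TPA with $r$ runs.* Let $A(\beta)$ be the set of $x\in(0,n]^P$ such that $\lceil x\rceil$ is the vector of positions of a linear extension and $x(a)-h(a)\le\beta$ for all items $a$. A run starts with $\beta=n$; while $\beta>0$, it draws $\sigma$ by Generate$(t)$, draws $X(a)$ for all items $a$ independently and uniformly from $(s-1,s]$ if $s-h(a)<\lceil\beta\rceil$ and from $(s-1,s-1+p_\beta]$ otherwise, where $s$ is the position of $a$ in $\sigma$, and replaces $\beta$ by $\inf\{\beta'\in[0,n]:X\in A(\beta')\}$. If $k$ is the total number of samples in the $r$ runs minus $r$, TPA returns $\exp(k/r)$. *Two-phase algorithm.*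 Call TPA with $r_1=\lceil 2\ln(2/\delta)\rceil$ runs to get $\hat L_1$, and put $\hat A_1=\ln\hat L_1$. Then call TPA, with fresh randomness, with $$r_2=\Big\lceil 2\big(\hat A_1+\sqrt{\hat A_1}+2\big)\big[(\ln(1+\epsilon))^2-(\ln(1+\epsilon))^3\big]^{-1}\ln(4/\delta)\Big\rceil$$ runs, and return its output $\hat L_2$. *Random bits.* The random bits counted are the independent fair bits used by Generate: one for each $C_3$, and for each $i$ and each $C_2$ the binary digits of a uniform $u\in[0,1)$, read one after the other until they determine the value $\lfloor (n-1)u\rfloor+1$ of $i$, or the truth value of $u<p_\beta$. The uniform real numbers used to draw $X$ from $\sigma$ are not counted. **Theorem.** One can choose the initial number $t=t(n)\ge1$ of steps in Generate, depending on $n$ only, and a constant $C$ such that for every such poset $P$ with $n\ge 2$ items, every $\mathrm{home}$, every $0<\epsilon\le1$ and every $0<\delta<1$ the two-phase algorithm has the following properties. 1. $\Pr\big((1+\epsilon)^{-1}\le \hat L_2/L(P)\le 1+\epsilon\big)\ge 1-\delta$. 2. The expected number of random bits is at most $$4.3\,n^3(\ln n)\big(\lceil\log_2 n\rceil+3\big)\Big[2(A+1)\ln(2/\delta)+(A+1)\big(A+3\sqrt{2A}+2\big)\big[(\ln(1+\epsilon))^2-(\ln(1+\epsilon))^3\big]^{-1}\ln(4/\delta)\Big].$$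 3. If $L(P)\ge2$ and $\delta\le 1/2$, the expected running time, measured by the number of triples $(i,C_3,C_2)$ drawn (each of which costs at most one comparison in the poset for the bounding state and one for the state), is at most $$C\,n^3(\ln n)(\ln L(P))^2\,\epsilon^{-2}\ln\delta^{-1}.$$ -/

import Mathlib

open MeasureTheory

namespace LinExt

noncomputable section

open scoped Classical

/-! ### Linear extensions

The poset is `α`, with `n` elements.  A linear extension is an arrangement `σ : Fin n ≃ α`
(position `i` holds the item `σ i`; positions are numbered from `0`) that respects the order. -/

/-- The arrangement `σ` respects the partial order: smaller items stand further to the left. -/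
def IsLinExt {n : ℕ} {α : Type*} [PartialOrder α] (σ : Fin n ≃ α) : Prop :=
  ∀ i j : Fin n, σ i ≤ σ j → i ≤ j

/-- `L(P)`, the number of linear extensions. -/
def numLinExt (n : ℕ) (α : Type*) [PartialOrder α] : ℕ :=
  Nat.card {σ : Fin n ≃ α // IsLinExt σ}

/-! ### Discrete random choices made from fair bits

A value `f u`, where `u` is uniform on `[0, 1)` and `f` is a step function, is obtained by reading
the binary digits of `u` one after the other, until those read so far determine `f u`. -/

/-- The dyadic number given by the first `k` bits of the stream `b`. -/
def dyadic (b : ℕ → Bool) (k : ℕ) : ℝ :=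
  ∑ j ∈ Finset.range k, if b j then (1 / 2 : ℝ) ^ (j + 1) else 0

/-- The first `k` bits of `b` determine `f u`. -/
def Decided {γ : Type*} (f : ℝ → γ) (b : ℕ → Bool) (k : ℕ) : Prop :=
  ∀ v ∈ Set.Ico (dyadic b k) (dyadic b k + (1 / 2 : ℝ) ^ k), f v = f (dyadic b k)

/-- The value that is read off the stream `b`. -/
def readValue {γ : Type*} (f : ℝ → γ) (b : ℕ → Bool) : γ :=
  f (dyadic b (sInf {k | Decided f b k}))

/-- The number of bits of `b` that are read: one for each `k` such that the first `k` bits do not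
yet determine the value. -/
def readCount {γ : Type*} (f : ℝ → γ) (b : ℕ → Bool) : ENNReal :=
  ∑' k : ℕ, if Decided f b k then 0 else 1

/-- Step function of the uniform distribution on `{0, …, m - 1}`. -/
def unifStep (m : ℕ) (u : ℝ) : ℕ := ⌊(m : ℝ) * u⌋₊

/-- Step function of the Bernoulli distribution with parameter `p`. -/
def bernStep (p : ℝ) (u : ℝ) : Bool := decide (u < p)

/-! ### The sources of randomness

Every draw of the algorithm has its own cell on the tape; all cells are independent, bits are fair
and elements of the unit interval are uniform. -/

/-- Randomness for one step of the chain: a bit stream for the position `i`, one bit for the coin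
that decides on the transposition, a bit stream for the coin `C₂`. -/
abbrev StepTape : Type := (ℕ → Bool) × Bool × (ℕ → Bool)

/-- Randomness for one sample: a step tape for every block of the coupling from the past and every
step of that block, and a uniform number for every coordinate of the continuous embedding. -/
abbrev SampleTape (α : Type*) : Type _ := (ℕ → ℕ → StepTape) × (α → unitInterval)

/-- Randomness for one call of TPA: a sample tape for every run and every sample in that run. -/
abbrev PhaseTape (α : Type*) : Type _ := ℕ → ℕ → SampleTape α

/-- Randomness for the two-phase algorithm. -/
abbrev Tape (α : Type*) : Type _ := PhaseTape α × PhaseTape α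

instance : MeasurableSpace StepTape := Prod.instMeasurableSpace

instance (α : Type*) : MeasurableSpace (SampleTape α) := Prod.instMeasurableSpace

instance (α : Type*) : MeasurableSpace (PhaseTape α) := MeasurableSpace.pi

instance (α : Type*) : MeasurableSpace (Tape α) := Prod.instMeasurableSpace

/-- A fair bit. -/
def coin : Measure Bool := (PMF.uniformOfFintype Bool).toMeasure

instance : IsProbabilityMeasure coin := by unfold coin; infer_instance

/-- A stream of independent fair bits. -/
def bitStream : Measure (ℕ → Bool) := Measure.infinitePi fun _ => coin

instance : IsProbabilityMeasure bitStream := by unfold bitStream; infer_instance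

/-- The law of a step tape. -/
def stepMeasure : Measure StepTape := bitStream.prod (coin.prod bitStream)

instance : IsProbabilityMeasure stepMeasure := by unfold stepMeasure; infer_instance

/-- The law of a sample tape. -/
def sampleMeasure (α : Type*) [Fintype α] : Measure (SampleTape α) :=
  (Measure.infinitePi fun _ : ℕ => Measure.infinitePi fun _ : ℕ => stepMeasure).prod
    (Measure.pi fun _ : α => (volume : Measure unitInterval))

instance (α : Type*) [Fintype α] : IsProbabilityMeasure (sampleMeasure α) := by
  unfold sampleMeasure; infer_instance

/-- The law of the randomness for one call of TPA. -/
def phaseMeasure (α : Type*) [Fintype α] : Measure (PhaseTape α) :=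
  Measure.infinitePi fun _ : ℕ => Measure.infinitePi fun _ : ℕ => sampleMeasure α

instance (α : Type*) [Fintype α] : IsProbabilityMeasure (phaseMeasure α) := by
  unfold phaseMeasure; infer_instance

/-- The law of the tape. -/
def tapeMeasure (α : Type*) [Fintype α] : Measure (Tape α) :=
  (phaseMeasure α).prod (phaseMeasure α)

instance (α : Type*) [Fintype α] : IsProbabilityMeasure (tapeMeasure α) := by
  unfold tapeMeasure; infer_instance

section Algorithm

variable {n : ℕ} {α : Type*} [PartialOrder α]

/-! ### The Markov chain and the bounding chain -/

/-- The parameter `1 + β - ⌈β⌉` of the coin `C₂`. -/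
def penalty (β : ℝ) : ℝ := 1 + β - ⌈β⌉

/-- The Metropolis rule: the item `a`, now at position `i`, may move to position `i + 1`.  Its new
displacement to the right of its home position must be less than `⌈β⌉`, or equal to `⌈β⌉` with
`C₂ = 1`. -/
def MayAdvance (home : Fin n ≃ α) (β : ℝ) (a : α) (i : Fin n) (c₂ : Bool) : Prop :=
  ((i : ℕ) : ℤ) + 1 - ((home.symm a : ℕ) : ℤ) < ⌈β⌉ ∨
    (((i : ℕ) : ℤ) + 1 - ((home.symm a : ℕ) : ℤ) = ⌈β⌉ ∧ c₂ = true)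

/-- One step of the chain on linear extensions: the items at positions `i` and `i + 1` are
transposed if `C₁ = 1`, the order permits it and the Metropolis rule permits it. -/
def chainStep (home : Fin n ≃ α) (β : ℝ) (σ : Fin n ≃ α) (i : ℕ) (c₁ c₂ : Bool) : Fin n ≃ α :=
  if h : i + 1 < n then
    let x : Fin n := ⟨i, Nat.lt_of_succ_lt h⟩
    let y : Fin n := ⟨i + 1, h⟩
    if c₁ = true ∧ ¬ σ x ≤ σ y ∧ MayAdvance home β (σ x) x c₂ then (Equiv.swap x y).trans σ else σ
  else σ

/-- A bounding state: `none` is the symbol `θ`, and `B j = some a` says that item `a` is at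
position `j` or further to the left. -/
abbrev BState (n : ℕ) (α : Type*) : Type _ := Fin n → Option α

/-- The initial bounding state `(θ, …, θ, home(1))`. -/
def initBound (home : Fin n ≃ α) : BState n α :=
  fun i => if (i : ℕ) + 1 = n then some (home ⟨0, i.pos⟩) else none

/-- The transposition part of a step of the bounding chain.  The symbol `θ` is comparable to no
item and may always advance. -/
def boundSwap (home : Fin n ≃ α) (β : ℝ) (B : BState n α) (i : ℕ) (c₃ c₂ : Bool) : BState n α :=
  if h : i + 1 < n then
    let x : Fin n := ⟨i, Nat.lt_of_succ_lt h⟩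
    let y : Fin n := ⟨i + 1, h⟩
    if c₃ = true ∧ (¬ ∃ a b, B x = some a ∧ B y = some b ∧ a ≤ b) ∧
        (∀ a, B x = some a → MayAdvance home β a x c₂)
    then B ∘ Equiv.swap x y else B
  else B

/-- If the last position holds `θ`, it receives the next item in the order of `home`. -/
def boundFill (home : Fin n ≃ α) (B : BState n α) : BState n α :=
  fun k =>
    if (k : ℕ) + 1 = n ∧ B k = none then
      if h : Nat.card {i : Fin n // B i ≠ none} < n then
        some (home ⟨Nat.card {i : Fin n // B i ≠ none}, h⟩)
      else none
    else B k

/-- One step of the bounding chain. -/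
def boundStep (home : Fin n ≃ α) (β : ℝ) (B : BState n α) (i : ℕ) (c₃ c₂ : Bool) : BState n α :=
  boundFill home (boundSwap home β B i c₃ c₂)

/-- The coupling: the coin `C₁` of the state and the coin `C₃` of the bounding state are opposite
if `σ(i) = B(i + 1)`, and equal otherwise. -/
def coupledCoin (σ : Fin n ≃ α) (B : BState n α) (i : ℕ) (c₃ : Bool) : Bool :=
  if ∃ h : i + 1 < n, some (σ ⟨i, Nat.lt_of_succ_lt h⟩) = B ⟨i + 1, h⟩ then !c₃ else c₃

/-! ### Sampling linear extensions by non-Markovian coupling from the past -/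

/-- The position drawn in a step, uniform on `{0, …, n - 2}`. -/
def drawPos (n : ℕ) (τ : StepTape) : ℕ := readValue (unifStep (n - 1)) τ.1

/-- The coin `C₂` drawn in a step, Bernoulli with parameter `1 + β - ⌈β⌉`. -/
def drawC₂ (β : ℝ) (τ : StepTape) : Bool := readValue (bernStep (penalty β)) τ.2.2

/-- The number of random bits read in a step. -/
def stepBits (n : ℕ) (β : ℝ) (τ : StepTape) : ENNReal :=
  readCount (unifStep (n - 1)) τ.1 + 1 + readCount (bernStep (penalty β)) τ.2.2

/-- The bounding chain after `s` steps of a block. -/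
def boundRun (home : Fin n ≃ α) (β : ℝ) (τ : ℕ → StepTape) : ℕ → BState n α
  | 0 => initBound home
  | s + 1 =>
    boundStep home β (boundRun home β τ s) (drawPos n (τ s)) (τ s).2.1 (drawC₂ β (τ s))

/-- The chain started from `σ`, coupled to the bounding chain, after `s` steps of a block. -/
def coupledRun (home : Fin n ≃ α) (β : ℝ) (τ : ℕ → StepTape) (σ : Fin n ≃ α) : ℕ → (Fin n ≃ α)
  | 0 => σ
  | s + 1 =>
    chainStep home β (coupledRun home β τ σ s) (drawPos n (τ s))
      (coupledCoin (coupledRun home β τ σ s) (boundRun home β τ s) (drawPos n (τ s)) (τ s).2.1)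
      (drawC₂ β (τ s))

/-- The number of steps in block `j`, when block `0` has `t` steps. -/
def blockLength (t j : ℕ) : ℕ := t * 2 ^ j

/-- The bounding state at the end of block `j`. -/
def blockBound (home : Fin n ≃ α) (t : ℕ) (β : ℝ) (τ : ℕ → ℕ → StepTape) (j : ℕ) : BState n α :=
  boundRun home β (τ j) (blockLength t j)

/-- At the end of block `j` no `θ` is left in the bounding state. -/
def Coalesced (home : Fin n ≃ α) (t : ℕ) (β : ℝ) (τ : ℕ → ℕ → StepTape) (j : ℕ) : Prop :=
  ∀ i, blockBound home t β τ j i ≠ none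

/-- A bounding state without `θ`, read as an arrangement. -/
def toArrangement (home : Fin n ≃ α) (B : BState n α) : Fin n ≃ α :=
  if h : ∃ σ : Fin n ≃ α, ∀ i, B i = some (σ i) then h.choose else home

/-- Run the chain from `σ` through the blocks `j - 1, …, 1, 0`, in this order. -/
def replay (home : Fin n ≃ α) (t : ℕ) (β : ℝ) (τ : ℕ → ℕ → StepTape) :
    ℕ → (Fin n ≃ α) → (Fin n ≃ α)
  | 0, σ => σ
  | j + 1, σ => replay home t β τ j (coupledRun home β (τ j) σ (blockLength t j))

/-- The output of `Generate(t)`: find the first block `j` in which the bounding chain coalesces,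
take the state that it determines, and run it through the earlier blocks. -/
def generate (home : Fin n ≃ α) (t : ℕ) (β : ℝ) (τ : ℕ → ℕ → StepTape) : Fin n ≃ α :=
  let j := sInf {j | Coalesced home t β τ j}
  replay home t β τ j (toArrangement home (blockBound home t β τ j))

/-- The cost of `Generate(t)` when a step with step tape `x` costs `w x`: block `j` is drawn if no
earlier block has coalesced. -/
def generateCost (home : Fin n ≃ α) (t : ℕ) (w : StepTape → ENNReal) (β : ℝ)
    (τ : ℕ → ℕ → StepTape) : ENNReal :=
  ∑' j : ℕ, if ∀ j' < j, ¬ Coalesced home t β τ j' then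
    ∑ s ∈ Finset.range (blockLength t j), w (τ j s) else 0

/-! ### The continuous embedding and TPA -/

/-- The set `A(β)`: the vectors `x` whose rounded coordinates are the positions (numbered from `1`)
of the items in a linear extension, and in which no coordinate exceeds the home position of its item
by more than `β`. -/
def shell (home : Fin n ≃ α) (β : ℝ) : Set (α → ℝ) :=
  {x | (∃ σ : Fin n ≃ α, IsLinExt σ ∧ ∀ a, ⌈x a⌉ = ((σ.symm a : ℕ) : ℤ) + 1) ∧
    ∀ a, x a - (((home.symm a : ℕ) : ℝ) + 1) ≤ β}

/-- The uniform draw from `A(β)`, made from an arrangement `σ` with the weighted distribution and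
uniform numbers `u`. -/
def embed (home : Fin n ≃ α) (β : ℝ) (σ : Fin n ≃ α) (u : α → unitInterval) : α → ℝ :=
  fun a =>
    ((σ.symm a : ℕ) : ℝ) +
      if ((σ.symm a : ℕ) : ℤ) - ((home.symm a : ℕ) : ℤ) < ⌈β⌉ then (u a : ℝ)
      else penalty β * (u a : ℝ)

/-- The next value of the parameter: `inf {β' ∈ [0, n] : X ∈ A(β')}` for a draw `X` from `A(β)`. -/
def nextBeta (home : Fin n ≃ α) (t : ℕ) (β : ℝ) (ω : SampleTape α) : ℝ :=
  sInf {β' | β' ∈ Set.Icc (0 : ℝ) n ∧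
    embed home β (generate home t β ω.1) ω.2 ∈ shell home β'}

/-- The parameter after `s` samples of a run of TPA, which starts at `n` and stops at `0`. -/
def runBeta (home : Fin n ≃ α) (t : ℕ) (ω : ℕ → SampleTape α) : ℕ → ℝ
  | 0 => n
  | s + 1 =>
    if 0 < runBeta home t ω s then nextBeta home t (runBeta home t ω s) (ω s)
    else runBeta home t ω s

/-- The amount that a run adds to the counter `k`: one less than the number of its samples. -/
def runCount (home : Fin n ≃ α) (t : ℕ) (ω : ℕ → SampleTape α) : ℕ :=
  sInf {s | runBeta home t ω s ≤ 0} - 1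

/-- The cost of a run, when a step with step tape `x` costs `w β x` at parameter value `β`. -/
def runCost (home : Fin n ≃ α) (t : ℕ) (w : ℝ → StepTape → ENNReal) (ω : ℕ → SampleTape α) :
    ENNReal :=
  ∑' s : ℕ, if 0 < runBeta home t ω s then
    generateCost home t (w (runBeta home t ω s)) (runBeta home t ω s) (ω s).1 else 0

/-- The logarithm `k / r` of the estimate returned by TPA with `r` runs. -/
def tpaLog (home : Fin n ≃ α) (t r : ℕ) (ω : PhaseTape α) : ℝ :=
  ((∑ i ∈ Finset.range r, runCount home t (ω i) : ℕ) : ℝ) / r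

/-- The cost of TPA with `r` runs. -/
def tpaCost (home : Fin n ≃ α) (t r : ℕ) (w : ℝ → StepTape → ENNReal) (ω : PhaseTape α) :
    ENNReal :=
  ∑ i ∈ Finset.range r, runCost home t w (ω i)

/-! ### The two-phase algorithm -/

/-- The number of runs in the first phase. -/
def runs₁ (δ : ℝ) : ℕ := ⌈2 * Real.log (2 / δ)⌉₊

/-- The number of runs in the second phase, where `a` is the estimate of `ln L(P)` from the first
phase. -/
def runs₂ (ε δ a : ℝ) : ℕ :=
  ⌈2 * (a + √a + 2) * (Real.log (1 + ε) ^ 2 - Real.log (1 + ε) ^ 3)⁻¹ * Real.log (4 / δ)⌉₊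

/-- The number of runs that the algorithm makes in its second phase. -/
def secondRuns (home : Fin n ≃ α) (t : ℕ) (ε δ : ℝ) (ω : Tape α) : ℕ :=
  runs₂ ε δ (tpaLog home t (runs₁ δ) ω.1)

/-- The output of the two-phase algorithm. -/
def estimate (home : Fin n ≃ α) (t : ℕ) (ε δ : ℝ) (ω : Tape α) : ℝ :=
  Real.exp (tpaLog home t (secondRuns home t ε δ ω) ω.2)

/-- The cost of the two-phase algorithm. -/
def totalCost (home : Fin n ≃ α) (t : ℕ) (ε δ : ℝ) (w : ℝ → StepTape → ENNReal) (ω : Tape α) :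
    ENNReal :=
  tpaCost home t (runs₁ δ) w ω.1 + tpaCost home t (secondRuns home t ε δ ω) w ω.2

/-- The number of random bits read by the two-phase algorithm. -/
def totalBits (home : Fin n ≃ α) (t : ℕ) (ε δ : ℝ) (ω : Tape α) : ENNReal :=
  totalCost home t ε δ (fun β => stepBits n β) ω

/-- The number of steps of the bounding chain drawn by the two-phase algorithm. -/
def totalSteps (home : Fin n ≃ α) (t : ℕ) (ε δ : ℝ) (ω : Tape α) : ENNReal :=
  totalCost home t ε δ (fun _ _ => 1) ω

end Algorithm

/-- The explicit bound on the expected number of random bits, with `A = ln L(P)`. -/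
def bitBound (n : ℕ) (A ε δ : ℝ) : ℝ :=
  4.3 * (n : ℝ) ^ 3 * Real.log n * ((⌈Real.logb 2 n⌉ : ℝ) + 3) *
    (2 * (A + 1) * Real.log (2 / δ) +
      (A + 1) * (A + 3 * √(2 * A) + 2) *
        (Real.log (1 + ε) ^ 2 - Real.log (1 + ε) ^ 3)⁻¹ * Real.log (4 / δ))

end

end LinExt

/-!
The proof follows one weighted distribution through the algorithm. For a parameter `β`, let a linear
extension `σ` have the weight `∏ wt β d` over the displacements `d` of its items to the right of
their home positions, where `wt β d` is the length of the part of `(d - 1, d]` below `β`; this is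
the volume of the part of `A(β)` that rounds to `σ`. Let `Z(β)` be the total weight. Then
`Z(0) = 1`, as only `home` has no item displaced to the right, and `Z(n) = L(P)`.

*The sampler.* The chain satisfies detailed balance for these weights (`weight_mul_acceptance`,
`sum_weight_chainOp`). The bounding state says how far to the right each of its items can be in the
state, and the coupling preserves this (`Bounds.step`); so a block that ends without any `θ`
leads from every admissible state to the same one (`coupledRun_eq_of_coalesced`). Starting a
stationary chain far in the past shows that the sample has exactly the weighted distribution
(`blocksMeasure_generate`).

*Time to coalescence.* A `θ` may always advance, and a move backwards happens at most as often as in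
a lazy random walk that is reflected at the first position and absorbed at the last one. For a
decreasing function `g`, summation by parts bounds the drift of the sum of `g` over the symbols `θ`
by the generator of this walk (`thetaSum_walkOp`, `stepAvg_thetaSum_le`). The walk operator is
symmetric with an explicit positive eigenfunction, a cosine, so that the Schur test gives its norm;
hence some `θ` is left after `s` steps with probability at most `(n - 1) λ ^ s`, where `λ` is the
largest eigenvalue (`blockMeasure_theta_le`, `one_le_gap`). With the first block as long as
`ln n + 2` relaxation times, doubling the blocks costs a factor `1.2815` on average.

*A run.* If TPA is at `β`, the next parameter value is at most `b` with probability `Z(b) / Z(β)`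
(`totalWeight_mul_nextBeta_le`). Thus `Z` at the next value has an atom of mass `1 / Z(β)` at `1`,
where the run stops, and is uniform above (`lintegral_nextBeta`). Consequently `1 + ln Z` drops by
one on average with each sample, and `e ^ (θ s) Z ^ c` with `c + 1 = e ^ θ` is conserved. The first
fact bounds the expected number of samples in a run by `1 + ln L(P)` (`sum_alive_le`), the second
shows that the count of a run has at most the exponential moments of a Poisson variable with mean
`ln L(P)` (`lintegral_exp_runCount_le`).

*The two phases.* Write `A = ln L(P)`. By Chernoff bounds for sums of independent counts, the first
phase falls below `A - √A` with probability at most `δ / 2` (`first_phase_tail`); otherwise the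
second phase makes sufficiently many runs (`le_add_sqrt_add_two`) and misses `A` by `ln (1 + ε)`
with probability at most `δ / 2` (`second_phase_tail`). The last bound needs `A` to be bounded
below; if `L(P) = 1`, all counts vanish almost surely. The expected cost is bounded by the product
of the expected cost of a sample, of `1 + A`, and of the expected number of runs
(`lintegral_totalCost_le`), where Jensen's inequality takes care of `√Â₁`. A step reads
`⌈log₂ n⌉ + 5` random bits on average at most (`lintegral_stepBits_le`).
-/

set_option linter.unusedSectionVars false

namespace LinExt

noncomputable section

open scoped Classical

/-! ### Product measures -/

section Product

variable {X : Type*} [MeasurableSpace X] (μ : Measure X) [IsProbabilityMeasure μ]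

theorem measurable_update_prod (s : ℕ) :
    Measurable fun p : (ℕ → X) × X => Function.update p.1 s p.2 := by
  refine measurable_pi_lambda _ fun i => ?_
  by_cases h : i = s
  · subst h; simpa using measurable_snd
  · simp only [Function.update_of_ne h]
    exact (measurable_pi_apply i).comp measurable_fst

/-- Replacing one coordinate of a sequence of independent draws by a fresh independent draw does
not change the law. -/
theorem map_update_infinitePi (s : ℕ) :
    ((Measure.infinitePi fun _ : ℕ => μ).prod μ).map (fun p => Function.update p.1 s p.2) =
      Measure.infinitePi fun _ : ℕ => μ := by
  refine Measure.eq_infinitePi _ fun I t ht => ?_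
  have hbox : MeasurableSet (Set.pi (I : Set ℕ) t) :=
    MeasurableSet.pi (Finset.countable_toSet I) fun i hi => ht i
  rw [Measure.map_apply (measurable_update_prod s) hbox]
  have hset : (fun p : (ℕ → X) × X => Function.update p.1 s p.2) ⁻¹' (Set.pi (I : Set ℕ) t) =
      (Set.pi ((I.erase s : Finset ℕ) : Set ℕ) t) ×ˢ (if s ∈ I then t s else Set.univ) := by
    ext ⟨ω, x⟩
    simp only [Set.mem_preimage, Set.mem_pi, Finset.mem_coe, Set.mem_prod, Finset.mem_erase]
    constructor
    · intro h
      refine ⟨fun i hi => by simpa [Function.update_of_ne hi.1] using h i hi.2, ?_⟩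
      split_ifs with hs
      · simpa using h s hs
      · trivial
    · rintro ⟨h1, h2⟩ i hi
      by_cases his : i = s
      · subst his; simpa [hi] using h2
      · simpa [Function.update_of_ne his] using h1 i ⟨his, hi⟩
  rw [hset, Measure.prod_prod, Measure.infinitePi_pi _ fun i _ => ht i]
  split_ifs with hs
  · rw [mul_comm, Finset.mul_prod_erase I (fun i => μ (t i)) hs]
  · rw [measure_univ, mul_one, Finset.erase_eq_of_notMem hs]

/-- Integrating over a sequence of independent draws, a coordinate can be integrated separately
from a quantity that does not depend on it. -/
theorem lintegral_coord {Y : Type*} [MeasurableSpace Y] (s : ℕ) (G : (ℕ → X) → Y)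
    (hG : Measurable G) (hs : ∀ ω x, G (Function.update ω s x) = G ω) (F : Y → X → ENNReal)
    (hF : Measurable (Function.uncurry F)) :
    ∫⁻ ω, F (G ω) (ω s) ∂(Measure.infinitePi fun _ : ℕ => μ) =
      ∫⁻ ω, ∫⁻ x, F (G ω) x ∂μ ∂(Measure.infinitePi fun _ : ℕ => μ) := by
  have hm : Measurable fun ω : ℕ → X => F (G ω) (ω s) :=
    hF.comp (hG.prodMk (measurable_pi_apply s))
  have hm2 : Measurable fun p : (ℕ → X) × X => F (G p.1) p.2 :=
    hF.comp ((hG.comp measurable_fst).prodMk measurable_snd)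
  conv_lhs => rw [← map_update_infinitePi μ s]
  rw [lintegral_map hm (measurable_update_prod s)]
  simp only [hs, Function.update_self]
  exact lintegral_prod _ hm2.aemeasurable

/-- A quantity that does not depend on coordinate `s` is independent of that coordinate. -/
theorem lintegral_coord_mul (s : ℕ) (G : (ℕ → X) → ENNReal) (hG : Measurable G)
    (hs : ∀ ω x, G (Function.update ω s x) = G ω) (F : X → ENNReal) (hF : Measurable F) :
    ∫⁻ ω, G ω * F (ω s) ∂(Measure.infinitePi fun _ : ℕ => μ) =
      (∫⁻ ω, G ω ∂(Measure.infinitePi fun _ : ℕ => μ)) * ∫⁻ x, F x ∂μ := by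
  rw [lintegral_coord μ s G hG hs (fun y x => y * F x)
    (measurable_fst.mul (hF.comp measurable_snd))]
  simp_rw [lintegral_const_mul _ hF]
  rw [lintegral_mul_const _ hG]

theorem lintegral_eval (s : ℕ) (F : X → ENNReal) (hF : Measurable F) :
    ∫⁻ ω, F (ω s) ∂(Measure.infinitePi fun _ : ℕ => μ) = ∫⁻ x, F x ∂μ := by
  simpa using lintegral_coord_mul μ s (fun _ => 1) measurable_const (fun _ _ => rfl) F hF

theorem lintegral_prod_range (r : ℕ) (F : X → ENNReal) (hF : Measurable F) :
    ∫⁻ ω, ∏ i ∈ Finset.range r, F (ω i) ∂(Measure.infinitePi fun _ : ℕ => μ) =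
      (∫⁻ x, F x ∂μ) ^ r := by
  induction r with
  | zero => simp
  | succ r ih =>
    simp_rw [Finset.prod_range_succ]
    rw [lintegral_coord_mul μ r _ _ _ F hF, ih, pow_succ]
    · exact Finset.measurable_prod _ fun i _ => hF.comp (measurable_pi_apply i)
    · intro ω x
      refine Finset.prod_congr rfl fun i hi => ?_
      rw [Function.update_of_ne (Finset.mem_range.1 hi).ne]

end Product

/-! ### Reading random choices off a bit stream -/

section Bits

theorem coin_singleton (x : Bool) : coin {x} = 2⁻¹ := by
  unfold coin
  rw [PMF.toMeasure_apply_singleton _ _ (measurableSet_singleton x)]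
  simp

theorem lintegral_coin (g : Bool → ENNReal) :
    ∫⁻ c, g c ∂coin = 2⁻¹ * (g true + g false) := by
  rw [lintegral_fintype]
  simp [coin_singleton, ← add_mul, mul_comm]

/-- The number whose binary digits are the first `k` bits of `b`. -/
def bitsVal (b : ℕ → Bool) : ℕ → ℕ
  | 0 => 0
  | k + 1 => 2 * bitsVal b k + (b k).toNat

theorem bitsVal_lt (b : ℕ → Bool) (k : ℕ) : bitsVal b k < 2 ^ k := by
  induction k with
  | zero => simp [bitsVal]
  | succ k ih =>
    have := Bool.toNat_le (b k)
    simp only [bitsVal, pow_succ]; omega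

theorem dyadic_eq (b : ℕ → Bool) (k : ℕ) : dyadic b k = bitsVal b k * (1 / 2 : ℝ) ^ k := by
  induction k with
  | zero => simp [dyadic, bitsVal]
  | succ k ih =>
    have : dyadic b (k + 1) = dyadic b k + if b k then (1 / 2 : ℝ) ^ (k + 1) else 0 := by
      simp [dyadic, Finset.sum_range_succ]
    rw [this, ih]
    cases h : b k <;> simp [bitsVal, h, pow_succ] <;> ring

theorem bitsVal_update (b : ℕ → Bool) (s : ℕ) (x : Bool) {k : ℕ} (hk : k ≤ s) :
    bitsVal (Function.update b s x) k = bitsVal b k := by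
  induction k with
  | zero => rfl
  | succ k ih =>
    simp only [bitsVal]
    rw [ih (by omega), Function.update_of_ne (by omega)]

theorem measurable_bitsVal (k : ℕ) : Measurable fun b : ℕ → Bool => bitsVal b k := by
  induction k with
  | zero => exact measurable_const
  | succ k ih =>
    exact (Measurable.of_discrete (f := fun p : ℕ × Bool => 2 * p.1 + p.2.toNat)).comp
      (ih.prodMk (measurable_pi_apply k))

theorem measurable_dyadic (k : ℕ) : Measurable fun b : ℕ → Bool => dyadic b k := by
  simp only [dyadic_eq]
  exact ((Measurable.of_discrete (f := fun n : ℕ => (n : ℝ))).comp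
    (measurable_bitsVal k)).mul_const _

theorem bitStream_bitsVal_eq (k d : ℕ) (hd : d < 2 ^ k) :
    bitStream {b | bitsVal b k = d} = 2⁻¹ ^ k := by
  induction k generalizing d with
  | zero =>
    have : d = 0 := by simpa using hd
    subst this
    simp [bitsVal]
  | succ k ih =>
    have hset : {b : ℕ → Bool | bitsVal b (k + 1) = d} =
        {b | bitsVal b k = d / 2 ∧ b k = decide (d % 2 = 1)} := by
      ext b
      simp only [bitsVal, Set.mem_ofPred_eq]
      cases b k <;> simp <;> omega
    have hm : MeasurableSet {b : ℕ → Bool | bitsVal b k = d / 2} :=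
      measurable_bitsVal k (measurableSet_singleton _)
    have hm2 : MeasurableSet ({decide (d % 2 = 1)} : Set Bool) := measurableSet_singleton _
    have key := lintegral_coord_mul coin k
      (fun b => Set.indicator {b : ℕ → Bool | bitsVal b k = d / 2} 1 b)
      (measurable_one.indicator hm)
      (fun b x => by simp [Set.indicator, bitsVal_update b k x le_rfl])
      (Set.indicator {decide (d % 2 = 1)} 1) (measurable_one.indicator hm2)
    rw [lintegral_indicator_one hm, lintegral_indicator_one hm2, coin_singleton] at key
    have h1 : bitStream {b : ℕ → Bool | bitsVal b k = d / 2} = 2⁻¹ ^ k :=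
      ih _ (by rw [pow_succ] at hd; omega)
    unfold bitStream at h1
    rw [h1] at key
    rw [hset, pow_succ, ← key]
    have hm3 : MeasurableSet {b : ℕ → Bool | bitsVal b k = d / 2 ∧ b k = decide (d % 2 = 1)} :=
      hm.inter (measurable_pi_apply k (measurableSet_singleton _))
    rw [← lintegral_indicator_one hm3]
    unfold bitStream
    refine lintegral_congr fun b => ?_
    by_cases h1 : bitsVal b k = d / 2 <;> by_cases h2 : b k = decide (d % 2 = 1) <;>
      simp [Set.indicator, h1, h2]

/-- The first `k` bits, read as a number, are uniform on `{0, …, 2 ^ k - 1}`. -/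
theorem bitStream_bitsVal_mem (k : ℕ) (s : Finset ℕ) (hs : ∀ d ∈ s, d < 2 ^ k) :
    bitStream {b | bitsVal b k ∈ s} = s.card * 2⁻¹ ^ k := by
  have : {b : ℕ → Bool | bitsVal b k ∈ s} = ⋃ d ∈ s, {b | bitsVal b k = d} := by
    ext b; simp
  rw [this, measure_biUnion_finset]
  · rw [Finset.sum_congr rfl fun d hd => bitStream_bitsVal_eq k d (hs d hd)]
    simp
  · intro d _ d' _ hdd
    refine Set.disjoint_left.2 fun b hb hb' => hdd ?_
    exact (hb : bitsVal b k = d).symm.trans hb'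
  · exact fun d _ => measurable_bitsVal k (measurableSet_singleton _)

/-- The dyadic intervals given by longer and longer initial parts of a stream are nested. -/
theorem dyadic_mono (b : ℕ → Bool) {j k : ℕ} (h : j ≤ k) :
    dyadic b j ≤ dyadic b k ∧ dyadic b k + (1 / 2 : ℝ) ^ k ≤ dyadic b j + (1 / 2 : ℝ) ^ j := by
  induction k, h using Nat.le_induction with
  | base => simp
  | succ k _ ih =>
    have : dyadic b (k + 1) = dyadic b k + if b k then (1 / 2 : ℝ) ^ (k + 1) else 0 := by
      simp [dyadic, Finset.sum_range_succ]
    have hp : (0 : ℝ) < (1 / 2 : ℝ) ^ k := by positivity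
    rw [this, pow_succ]
    split_ifs
    · constructor <;> linarith [ih.1, ih.2]
    · constructor <;> linarith [ih.1, ih.2]

/-- Reading on after the value is determined does not change it. -/
theorem readValue_eq {γ : Type*} (f : ℝ → γ) (b : ℕ → Bool) {k : ℕ} (h : Decided f b k) :
    readValue f b = f (dyadic b k) := by
  have h0 : Decided f b (sInf {k | Decided f b k}) := Nat.sInf_mem (s := {k | Decided f b k}) ⟨k, h⟩
  have hle : sInf {k | Decided f b k} ≤ k := Nat.sInf_le (s := {k | Decided f b k}) h
  obtain ⟨h1, h2⟩ := dyadic_mono b hle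
  have hp : (0 : ℝ) < (1 / 2 : ℝ) ^ k := by positivity
  exact (h0 _ ⟨h1, by linarith⟩).symm

/-- If `f` takes the value `c` on an interval, the value read off a stream of fair bits is `c` with
at least the probability given by the length of the interval: count the dyadic intervals that lie
inside. -/
theorem le_bitStream_readValue {γ : Type*} (f : ℝ → γ) (c : γ) (x y : ℝ) (hx : 0 ≤ x)
    (hy : y ≤ 1) (hf : ∀ v ∈ Set.Ico x y, f v = c) :
    ENNReal.ofReal (y - x) ≤ bitStream {b | readValue f b = c} := by
  have key : ∀ k : ℕ, ENNReal.ofReal (y - x - 2 * (1 / 2 : ℝ) ^ k) ≤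
      bitStream {b | readValue f b = c} := by
    intro k
    have h2 : (0 : ℝ) < 2 ^ k := by positivity
    have hhalf : (1 / 2 : ℝ) ^ k = (2 ^ k)⁻¹ := by rw [one_div, inv_pow]
    set s : Finset ℕ := Finset.Ico ⌈x * 2 ^ k⌉₊ ⌊y * 2 ^ k⌋₊ with hs
    have hlt : ∀ d ∈ s, d < 2 ^ k := by
      intro d hd
      have h1 : d < ⌊y * 2 ^ k⌋₊ := (Finset.mem_Ico.1 hd).2
      have h3 : ⌊y * 2 ^ k⌋₊ ≤ ⌊((2 ^ k : ℕ) : ℝ)⌋₊ := by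
        refine Nat.floor_mono ?_
        push_cast
        nlinarith
      rw [Nat.floor_natCast] at h3
      omega
    have hsub : {b : ℕ → Bool | bitsVal b k ∈ s} ⊆ {b | readValue f b = c} := by
      intro b hb
      obtain ⟨h1, h3⟩ := Finset.mem_Ico.1 (show bitsVal b k ∈ s from hb)
      have h1' : x * 2 ^ k ≤ bitsVal b k := Nat.ceil_le.1 h1
      have hypos : 0 ≤ y * 2 ^ k := by
        by_contra hneg
        rw [Nat.floor_of_nonpos (by linarith)] at h3
        omega
      have h3' : (bitsVal b k : ℝ) + 1 ≤ y * 2 ^ k := by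
        have := Nat.floor_le hypos
        have h4 : ((bitsVal b k + 1 : ℕ) : ℝ) ≤ (⌊y * 2 ^ k⌋₊ : ℝ) := by exact_mod_cast h3
        push_cast at h4
        linarith
      have hd : dyadic b k = bitsVal b k / 2 ^ k := by
        rw [dyadic_eq, hhalf, div_eq_mul_inv]
      have hlow : x ≤ dyadic b k := by rw [hd, le_div_iff₀ h2]; exact h1'
      have hup : dyadic b k + (1 / 2 : ℝ) ^ k ≤ y := by
        rw [hd, hhalf, ← one_div, ← add_div, div_le_iff₀ h2]; exact h3'
      have hp : (0 : ℝ) < (1 / 2 : ℝ) ^ k := by positivity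
      have hc : f (dyadic b k) = c := hf _ ⟨hlow, by linarith⟩
      have hdec : Decided f b k := fun v hv => by
        rw [hc]; exact hf v ⟨hlow.trans hv.1, lt_of_lt_of_le hv.2 hup⟩
      exact (readValue_eq f b hdec).trans hc
    refine le_trans ?_ (measure_mono hsub)
    rw [bitStream_bitsVal_mem k s hlt]
    have hcard : (y * 2 ^ k - 1) - (x * 2 ^ k + 1) ≤ (s.card : ℝ) := by
      have h1 : y * 2 ^ k - 1 < ⌊y * 2 ^ k⌋₊ := Nat.sub_one_lt_floor _
      have h3 : (⌈x * 2 ^ k⌉₊ : ℝ) < x * 2 ^ k + 1 := Nat.ceil_lt_add_one (by positivity)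
      have h4 : (⌊y * 2 ^ k⌋₊ : ℝ) ≤ s.card + ⌈x * 2 ^ k⌉₊ := by
        have : ⌊y * 2 ^ k⌋₊ ≤ s.card + ⌈x * 2 ^ k⌉₊ := by rw [hs, Nat.card_Ico]; omega
        exact_mod_cast this
      linarith
    calc ENNReal.ofReal (y - x - 2 * (1 / 2 : ℝ) ^ k)
        ≤ ENNReal.ofReal (s.card * (1 / 2 : ℝ) ^ k) := by
          refine ENNReal.ofReal_le_ofReal ?_
          have : y - x - 2 * (1 / 2 : ℝ) ^ k =
              ((y * 2 ^ k - 1) - (x * 2 ^ k + 1)) * (1 / 2 : ℝ) ^ k := by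
            rw [hhalf]; field_simp; ring
          rw [this]
          exact mul_le_mul_of_nonneg_right hcard (by positivity)
      _ = s.card * 2⁻¹ ^ k := by
          rw [ENNReal.ofReal_mul (by positivity), ENNReal.ofReal_natCast,
            ENNReal.ofReal_pow (by norm_num)]
          congr 2
          rw [one_div, ENNReal.ofReal_inv_of_pos (by norm_num)]
          simp
  have hlim : Filter.Tendsto (fun k : ℕ => ENNReal.ofReal (y - x - 2 * (1 / 2 : ℝ) ^ k))
      Filter.atTop (nhds (ENNReal.ofReal (y - x - 2 * 0))) := by
    refine ENNReal.tendsto_ofReal (Filter.Tendsto.const_sub _ (Filter.Tendsto.const_mul _ ?_))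
    exact tendsto_pow_atTop_nhds_zero_of_lt_one (by norm_num) (by norm_num)
  have := le_of_tendsto' hlim key
  simpa using this

/-- The first index with property `P` is measurable; the value is `0` also where no index has the
property. -/
theorem measurable_sInf_nat {Ω : Type*} [MeasurableSpace Ω] (P : ℕ → Ω → Prop)
    (hP : ∀ k, MeasurableSet {x | P k x}) : Measurable fun x => sInf {k | P k x} := by
  refine measurable_to_countable' fun m => ?_
  have : (fun x => sInf {k | P k x}) ⁻¹' {m} =
      ({x | P m x} ∩ ⋂ j ∈ Finset.range m, {x | P j x}ᶜ) ∪
        (if m = 0 then ⋂ j, {x | P j x}ᶜ else ∅) := by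
    ext x
    simp only [Set.mem_preimage, Set.mem_singleton_iff, Set.mem_union, Set.mem_inter_iff,
      Set.mem_ofPred_eq, Set.mem_iInter, Set.mem_compl_iff, Finset.mem_range]
    constructor
    · intro h
      rcases Set.eq_empty_or_nonempty {k | P k x} with he | hne
      · right
        have hm : m = 0 := by rw [← h, he, Nat.sInf_empty]
        rw [if_pos hm]
        simp only [Set.mem_iInter, Set.mem_compl_iff, Set.mem_ofPred_eq]
        intro j hj
        have : j ∈ {k | P k x} := hj
        rw [he] at this
        exact this
      · left
        have hmem := Nat.sInf_mem hne
        rw [h] at hmem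
        refine ⟨hmem, fun j hj hPj => ?_⟩
        have : sInf {k | P k x} ≤ j := Nat.sInf_le hPj
        omega
    · rintro (⟨h1, h2⟩ | h)
      · refine le_antisymm (Nat.sInf_le h1) ?_
        by_contra hlt
        exact h2 _ (not_le.1 hlt) (Nat.sInf_mem (s := {k | P k x}) ⟨m, h1⟩)
      · split_ifs at h with hm
        · have : {k | P k x} = ∅ := by
            ext j
            simp only [Set.mem_iInter, Set.mem_compl_iff, Set.mem_ofPred_eq] at h
            simp [h j]
          rw [this, Nat.sInf_empty, hm]
        · exact absurd h (Set.notMem_empty x)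
  rw [this]
  refine MeasurableSet.union ((hP m).inter ?_) ?_
  · exact Finset.measurableSet_biInter _ fun j _ => (hP j).compl
  · split_ifs
    · exact MeasurableSet.iInter fun j => (hP j).compl
    · exact MeasurableSet.empty

theorem decided_iff {γ : Type*} (f : ℝ → γ) (b : ℕ → Bool) (k : ℕ) :
    Decided f b k ↔ bitsVal b k ∈ {d : ℕ | ∀ v ∈ Set.Ico (d * (1 / 2 : ℝ) ^ k)
      (d * (1 / 2 : ℝ) ^ k + (1 / 2 : ℝ) ^ k), f v = f (d * (1 / 2 : ℝ) ^ k)} := by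
  simp only [Decided, dyadic_eq, Set.mem_ofPred_eq]

theorem measurableSet_decided {γ : Type*} (f : ℝ → γ) (k : ℕ) :
    MeasurableSet {b | Decided f b k} := by
  simp only [decided_iff]
  exact measurable_bitsVal k (MeasurableSet.of_discrete)

theorem measurable_readValue {γ : Type*} [MeasurableSpace γ] (f : ℝ → γ) (hf : Measurable f) :
    Measurable (readValue f) := by
  have h1 : Measurable fun p : ℕ × (ℕ → Bool) => dyadic p.2 p.1 :=
    measurable_from_prod_countable_right fun k => measurable_dyadic k
  exact hf.comp (h1.comp ((measurable_sInf_nat (fun k b => Decided f b k)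
    (measurableSet_decided f)).prodMk measurable_id))

/-- The comparison of `u` with `p` is decided as soon as `p` is not in the interior of the dyadic
interval that is known to contain `u`. -/
theorem decided_bernStep_iff (p : ℝ) (b : ℕ → Bool) (k : ℕ) :
    Decided (bernStep p) b k ↔ p ≤ dyadic b k ∨ dyadic b k + (1 / 2 : ℝ) ^ k ≤ p := by
  have hp : (0 : ℝ) < (1 / 2 : ℝ) ^ k := by positivity
  constructor
  · intro h
    by_contra hc
    push Not at hc
    have h1 := h p ⟨hc.1.le, hc.2⟩
    simp [bernStep, hc.1] at h1
  · intro h v hv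
    simp only [bernStep, decide_eq_decide]
    rcases h with h | h
    · exact ⟨fun h' => absurd (hv.1.trans_lt h') (not_lt.2 h), fun h' => absurd h' (not_lt.2 h)⟩
    · exact ⟨fun _ => by linarith, fun _ => hv.2.trans_le h⟩

theorem measurableSet_decided_bernStep (k : ℕ) :
    MeasurableSet {q : ℝ × (ℕ → Bool) | Decided (bernStep q.1) q.2 k} := by
  simp only [decided_bernStep_iff]
  have h2 : Measurable fun q : ℝ × (ℕ → Bool) => dyadic q.2 k :=
    (measurable_dyadic k).comp measurable_snd
  exact (measurableSet_le measurable_fst h2).union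
    (measurableSet_le (h2.add_const _) measurable_fst)

theorem measurable_readValue_bernStep :
    Measurable fun q : ℝ × (ℕ → Bool) => readValue (bernStep q.1) q.2 := by
  have h1 : Measurable fun p : ℕ × (ℕ → Bool) => dyadic p.2 p.1 :=
    measurable_from_prod_countable_right fun k => measurable_dyadic k
  have h2 : Measurable fun q : ℝ × (ℕ → Bool) =>
      dyadic q.2 (sInf {k | Decided (bernStep q.1) q.2 k}) :=
    h1.comp ((measurable_sInf_nat (fun k (q : ℝ × (ℕ → Bool)) => Decided (bernStep q.1) q.2 k)
      measurableSet_decided_bernStep).prodMk measurable_snd)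
  refine measurable_to_bool ?_
  have : (fun q : ℝ × (ℕ → Bool) => readValue (bernStep q.1) q.2) ⁻¹' {true} =
      {q | dyadic q.2 (sInf {k | Decided (bernStep q.1) q.2 k}) < q.1} := by
    ext q; simp [readValue, bernStep]
  rw [this]
  exact measurableSet_lt h2 measurable_fst

theorem measurable_unifStep (m : ℕ) : Measurable (unifStep m) :=
  Nat.measurable_floor.comp (measurable_const.mul measurable_id)

theorem measurable_bernStep (p : ℝ) : Measurable (bernStep p) :=
  measurable_to_bool (by
    have : bernStep p ⁻¹' {true} = Set.Iio p := by ext; simp [bernStep]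
    rw [this]; exact measurableSet_Iio)

theorem measurable_readCount_bernStep :
    Measurable fun q : ℝ × (ℕ → Bool) => readCount (bernStep q.1) q.2 :=
  Measurable.tsum fun k =>
    Measurable.ite (measurableSet_decided_bernStep k) measurable_const measurable_const

theorem measurable_readCount {γ : Type*} (f : ℝ → γ) : Measurable (readCount f) :=
  Measurable.tsum fun k =>
    Measurable.ite (measurableSet_decided f k) measurable_const measurable_const

/-- A probability measure that dominates the weights of a probability vector is the discrete measure
with these weights. -/
theorem lintegral_eq_sum_of_le {Ω ι : Type*} [MeasurableSpace Ω] [MeasurableSpace ι]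
    [DiscreteMeasurableSpace ι] (ν : Measure Ω) [IsProbabilityMeasure ν] (T : Ω → ι)
    (hT : Measurable T) (s : Finset ι) (w : ι → ENNReal) (hw : ∑ i ∈ s, w i = 1)
    (h : ∀ i ∈ s, w i ≤ ν {x | T x = i}) (g : ι → ENNReal) :
    ∫⁻ x, g (T x) ∂ν = ∑ i ∈ s, w i * g i := by
  set ν' : Measure ι := ∑ i ∈ s, w i • Measure.dirac i with hν'
  have : IsProbabilityMeasure (ν.map T) := Measure.isProbabilityMeasure_map hT.aemeasurable
  have happ : ∀ A : Set ι, ν' A = ∑ i ∈ s, w i * A.indicator 1 i := by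
    intro A
    rw [hν', Measure.finsetSum_apply]
    exact Finset.sum_congr rfl fun i _ => by
      rw [Measure.smul_apply, Measure.dirac_apply' _ MeasurableSet.of_discrete, smul_eq_mul]
  have hle : ν' ≤ ν.map T := by
    refine Measure.le_iff.2 fun A hA => ?_
    rw [happ]
    have hfin : ∑ i ∈ s, w i * A.indicator 1 i ≤
        ∑ i ∈ s with i ∈ A, (ν.map T) {i} := by
      rw [Finset.sum_filter]
      refine Finset.sum_le_sum fun i hi => ?_
      by_cases hiA : i ∈ A
      · rw [if_pos hiA, Set.indicator_of_mem hiA, Pi.one_apply, mul_one,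
          Measure.map_apply hT MeasurableSet.of_discrete]
        exact h i hi
      · simp [hiA]
    refine hfin.trans ?_
    rw [sum_measure_singleton]
    exact measure_mono fun i hi => by simpa using (Finset.mem_filter.1 hi).2
  have huniv : ν' Set.univ = (ν.map T) Set.univ := by
    rw [happ, measure_univ]; simpa using hw
  have : IsFiniteMeasure ν' := ⟨by rw [huniv, measure_univ]; exact ENNReal.one_lt_top⟩
  have heq : ν' = ν.map T := Measure.eq_of_le_of_measure_univ_eq hle huniv
  rw [← lintegral_map (f := g) Measurable.of_discrete hT, ← heq, hν',
    lintegral_finsetSum_measure]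
  refine Finset.sum_congr rfl fun i _ => ?_
  rw [lintegral_smul_measure, lintegral_dirac' _ Measurable.of_discrete, smul_eq_mul]

/-- Reading off `unifStep m` gives each of the `m` values with probability `1 / m`: each value has
at least this probability, and the probabilities sum to `1`. -/
theorem lintegral_readValue_unifStep (m : ℕ) (hm : 0 < m) (g : ℕ → ENNReal) :
    ∫⁻ b, g (readValue (unifStep m) b) ∂bitStream =
      ∑ i ∈ Finset.range m, ENNReal.ofReal (1 / m) * g i := by
  have hm' : (0 : ℝ) < m := by exact_mod_cast hm
  refine lintegral_eq_sum_of_le bitStream _ (measurable_readValue _ (measurable_unifStep m)) _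
    (fun _ => ENNReal.ofReal (1 / m)) ?_ ?_ g
  · rw [Finset.sum_const, Finset.card_range, nsmul_eq_mul, ← ENNReal.ofReal_natCast,
      ← ENNReal.ofReal_mul hm'.le, mul_one_div_cancel hm'.ne', ENNReal.ofReal_one]
  · intro i hi
    have hi' : (i : ℝ) + 1 ≤ m := by exact_mod_cast Finset.mem_range.1 hi
    have := le_bitStream_readValue (unifStep m) i (i / m) ((i + 1) / m) (by positivity)
      (by rwa [div_le_one hm']) (fun v hv => by
        have h1 := (div_le_iff₀ hm').1 hv.1
        have h2 := (lt_div_iff₀ hm').1 hv.2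
        rw [unifStep, Nat.floor_eq_iff (by nlinarith [(Nat.cast_nonneg i : (0 : ℝ) ≤ i)])]
        constructor <;> linarith)
    convert this using 2
    ring

theorem lintegral_readValue_bernStep (p : ℝ) (hp0 : 0 ≤ p) (hp1 : p ≤ 1) (g : Bool → ENNReal) :
    ∫⁻ b, g (readValue (bernStep p) b) ∂bitStream =
      ENNReal.ofReal p * g true + ENNReal.ofReal (1 - p) * g false := by
  have := lintegral_eq_sum_of_le bitStream _ (measurable_readValue _ (measurable_bernStep p))
    Finset.univ (fun c => if c then ENNReal.ofReal p else ENNReal.ofReal (1 - p)) ?_ ?_ g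
  · simpa using this
  · simp only [Fintype.sum_bool, if_true]
    rw [if_neg (by simp), ← ENNReal.ofReal_add hp0 (by linarith)]
    simp
  · intro c _
    cases c
    · simpa using le_bitStream_readValue (bernStep p) false p 1 hp0 le_rfl
        (fun v hv => by simpa [bernStep] using hv.1)
    · simpa using le_bitStream_readValue (bernStep p) true 0 p le_rfl hp1
        (fun v hv => by simpa [bernStep] using hv.2)

/-- If `f` is constant on all but the dyadic intervals of level `k` with numbers in `s`, then `k`
bits are not enough with probability at most `#s / 2 ^ k`. -/
theorem bitStream_not_decided_le {γ : Type*} (f : ℝ → γ) (k : ℕ) (s : Finset ℕ)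
    (hs : ∀ d : ℕ, d < 2 ^ k → d ∉ s → ∀ v ∈ Set.Ico (d * (1 / 2 : ℝ) ^ k)
      (d * (1 / 2 : ℝ) ^ k + (1 / 2 : ℝ) ^ k), f v = f (d * (1 / 2 : ℝ) ^ k)) :
    bitStream {b | ¬ Decided f b k} ≤ s.card * 2⁻¹ ^ k := by
  have hsub : {b | ¬ Decided f b k} ⊆ {b : ℕ → Bool | bitsVal b k ∈ s.filter (· < 2 ^ k)} := by
    intro b hb
    by_contra hc
    refine hb ((decided_iff f b k).2 (hs _ (bitsVal_lt b k) fun hmem => hc ?_))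
    exact Finset.mem_filter.2 ⟨hmem, bitsVal_lt b k⟩
  refine (measure_mono hsub).trans ?_
  rw [bitStream_bitsVal_mem k _ fun d hd => (Finset.mem_filter.1 hd).2]
  gcongr
  exact Finset.filter_subset _ _

theorem lintegral_readCount {γ : Type*} (f : ℝ → γ) :
    ∫⁻ b, readCount f b ∂bitStream = ∑' k, bitStream {b | ¬ Decided f b k} := by
  unfold readCount
  rw [lintegral_tsum fun k => (Measurable.ite (measurableSet_decided f k) measurable_const
    measurable_const).aemeasurable]
  refine tsum_congr fun k => ?_
  have hm : MeasurableSet {b | ¬ Decided f b k} := (measurableSet_decided f k).compl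
  rw [← lintegral_indicator_one hm]
  refine lintegral_congr fun b => ?_
  by_cases h : Decided f b k <;> simp [h, Set.indicator]

theorem tsum_inv_two_pow : ∑' k : ℕ, (2⁻¹ : ENNReal) ^ k = 2 := by
  rw [ENNReal.tsum_geometric, ENNReal.one_sub_inv_two, inv_inv]

/-- A Bernoulli coin costs at most two bits on average, whatever its parameter `p` is: for each `k`,
only one dyadic interval of level `k` contains `p` in its interior. -/
theorem lintegral_readCount_bernStep_le (p : ℝ) :
    ∫⁻ b, readCount (bernStep p) b ∂bitStream ≤ 2 := by
  rw [lintegral_readCount, ← tsum_inv_two_pow]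
  refine ENNReal.tsum_le_tsum fun k => ?_
  have h := bitStream_not_decided_le (bernStep p) k {⌊p * 2 ^ k⌋₊} ?_
  · simpa using h
  · intro d _ hd v hv
    have hp2 : (0 : ℝ) < 2 ^ k := by positivity
    have hhalf : (1 / 2 : ℝ) ^ k = (2 ^ k)⁻¹ := by rw [one_div, inv_pow]
    simp only [bernStep, decide_eq_decide]
    refine ⟨fun h => hv.1.trans_lt h, fun h => ?_⟩
    rw [hhalf, ← div_eq_mul_inv] at h hv
    by_contra hc
    push Not at hc
    apply hd
    rw [Finset.mem_singleton]
    symm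
    have h3 : p < (d + 1) / 2 ^ k := by
      have := hc.trans_lt hv.2
      rwa [← one_div, ← add_div] at this
    rw [div_lt_iff₀ hp2] at h
    rw [lt_div_iff₀ hp2] at h3
    rw [Nat.floor_eq_iff (by nlinarith [(Nat.cast_nonneg d : (0 : ℝ) ≤ d)])]
    exact ⟨h.le, h3⟩

/-- A dyadic interval on which `unifStep m` is not constant contains a jump `i / m`. -/
theorem exists_floor_eq_of_unifStep_ne (m k d : ℕ) (hm : 0 < m) (hd : d < 2 ^ k) (v : ℝ)
    (hv : v ∈ Set.Ico (d * (1 / 2 : ℝ) ^ k) (d * (1 / 2 : ℝ) ^ k + (1 / 2 : ℝ) ^ k))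
    (hne : unifStep m v ≠ unifStep m (d * (1 / 2 : ℝ) ^ k)) :
    ∃ i ∈ Finset.Ico 1 m, ⌊(i : ℝ) / m * 2 ^ k⌋₊ = d := by
  have hm' : (0 : ℝ) < m := by exact_mod_cast hm
  have hp2 : (0 : ℝ) < 2 ^ k := by positivity
  have hhalf : (1 / 2 : ℝ) ^ k = (2 ^ k)⁻¹ := by rw [one_div, inv_pow]
  rw [hhalf, ← div_eq_mul_inv] at hv hne
  have hd0 : (0 : ℝ) ≤ d / 2 ^ k := by positivity
  have hv0 : 0 ≤ v := hd0.trans hv.1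
  have hle : unifStep m (d / 2 ^ k) ≤ unifStep m v :=
    Nat.floor_mono (mul_le_mul_of_nonneg_left hv.1 hm'.le)
  have hlt : unifStep m (d / 2 ^ k) < unifStep m v := lt_of_le_of_ne hle (Ne.symm hne)
  set i := unifStep m v with hi
  have hi1 : (i : ℝ) ≤ m * v := Nat.floor_le (mul_nonneg hm'.le hv0)
  have hi2 : m * ((d : ℝ) / 2 ^ k) < i := (Nat.floor_lt (mul_nonneg hm'.le hd0)).1 hlt
  have hv1 : v < (d + 1) / 2 ^ k := by
    have := hv.2
    rwa [← one_div, ← add_div] at this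
  have hd1 : ((d : ℝ) + 1) / 2 ^ k ≤ 1 := by
    rw [div_le_one hp2]
    exact_mod_cast hd
  have him : (i : ℝ) / m ≤ v := by rw [div_le_iff₀ hm']; linarith
  refine ⟨i, Finset.mem_Ico.2 ⟨by omega, ?_⟩, ?_⟩
  · have : (i : ℝ) < m := by
      have := (div_lt_iff₀ hm').1 (him.trans_lt (hv1.trans_le hd1))
      linarith
    exact_mod_cast this
  · rw [Nat.floor_eq_iff (by positivity)]
    constructor
    · have : (d : ℝ) / 2 ^ k ≤ i / m := by
        rw [le_div_iff₀ hm']; linarith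
      rwa [div_le_iff₀ hp2] at this
    · have : (i : ℝ) / m < (d + 1) / 2 ^ k := him.trans_lt hv1
      rwa [lt_div_iff₀ hp2] at this

/-- The expected number of bits read for a uniform choice among `m` values: after `k ≥ K` bits, at
most `m - 1` of the `2 ^ k` dyadic intervals contain a jump. -/
theorem lintegral_readCount_unifStep_le (m K : ℕ) (hm : 0 < m) :
    ∫⁻ b, readCount (unifStep m) b ∂bitStream ≤ K + (m - 1 : ℕ) * (2 * 2⁻¹ ^ K) := by
  have hsplit := Summable.sum_add_tsum_nat_add' (k := K)
    (f := fun k => bitStream {b | ¬ Decided (unifStep m) b k}) ENNReal.summable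
  rw [lintegral_readCount, ← hsplit]
  refine add_le_add ?_ ?_
  · calc ∑ k ∈ Finset.range K, bitStream {b | ¬ Decided (unifStep m) b k}
        ≤ ∑ k ∈ Finset.range K, 1 := Finset.sum_le_sum fun _ _ => prob_le_one
      _ = K := by simp
  · have hterm : ∀ k : ℕ, bitStream {b | ¬ Decided (unifStep m) b (k + K)} ≤
        (m - 1 : ℕ) * (2⁻¹ ^ k * 2⁻¹ ^ K) := by
      intro k
      rw [← pow_add]
      generalize k + K = l
      set s := (Finset.Ico 1 m).image fun i : ℕ => ⌊(i : ℝ) / m * 2 ^ l⌋₊ with hs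
      refine (bitStream_not_decided_le (unifStep m) l s fun d hlt hd v hv => ?_).trans ?_
      · by_contra hne
        refine hd ?_
        rw [hs]
        exact Finset.mem_image.2 (exists_floor_eq_of_unifStep_ne m l d hm hlt v hv hne)
      · have hcard : s.card ≤ m - 1 := by
          rw [hs]; exact Finset.card_image_le.trans (by simp)
        exact mul_le_mul_left (Nat.cast_le.2 hcard) _
    refine (ENNReal.tsum_le_tsum hterm).trans_eq ?_
    rw [ENNReal.tsum_mul_left, ENNReal.tsum_mul_right, tsum_inv_two_pow]

end Bits

/-! ### The bounding chain bounds the coupled chain -/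

section Coupling

variable {n : ℕ} {α : Type*} [PartialOrder α]

/-- The arrangements in the support of the weighted distribution: linear extensions in which no item
stands more than `⌈β⌉` positions to the right of its home. -/
def InSupport (home : Fin n ≃ α) (β : ℝ) (σ : Fin n ≃ α) : Prop :=
  IsLinExt σ ∧ ∀ i : Fin n, ((i : ℕ) : ℤ) - ((home.symm (σ i) : ℕ) : ℤ) ≤ ⌈β⌉

/-- The invariants of the bounding chain: the items in `B` are the first `q` items of `home`, each
occurs once, and comparable items stand in the right order.  If an item stands to the right of an
item that comes later in `home`, then it got there by advancing, so that it is displaced by at most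
`⌈β⌉`; an item that has entered at the last position and has not been overtaken may be displaced by
more. -/
structure BoundInv (home : Fin n ≃ α) (β : ℝ) (q : ℕ) (B : BState n α) : Prop where
  items : ∀ a, (∃ j, B j = some a) ↔ (home.symm a : ℕ) < q
  inj : ∀ j k a, B j = some a → B k = some a → j = k
  ord : ∀ j k a b, B j = some a → B k = some b → a ≤ b → j ≤ k
  disp : ∀ j k b c, B j = some b → B k = some c → j < k → home.symm c < home.symm b →
    ((k : ℕ) : ℤ) - ((home.symm c : ℕ) : ℤ) ≤ ⌈β⌉

theorem BoundInv.card_eq {home : Fin n ≃ α} {β : ℝ} {q : ℕ} {B : BState n α}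
    (h : BoundInv home β q B) (hq : q ≤ n) : Nat.card {i : Fin n // B i ≠ none} = q := by
  have hne : ∀ i : {i : Fin n // B i ≠ none}, ∃ a, B i = some a := fun i =>
    Option.ne_none_iff_exists'.1 i.2
  choose f hf using hne
  have hlt : ∀ i, (home.symm (f i) : ℕ) < q := fun i => (h.items _).1 ⟨_, hf i⟩
  let g : {i : Fin n // B i ≠ none} → Fin q := fun i => ⟨home.symm (f i), hlt i⟩
  have hg : Function.Bijective g := by
    constructor
    · intro i j hij
      have h1 : home.symm (f i) = home.symm (f j) := Fin.ext (Fin.mk.inj_iff.1 hij)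
      have h2 : f i = f j := home.symm.injective h1
      exact Subtype.ext (h.inj _ _ _ (hf i) (by rw [h2]; exact hf j))
    · intro k
      obtain ⟨j, hj⟩ := (h.items (home ⟨k, k.2.trans_le hq⟩)).2 (by simp)
      have hj' : B j ≠ none := by simp [hj]
      refine ⟨⟨j, hj'⟩, ?_⟩
      have h3 : f ⟨j, hj'⟩ = home ⟨k, k.2.trans_le hq⟩ :=
        Option.some.inj ((hf ⟨j, hj'⟩).symm.trans hj)
      exact Fin.ext (by simp [g, h3])
  rw [Nat.card_eq_of_bijective g hg, Nat.card_eq_fintype_card, Fintype.card_fin]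

theorem BoundInv.init (home : Fin n ≃ α) (β : ℝ) (hn : 0 < n) :
    BoundInv home β 1 (initBound home) := by
  have key : ∀ (j : Fin n) a, initBound home j = some a ↔
      (j : ℕ) + 1 = n ∧ home ⟨0, hn⟩ = a := by
    intro j a
    unfold initBound
    split_ifs with h <;> simp [h]
  refine ⟨fun a => ?_, fun j k a hj hk => ?_, fun j k a b hj hk _ => ?_,
    fun j k b c hj hk hlt _ => ?_⟩
  · constructor
    · rintro ⟨j, hj⟩
      rw [← ((key _ _).1 hj).2]; simp
    · intro h
      refine ⟨⟨n - 1, by omega⟩, (key _ _).2 ⟨by simp; omega, ?_⟩⟩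
      rw [← home.apply_symm_apply a]
      congr 1
      exact Fin.ext (by simp; omega)
  · exact Fin.ext (by have := ((key _ _).1 hj).1; have := ((key _ _).1 hk).1; omega)
  · exact Fin.le_def.2 (by have := ((key _ _).1 hj).1; have := ((key _ _).1 hk).1; omega)
  · have := ((key _ _).1 hj).1; have := ((key _ _).1 hk).1; have := Fin.lt_def.1 hlt; omega

theorem swap_lt_swap_or (x y : Fin n) (hxy : (y : ℕ) = x + 1) (j k : Fin n) (hjk : j < k) :
    Equiv.swap x y j < Equiv.swap x y k ∨ (j = x ∧ k = y) := by
  simp only [Equiv.swap_apply_def, Fin.ext_iff]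
  rw [Fin.lt_def] at hjk ⊢
  split_ifs <;> omega

theorem BoundInv.swap {home : Fin n ≃ α} {β : ℝ} {q : ℕ} {B : BState n α}
    (h : BoundInv home β q B) (x y : Fin n) (hxy : (y : ℕ) = x + 1)
    (hcomp : ¬ ∃ a b, B x = some a ∧ B y = some b ∧ a ≤ b)
    (hadv : ∀ a, B x = some a → (y : ℤ) - ((home.symm a : ℕ) : ℤ) ≤ ⌈β⌉) :
    BoundInv home β q (B ∘ Equiv.swap x y) := by
  -- the swap preserves the order of all pairs of positions except `(x, y)`
  have hsw : ∀ j k : Fin n, j < k → Equiv.swap x y j < Equiv.swap x y k ∨ (j = x ∧ k = y) :=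
    fun j k hjk => swap_lt_swap_or x y hxy j k hjk
  refine ⟨fun a => ?_, fun j k a hj hk => ?_, fun j k a b hj hk hab => ?_,
    fun j k b c hj hk hjk hbc => ?_⟩
  · rw [← h.items a]
    constructor
    · rintro ⟨j, hj⟩; exact ⟨_, hj⟩
    · rintro ⟨j, hj⟩; exact ⟨Equiv.swap x y j, by simpa using hj⟩
  · exact (Equiv.swap x y).injective (h.inj _ _ a hj hk)
  · by_contra hlt
    rcases hsw k j (not_le.1 hlt) with h1 | ⟨rfl, rfl⟩
    · exact absurd (h.ord _ _ _ _ hj hk hab) (not_le.2 h1)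
    · refine hcomp ⟨a, b, by simpa using hj, by simpa using hk, hab⟩
  · rcases hsw j k hjk with h1 | ⟨rfl, rfl⟩
    · have h2 := h.disp _ _ _ _ hj hk h1 hbc
      by_cases hkx : k = x
      · subst hkx
        rw [Equiv.swap_apply_left] at h2
        omega
      · by_cases hky : k = y
        · subst hky
          have hx : B x = some c := by simpa using hk
          exact hadv c hx
        · rwa [Equiv.swap_apply_of_ne_of_ne hkx hky] at h2
    · exact hadv c (by simpa using hk)

theorem MayAdvance.le {home : Fin n ≃ α} {β : ℝ} {a : α} {i : Fin n} {c₂ : Bool}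
    (h : MayAdvance home β a i c₂) :
    ((i : ℕ) : ℤ) + 1 - ((home.symm a : ℕ) : ℤ) ≤ ⌈β⌉ := by
  rcases h with h | h
  · exact h.le
  · exact h.1.le

theorem BoundInv.boundSwap {home : Fin n ≃ α} {β : ℝ} {q : ℕ} {B : BState n α}
    (h : BoundInv home β q B) (i : ℕ) (c₃ c₂ : Bool) :
    BoundInv home β q (boundSwap home β B i c₃ c₂) := by
  unfold LinExt.boundSwap
  split_ifs with h1
  · dsimp only
    split_ifs with h2
    · refine h.swap _ _ rfl h2.2.1 fun a ha => ?_
      have := (h2.2.2 a ha).le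
      push_cast
      exact this
    · exact h
  · exact h

/-- An item that enters comes later in `home` than all items present, so it is below none of them,
and standing at the last position it is to the right of all of them. -/
theorem BoundInv.boundFill {home : Fin n ≃ α} (hhome : IsLinExt home) {β : ℝ} {q : ℕ}
    {B : BState n α} (h : BoundInv home β q B) (hq : q ≤ n) (hn : 0 < n) :
    ∃ q', q' ≤ n ∧ BoundInv home β q' (boundFill home B) ∧
      boundFill home B ⟨n - 1, by omega⟩ ≠ none := by
  have hcard := h.card_eq hq
  by_cases hlast : B ⟨n - 1, by omega⟩ = none
  · -- the last position holds `θ`, hence fewer than `n` items are present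
    have hqn : q < n := by
      by_contra hge
      have hqe : q = n := by omega
      have hall : ∀ k : Fin n, ∃ j, B j = some (home k) := fun k =>
        (h.items _).2 (by simp only [Equiv.symm_apply_apply]; omega)
      choose f hf using hall
      have hfi : Function.Injective f := fun k l hkl => by
        have h1 := hf k
        rw [hkl, hf l] at h1
        exact home.injective (Option.some.inj h1).symm
      obtain ⟨k, hk⟩ := (Finite.injective_iff_surjective.1 hfi) ⟨n - 1, by omega⟩
      have := hf k
      rw [hk, hlast] at this
      exact absurd this (by simp)
    have hB : ∀ (j : Fin n) a, LinExt.boundFill home B j = some a ↔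
        B j = some a ∨ ((j : ℕ) + 1 = n ∧ home ⟨q, hqn⟩ = a) := by
      intro j a
      unfold LinExt.boundFill
      rw [dif_pos (by rw [hcard]; exact hqn)]
      simp only [hcard]
      by_cases hj : (j : ℕ) + 1 = n
      · have hjl : j = ⟨n - 1, by omega⟩ := Fin.ext (by simp; omega)
        have hBj : B j = none := by rw [hjl]; exact hlast
        simp [hj, hBj]
      · simp [hj]
    refine ⟨q + 1, hqn, ⟨fun a => ?_, fun j k a hj hk => ?_, fun j k a b hj hk hab => ?_,
      fun j k b c hj hk hjk hbc => ?_⟩, ?_⟩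
    · constructor
      · rintro ⟨j, hj⟩
        rcases (hB _ _).1 hj with h1 | ⟨_, rfl⟩
        · have := (h.items a).1 ⟨j, h1⟩; omega
        · simp
      · intro ha
        rcases Nat.lt_succ_iff_lt_or_eq.1 ha with h1 | h1
        · obtain ⟨j, hj⟩ := (h.items a).2 h1
          exact ⟨j, (hB _ _).2 (Or.inl hj)⟩
        · refine ⟨⟨n - 1, by omega⟩, (hB _ _).2 (Or.inr ⟨by simp; omega, ?_⟩)⟩
          rw [← home.apply_symm_apply a]
          congr 1
          exact Fin.ext h1.symm
    · have hnew : ∀ l, B l = some a → home ⟨q, hqn⟩ ≠ a := by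
        rintro l hl rfl
        have := (h.items _).1 ⟨l, hl⟩
        simp at this
      rcases (hB _ _).1 hj with h1 | ⟨h1, h2⟩ <;> rcases (hB _ _).1 hk with h3 | ⟨h3, h4⟩
      · exact h.inj _ _ a h1 h3
      · exact absurd h4 (hnew _ h1)
      · exact absurd h2 (hnew _ h3)
      · exact Fin.ext (by omega)
    · rcases (hB _ _).1 hk with h3 | ⟨h3, h4⟩
      · rcases (hB _ _).1 hj with h1 | ⟨h1, rfl⟩
        · exact h.ord _ _ _ _ h1 h3 hab
        · -- the new item comes after all present items in `home`
          have hb := (h.items b).1 ⟨k, h3⟩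
          have := hhome ⟨q, hqn⟩ (home.symm b) (by simpa using hab)
          have := Fin.le_def.1 this
          simp only at this
          omega
      · exact Fin.le_def.2 (by omega)
    · rcases (hB _ _).1 hj with h1 | ⟨h1, rfl⟩
      · rcases (hB _ _).1 hk with h3 | ⟨h3, rfl⟩
        · exact h.disp _ _ _ _ h1 h3 hjk hbc
        · have hb := (h.items b).1 ⟨j, h1⟩
          have := Fin.lt_def.1 hbc
          simp only [Equiv.symm_apply_apply] at this
          omega
      · have := Fin.lt_def.1 hjk; omega
    · have := (hB ⟨n - 1, by omega⟩ (home ⟨q, hqn⟩)).2 (Or.inr ⟨by simp; omega, rfl⟩)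
      rw [this]; simp
  · have hB : LinExt.boundFill home B = B := by
      funext j
      unfold LinExt.boundFill
      rw [if_neg]
      rintro ⟨h1, h2⟩
      apply hlast
      rw [← h2]
      congr 1
      exact Fin.ext (by simp; omega)
    rw [hB]
    exact ⟨q, hq, h, hlast⟩

/-- The invariants hold for some number of items, and the last position holds an item. -/
def GoodBound (home : Fin n ≃ α) (β : ℝ) (B : BState n α) : Prop :=
  (∃ q ≤ n, BoundInv home β q B) ∧ ∀ j : Fin n, (j : ℕ) + 1 = n → B j ≠ none

theorem GoodBound.init (home : Fin n ≃ α) (β : ℝ) (hn : 0 < n) :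
    GoodBound home β (initBound home) :=
  ⟨⟨1, hn, BoundInv.init home β hn⟩, fun j hj => by simp [initBound, hj]⟩

theorem GoodBound.boundStep {home : Fin n ≃ α} (hhome : IsLinExt home) {β : ℝ} {B : BState n α}
    (h : GoodBound home β B) (i : ℕ) (c₃ c₂ : Bool) (hn : 0 < n) :
    GoodBound home β (boundStep home β B i c₃ c₂) := by
  obtain ⟨⟨q, hq, hB⟩, _⟩ := h
  obtain ⟨q', hq', h1, h2⟩ := (hB.boundSwap i c₃ c₂).boundFill hhome hq hn
  refine ⟨⟨q', hq', h1⟩, fun j hj => ?_⟩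
  have : j = ⟨n - 1, by omega⟩ := Fin.ext (by simp; omega)
  rw [this]
  exact h2

theorem swap_trans_symm_apply (σ : Fin n ≃ α) (x y : Fin n) (a : α) :
    ((Equiv.swap x y).trans σ).symm a = Equiv.swap x y (σ.symm a) := by
  simp

/-- A transposition of adjacent incomparable items leads from linear extensions to linear
extensions. -/
theorem IsLinExt.swap {σ : Fin n ≃ α} (h : IsLinExt σ) (x y : Fin n) (hxy : (y : ℕ) = x + 1)
    (hc : ¬ σ x ≤ σ y) : IsLinExt ((Equiv.swap x y).trans σ) := by
  intro i j hij
  simp only [Equiv.trans_apply] at hij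
  have h1 := h _ _ hij
  by_contra hlt
  rw [not_le] at hlt
  have hcase : (i = y ∧ j = x) ∨ Equiv.swap x y j < Equiv.swap x y i := by
    rcases swap_lt_swap_or x y hxy j i hlt with h2 | ⟨h2, h3⟩
    · exact Or.inr h2
    · exact Or.inl ⟨h3, h2⟩
  rcases hcase with ⟨rfl, rfl⟩ | h2
  · simp at hij; exact hc hij
  · exact absurd h1 (not_le.2 h2)

/-- The Metropolis rule keeps the displacements at most `⌈β⌉`. -/
theorem InSupport.chainStep {home : Fin n ≃ α} {β : ℝ} {σ : Fin n ≃ α}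
    (h : InSupport home β σ) (i : ℕ) (c₁ c₂ : Bool) :
    InSupport home β (chainStep home β σ i c₁ c₂) := by
  unfold LinExt.chainStep
  split_ifs with h1
  · dsimp only
    split_ifs with h2
    · refine ⟨h.1.swap _ _ rfl h2.2.1, fun j => ?_⟩
      simp only [Equiv.trans_apply, Equiv.swap_apply_def]
      have h3 := h2.2.2.le
      split_ifs with hj hj
      · have := h.2 ⟨i + 1, h1⟩
        subst hj
        simp only at this ⊢
        omega
      · subst hj
        simp only at h3 ⊢
        omega
      · exact h.2 j
    · exact h
  · exact h

/-- In `σ`, the item `a` is at position `j` or further to the left if `B j = a`. -/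
def Bounds (B : BState n α) (σ : Fin n ≃ α) : Prop :=
  ∀ j a, B j = some a → σ.symm a ≤ j

/-- An item that enters at the last position is no restriction on the state. -/
theorem Bounds.boundFill {home : Fin n ≃ α} {B : BState n α} {σ : Fin n ≃ α} (h : Bounds B σ) :
    Bounds (boundFill home B) σ := by
  intro j a hj
  by_cases hlast : (j : ℕ) + 1 = n
  · have := (σ.symm a).2
    exact Fin.le_def.2 (by omega)
  · refine h j a ?_
    simpa [LinExt.boundFill, hlast] using hj

/-- If the bounding chain moves an item from `y` to `x`, and that item is at `y` in the state, then
the state may make the same move. -/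
theorem allowed_of_bound_allowed {home : Fin n ≃ α} (hhome : IsLinExt home) {β : ℝ} {q : ℕ}
    {B : BState n α} {σ : Fin n ≃ α} (hB : BoundInv home β q B) (hσ : InSupport home β σ)
    (hb : Bounds B σ) (x y : Fin n) (hxy : (y : ℕ) = x + 1) (hy : B y = some (σ y))
    (hcomp : ¬ ∃ a b, B x = some a ∧ B y = some b ∧ a ≤ b) (c₂ : Bool)
    (hadv : ∀ a, B x = some a → MayAdvance home β a x c₂) :
    ¬ σ x ≤ σ y ∧ MayAdvance home β (σ x) x c₂ := by
  have hne : σ x ≠ σ y := fun h => by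
    have := σ.injective h
    have := Fin.ext_iff.1 this
    omega
  -- if `σ x` occurs in `B`, then at `x` or to the right of `y`
  have hpos : ∀ k, B k = some (σ x) → k = x ∨ y < k := by
    intro k hk
    have h1 := hb k _ hk
    rw [Equiv.symm_apply_apply] at h1
    by_contra hc
    push Not at hc
    have h2 : k = y := Fin.ext (by
      have := Fin.le_def.1 h1; have := Fin.le_def.1 hc.2
      have : (k : ℕ) ≠ x := fun h => hc.1 (Fin.ext h)
      omega)
    rw [h2, hy] at hk
    exact hne (Option.some.inj hk).symm
  have hyq := (hB.items (σ y)).1 ⟨y, hy⟩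
  constructor
  · intro hle
    have h1 : home.symm (σ x) ≤ home.symm (σ y) := hhome _ _ (by simpa using hle)
    obtain ⟨k, hk⟩ := (hB.items (σ x)).2 (lt_of_le_of_lt (Fin.le_def.1 h1) hyq)
    have h2 := hB.ord _ _ _ _ hk hy hle
    rcases hpos k hk with rfl | h3
    · exact hcomp ⟨_, _, hk, hy, hle⟩
    · exact absurd h2 (not_le.2 h3)
  · by_contra hnot
    have hge : ⌈β⌉ ≤ ((x : ℕ) : ℤ) + 1 - ((home.symm (σ x) : ℕ) : ℤ) := by
      by_contra hlt
      exact hnot (Or.inl (not_le.1 hlt))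
    rcases lt_or_ge (home.symm (σ x)) (home.symm (σ y)) with h1 | h1
    · obtain ⟨k, hk⟩ := (hB.items (σ x)).2 (lt_trans (Fin.lt_def.1 h1) hyq)
      rcases hpos k hk with rfl | h3
      · exact hnot (hadv _ hk)
      · have h4 := hB.disp _ _ _ _ hy hk h3 h1
        have := Fin.lt_def.1 h3
        omega
    · have h2 : (home.symm (σ y) : ℕ) < home.symm (σ x) := by
        have h3 := Fin.le_def.1 h1
        have h4 : (home.symm (σ y) : ℕ) ≠ home.symm (σ x) := fun h =>
          hne (home.symm.injective (Fin.ext h)).symm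
        omega
      have := hσ.2 y
      omega

/-- The bound is preserved by a step of the coupled chains. It could be lost for an item in three
ways only. The bounding state moves it from `i + 1` to `i` while the state keeps it at `i + 1`:
excluded by `allowed_of_bound_allowed`. The bounding state moves it from `i + 1` to `i` while the
state moves it from `i` to `i + 1`: excluded since the coins are opposite. The bounding state keeps
it at `i` while the state moves it from `i` to `i + 1`: then the coins agree and the Metropolis rule
gives the same answer, and an item above it that is bounded by `i + 1` would have to be at `i + 1`
in the state. -/
theorem Bounds.step {home : Fin n ≃ α} (hhome : IsLinExt home) {β : ℝ}
    {B : BState n α} {σ : Fin n ≃ α} (hB : GoodBound home β B) (hσ : InSupport home β σ)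
    (hb : Bounds B σ) (i : ℕ) (c₃ c₂ : Bool) :
    Bounds (boundStep home β B i c₃ c₂)
      (chainStep home β σ i (coupledCoin σ B i c₃) c₂) := by
  obtain ⟨⟨q, _, hBq⟩, _⟩ := hB
  refine Bounds.boundFill ?_
  unfold LinExt.boundSwap LinExt.chainStep coupledCoin
  by_cases hi : i + 1 < n
  swap
  · simpa [hi] using hb
  simp only [hi, dite_true, exists_true_left]
  generalize hx : (⟨i, Nat.lt_of_succ_lt hi⟩ : Fin n) = x
  generalize hy : (⟨i + 1, hi⟩ : Fin n) = y
  have hxy : (y : ℕ) = x + 1 := by rw [← hx, ← hy]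
  -- the effect of the transposition on the position of an item
  have hmove : ∀ a, Equiv.swap x y (σ.symm a) ≤ σ.symm a ∨ (σ.symm a = x ∧
      Equiv.swap x y (σ.symm a) = y) := by
    intro a
    simp only [Equiv.swap_apply_def]
    split_ifs with h1 h2
    · exact Or.inr ⟨h1, rfl⟩
    · left; rw [h2]; exact Fin.le_def.2 (by omega)
    · exact Or.inl le_rfl
  by_cases hallow : c₃ = true ∧ (¬ ∃ a b, B x = some a ∧ B y = some b ∧ a ≤ b) ∧
      ∀ a, B x = some a → MayAdvance home β a x c₂
  · rw [if_pos hallow]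
    intro j a hj
    simp only [Function.comp_apply] at hj
    have hle := hb _ _ hj
    by_cases hjx : j = x
    · -- the item `a` has moved from `y` to `x` in the bounding state
      subst hjx
      rw [Equiv.swap_apply_left] at hj hle
      by_cases hcoin : some (σ j) = B y
      · have ha : σ j = a := Option.some.inj (hcoin.trans hj)
        simp only [hcoin, if_true, hallow.1, Bool.not_true, Bool.false_eq_true, false_and, if_false]
        rw [← ha, Equiv.symm_apply_apply]
      · simp only [hcoin, if_false]
        by_cases hay : σ.symm a = y
        · have hya : σ y = a := by rw [← hay, Equiv.apply_symm_apply]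
          have hal := allowed_of_bound_allowed hhome hBq hσ hb j y hxy (by rw [hj, hya])
            hallow.2.1 c₂ hallow.2.2
          rw [if_pos ⟨hallow.1, hal⟩, swap_trans_symm_apply, hay, Equiv.swap_apply_right]
        · have hax : σ.symm a ≠ j := fun h => hcoin (by rw [← h, Equiv.apply_symm_apply, hj])
          have hlt : σ.symm a ≤ j := Fin.le_def.2 (by
            have := Fin.le_def.1 hle
            have : (σ.symm a : ℕ) ≠ y := fun h => hay (Fin.ext h)
            omega)
          split_ifs
          · rwa [swap_trans_symm_apply, Equiv.swap_apply_of_ne_of_ne hax hay]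
          · exact hlt
    · -- the bound for `a` has not decreased, and it is at least `y` if it was at least `x`
      have h1 : Equiv.swap x y j ≤ j ∧ (x ≤ Equiv.swap x y j → y ≤ j) := by
        have hjx' : (j : ℕ) ≠ x := fun h => hjx (Fin.ext h)
        simp only [Equiv.swap_apply_def, hjx, if_false]
        split_ifs with h2
        · subst h2
          exact ⟨Fin.le_def.2 (by omega), fun _ => le_rfl⟩
        · refine ⟨le_rfl, fun h => Fin.le_def.2 ?_⟩
          have := Fin.le_def.1 h
          omega
      have hold : σ.symm a ≤ j := hle.trans h1.1
      split_ifs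
      all_goals first
        | exact hold
        | (rw [swap_trans_symm_apply]
           rcases hmove a with h2 | ⟨h2, h3⟩
           · exact h2.trans hold
           · rw [h3]; exact h1.2 (h2 ▸ hle))
  · rw [if_neg hallow]
    intro j a hj
    have hle := hb _ _ hj
    by_cases hax : σ.symm a = x ∧ j = x
    · -- the bounding state has `a` at `x`, and so has the state: it cannot advance
      obtain ⟨hax, rfl⟩ := hax
      have hxa : σ j = a := by rw [← hax, Equiv.apply_symm_apply]
      have hno : ∀ c₁ : Bool, (c₁ = if some (σ j) = B y then !c₃ else c₃) →
          ¬ (c₁ = true ∧ ¬ σ j ≤ σ y ∧ MayAdvance home β (σ j) j c₂) := by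
        rintro c₁ hc₁ ⟨h1, h2, h3⟩
        have hyj : some (σ j) ≠ B y := by
          intro h
          have hja : B y = some a := by rw [← h, hxa]
          have := hBq.inj _ _ _ hj hja
          have := Fin.ext_iff.1 this
          omega
        rw [if_neg hyj, h1] at hc₁
        refine hallow ⟨hc₁.symm, ?_, ?_⟩
        · rintro ⟨a', b, ha', hb', hab⟩
          rw [hj] at ha'
          obtain rfl := Option.some.inj ha'
          have hby := hb _ _ hb'
          have hs : σ j ≤ b := by rw [hxa]; exact hab
          have h4 : j ≤ σ.symm b := by
            have := hσ.1 j (σ.symm b) (by rwa [Equiv.apply_symm_apply])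
            exact this
          have h5 : σ.symm b ≠ y := by
            intro h
            apply h2
            rw [← h, Equiv.apply_symm_apply]; exact hs
          have h6 : σ.symm b = j := Fin.ext (by
            have := Fin.le_def.1 h4
            have := Fin.le_def.1 hby
            have : (σ.symm b : ℕ) ≠ y := fun h => h5 (Fin.ext h)
            omega)
          exact hyj (by rw [hb', ← h6, Equiv.apply_symm_apply])
        · intro a' ha'
          rw [hj] at ha'
          obtain rfl := Option.some.inj ha'
          rwa [hxa] at h3
      rw [if_neg (hno _ rfl), hax]
    · split_ifs
      all_goals first
        | exact hle
        | (rw [swap_trans_symm_apply]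
           rcases hmove a with h2 | ⟨h2, h3⟩
           · exact h2.trans hle
           · rw [h3]
             have : (j : ℕ) ≠ x := fun h => hax ⟨h2, Fin.ext h⟩
             rw [h2] at hle
             have := Fin.le_def.1 hle
             exact Fin.le_def.2 (by omega))

theorem goodBound_boundRun {home : Fin n ≃ α} (hhome : IsLinExt home) (hn : 0 < n) (β : ℝ)
    (τ : ℕ → StepTape) (s : ℕ) : GoodBound home β (boundRun home β τ s) := by
  induction s with
  | zero => exact GoodBound.init home β hn
  | succ s ih => exact ih.boundStep hhome _ _ _ hn

theorem inSupport_coupledRun {home : Fin n ≃ α} {β : ℝ} {σ : Fin n ≃ α}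
    (h : InSupport home β σ) (τ : ℕ → StepTape) (s : ℕ) :
    InSupport home β (coupledRun home β τ σ s) := by
  induction s with
  | zero => exact h
  | succ s ih => exact ih.chainStep _ _ _

/-- At the start of a block the only item in the bounding state is at the last position, so the
bounding state bounds every arrangement. -/
theorem bounds_run {home : Fin n ≃ α} (hhome : IsLinExt home) (hn : 0 < n) {β : ℝ} {σ : Fin n ≃ α}
    (h : InSupport home β σ) (τ : ℕ → StepTape) (s : ℕ) :
    Bounds (boundRun home β τ s) (coupledRun home β τ σ s) := by
  induction s with
  | zero =>
    intro j a hj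
    have hl : (j : ℕ) + 1 = n := by
      by_contra hne
      simp [boundRun, initBound, hne] at hj
    have := ((coupledRun home β τ σ 0).symm a).2
    exact Fin.le_def.2 (by omega)
  | succ s ih =>
    exact ih.step hhome (goodBound_boundRun hhome hn β τ s) (inSupport_coupledRun h τ s) _ _ _

/-- An arrangement that is bounded by a bounding state without `θ` equals it. -/
theorem Bounds.eq_of_ne_none {home : Fin n ≃ α} {β : ℝ} {B : BState n α} {σ : Fin n ≃ α}
    (hB : GoodBound home β B) (hb : Bounds B σ) (hne : ∀ i, B i ≠ none) :
    ∀ i, B i = some (σ i) := by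
  obtain ⟨⟨q, _, hBq⟩, _⟩ := hB
  choose f hf using fun i => Option.ne_none_iff_exists'.1 (hne i)
  have hfi : Function.Injective fun i => σ.symm (f i) := fun i j hij => by
    have h1 : f i = f j := σ.symm.injective hij
    exact hBq.inj _ _ _ (hf i) (by rw [h1]; exact hf j)
  have hle : ∀ i, σ.symm (f i) ≤ i := fun i => hb _ _ (hf i)
  have hid : ∀ i, σ.symm (f i) = i := by
    intro i
    induction i using WellFoundedLT.induction with
    | ind i ih =>
      rcases lt_or_eq_of_le (hle i) with h1 | h1
      · have h2 := ih _ h1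
        exact absurd (hfi h2) h1.ne
      · exact h1
  intro i
  rw [hf i]
  congr 1
  rw [← σ.apply_symm_apply (f i), hid i]

theorem toArrangement_eq {home σ : Fin n ≃ α} {B : BState n α} (h : ∀ i, B i = some (σ i)) :
    toArrangement home B = σ := by
  have hex : ∃ σ : Fin n ≃ α, ∀ i, B i = some (σ i) := ⟨σ, h⟩
  unfold toArrangement
  rw [dif_pos hex]
  refine Equiv.ext fun i => ?_
  have := hex.choose_spec i
  rw [h i] at this
  exact (Option.some.inj this).symm

/-- A block that has coalesced leads from every arrangement in the support to the state which the
bounding chain determines. -/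
theorem coupledRun_eq_of_coalesced {home : Fin n ≃ α} (hhome : IsLinExt home) (hn : 0 < n) {β : ℝ}
    {t j : ℕ} {τ : ℕ → ℕ → StepTape} (hc : Coalesced home t β τ j) {σ : Fin n ≃ α}
    (hσ : InSupport home β σ) :
    coupledRun home β (τ j) σ (blockLength t j) =
      toArrangement home (blockBound home t β τ j) :=
  (toArrangement_eq ((bounds_run hhome hn hσ (τ j) (blockLength t j)).eq_of_ne_none
    (goodBound_boundRun hhome hn β (τ j) _) hc)).symm

end Coupling

/-! ### The law of one step -/

section StepLaw

/-- The random choices made in one step: the position and the two coins. -/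
def draw (n : ℕ) (β : ℝ) (τ : StepTape) : ℕ × Bool × Bool := (drawPos n τ, τ.2.1, drawC₂ β τ)

theorem measurable_penalty : Measurable penalty := by
  unfold penalty
  exact (measurable_const.add measurable_id).sub
    ((Measurable.of_discrete (f := fun z : ℤ => (z : ℝ))).comp Int.measurable_ceil)

theorem measurable_drawPos (n : ℕ) : Measurable (drawPos n) := by
  unfold drawPos
  have h := measurable_readValue _ (measurable_unifStep (n - 1))
  exact h.comp measurable_fst

theorem measurable_drawC₂ : Measurable fun q : ℝ × StepTape => drawC₂ q.1 q.2 := by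
  unfold drawC₂
  have h : Measurable fun q : ℝ × StepTape => (penalty q.1, q.2.2.2) :=
    (measurable_penalty.comp measurable_fst).prodMk measurable_snd.snd.snd
  have h' := measurable_readValue_bernStep.comp h
  exact h'

theorem measurable_draw (n : ℕ) : Measurable fun q : ℝ × StepTape => draw n q.1 q.2 := by
  unfold draw
  have h1 : Measurable fun q : ℝ × StepTape => drawPos n q.2 :=
    (measurable_drawPos n).comp measurable_snd
  have h2 : Measurable fun q : ℝ × StepTape => q.2.2.1 := measurable_snd.snd.fst
  exact h1.prodMk (h2.prodMk measurable_drawC₂)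

theorem penalty_pos (β : ℝ) : 0 < penalty β := by
  have := Int.ceil_lt_add_one β
  unfold penalty; linarith

theorem penalty_le_one (β : ℝ) : penalty β ≤ 1 := by
  have := Int.le_ceil β
  unfold penalty; linarith

/-- The mean of a function of the position and the two coins drawn in one step. -/
def stepAvg (n : ℕ) (β : ℝ) (g : ℕ → Bool → Bool → ENNReal) : ENNReal :=
  ∑ i ∈ Finset.range (n - 1), ENNReal.ofReal (1 / (n - 1 : ℕ)) *
    (2⁻¹ * ∑ c : Bool, (ENNReal.ofReal (penalty β) * g i c true +
      ENNReal.ofReal (1 - penalty β) * g i c false))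

theorem lintegral_draw (n : ℕ) (hn : 2 ≤ n) (β : ℝ) (g : ℕ → Bool → Bool → ENNReal) :
    ∫⁻ τ, g (drawPos n τ) τ.2.1 (drawC₂ β τ) ∂stepMeasure = stepAvg n β g := by
  have hm : Measurable fun τ : StepTape => g (drawPos n τ) τ.2.1 (drawC₂ β τ) :=
    (Measurable.of_discrete (f := fun q : ℕ × Bool × Bool => g q.1 q.2.1 q.2.2)).comp
      ((measurable_draw n).comp (measurable_const (a := β).prodMk measurable_id))
  unfold stepMeasure
  rw [lintegral_prod _ hm.aemeasurable]
  have hin : ∀ x : ℕ → Bool, ∫⁻ y, g (drawPos n (x, y)) (x, y).2.1 (drawC₂ β (x, y))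
      ∂(coin.prod bitStream) = 2⁻¹ * ∑ c : Bool, (ENNReal.ofReal (penalty β) *
        g (readValue (unifStep (n - 1)) x) c true +
      ENNReal.ofReal (1 - penalty β) * g (readValue (unifStep (n - 1)) x) c false) := by
    intro x
    have hx : Measurable fun y : Bool × (ℕ → Bool) =>
        g (drawPos n (x, y)) (x, y).2.1 (drawC₂ β (x, y)) :=
      hm.comp measurable_prodMk_left
    rw [lintegral_prod _ hx.aemeasurable, lintegral_coin, Fintype.sum_bool]
    simp only [drawPos, drawC₂]
    rw [lintegral_readValue_bernStep _ (penalty_pos β).le (penalty_le_one β)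
        (g (readValue (unifStep (n - 1)) x) true),
      lintegral_readValue_bernStep _ (penalty_pos β).le (penalty_le_one β)
        (g (readValue (unifStep (n - 1)) x) false)]
  rw [lintegral_congr hin]
  exact lintegral_readValue_unifStep (n - 1) (by omega) (fun i => 2⁻¹ * ∑ c : Bool,
    (ENNReal.ofReal (penalty β) * g i c true + ENNReal.ofReal (1 - penalty β) * g i c false))

/-- The expected number of bits read in one step. -/
theorem lintegral_stepBits_le (n K : ℕ) (hn : 2 ≤ n) (β : ℝ) :
    ∫⁻ τ, stepBits n β τ ∂stepMeasure ≤ K + (n - 2 : ℕ) * (2 * 2⁻¹ ^ K) + 1 + 2 := by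
  have h1 : Measurable fun τ : StepTape => readCount (unifStep (n - 1)) τ.1 :=
    (measurable_readCount _).comp measurable_fst
  have h2 : Measurable fun τ : StepTape => readCount (bernStep (penalty β)) τ.2.2 :=
    (measurable_readCount _).comp (measurable_snd.comp measurable_snd)
  unfold stepBits
  rw [lintegral_add_right _ h2, lintegral_add_right _ measurable_const]
  have e1 : ∫⁻ τ : StepTape, readCount (unifStep (n - 1)) τ.1 ∂stepMeasure =
      ∫⁻ b, readCount (unifStep (n - 1)) b ∂bitStream := by
    unfold stepMeasure
    rw [lintegral_prod _ h1.aemeasurable]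
    simp
  have e2 : ∫⁻ τ : StepTape, readCount (bernStep (penalty β)) τ.2.2 ∂stepMeasure =
      ∫⁻ b, readCount (bernStep (penalty β)) b ∂bitStream := by
    unfold stepMeasure
    rw [lintegral_prod _ h2.aemeasurable]
    have : Measurable fun y : Bool × (ℕ → Bool) => readCount (bernStep (penalty β)) y.2 :=
      (measurable_readCount _).comp measurable_snd
    have h3 : ∀ x : ℕ → Bool, ∫⁻ y : Bool × (ℕ → Bool),
        readCount (bernStep (penalty β)) (x, y).2.2 ∂(coin.prod bitStream) =
        ∫⁻ b, readCount (bernStep (penalty β)) b ∂bitStream := fun x => by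
      rw [lintegral_prod _ this.aemeasurable]
      dsimp only
      rw [lintegral_const, measure_univ, mul_one]
    rw [lintegral_congr h3]
    simp
  rw [e1, e2]
  refine add_le_add (add_le_add ?_ (by simp)) (lintegral_readCount_bernStep_le _)
  have := lintegral_readCount_unifStep_le (n - 1) K (by omega)
  rwa [show n - 1 - 1 = n - 2 by omega] at this

theorem measurable_stepBits (n : ℕ) :
    Measurable fun q : ℝ × StepTape => stepBits n q.1 q.2 := by
  unfold stepBits
  have h1 : Measurable fun q : ℝ × StepTape => readCount (unifStep (n - 1)) q.2.1 :=
    (measurable_readCount _).comp measurable_snd.fst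
  have h2 : Measurable fun q : ℝ × StepTape => (penalty q.1, q.2.2.2) :=
    (measurable_penalty.comp measurable_fst).prodMk measurable_snd.snd.snd
  have h3 := measurable_readCount_bernStep.comp h2
  exact (h1.add measurable_const).add h3

end StepLaw

/-! ### Stationarity of the weighted distribution -/

section Stationary

variable {n : ℕ} {α : Type*} [PartialOrder α]

/-- The weight of an item that stands `d` positions to the right of its home: the probability that a
uniform number in `(d - 1, d]` is at most `β`. -/
def wt (β : ℝ) (d : ℤ) : ℝ := max 0 (min 1 (β - d + 1))

theorem wt_nonneg (β : ℝ) (d : ℤ) : 0 ≤ wt β d := le_max_left _ _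

theorem wt_of_lt {β : ℝ} {d : ℤ} (h : d < ⌈β⌉) : wt β d = 1 := by
  have : (d : ℝ) < β := Int.lt_ceil.1 h
  rw [wt, min_eq_left (by linarith), max_eq_right zero_le_one]

theorem wt_of_eq {β : ℝ} {d : ℤ} (h : d = ⌈β⌉) : wt β d = penalty β := by
  have h1 := penalty_pos β
  have h2 := penalty_le_one β
  have : β - d + 1 = penalty β := by rw [h, penalty]; ring
  rw [wt, this, min_eq_right h2, max_eq_right h1.le]

theorem wt_of_gt {β : ℝ} {d : ℤ} (h : ⌈β⌉ < d) : wt β d = 0 := by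
  have h1 : (⌈β⌉ : ℝ) + 1 ≤ d := by exact_mod_cast h
  have := Int.le_ceil β
  rw [wt, max_eq_left]
  exact (min_le_right _ _).trans (by linarith)

/-- The weight of an arrangement: the product of the weights of its items if the arrangement is a
linear extension. -/
def weight (home : Fin n ≃ α) (β : ℝ) (σ : Fin n ≃ α) : ℝ :=
  if IsLinExt σ then ∏ i : Fin n, wt β (((i : ℕ) : ℤ) - ((home.symm (σ i) : ℕ) : ℤ)) else 0

theorem weight_nonneg (home : Fin n ≃ α) (β : ℝ) (σ : Fin n ≃ α) : 0 ≤ weight home β σ := by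
  unfold weight
  split_ifs
  · exact Finset.prod_nonneg fun i _ => wt_nonneg _ _
  · exact le_rfl

theorem weight_eq_zero {home : Fin n ≃ α} {β : ℝ} {σ : Fin n ≃ α} (h : ¬ InSupport home β σ) :
    weight home β σ = 0 := by
  unfold weight
  split_ifs with hσ
  · simp only [InSupport, hσ, true_and, not_forall, not_le] at h
    obtain ⟨i, hi⟩ := h
    exact Finset.prod_eq_zero (Finset.mem_univ i) (wt_of_gt hi)
  · rfl

/-- The probability that the transposition at positions `x`, `y` is accepted if it is proposed. -/
def acceptance (home : Fin n ≃ α) (β : ℝ) (σ : Fin n ≃ α) (x y : Fin n) : ℝ :=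
  if σ x ≤ σ y then 0 else wt β (((y : ℕ) : ℤ) - ((home.symm (σ x) : ℕ) : ℤ))

/-- Detailed balance. -/
theorem weight_mul_acceptance (home : Fin n ≃ α) (β : ℝ) (σ : Fin n ≃ α) (x y : Fin n)
    (hxy : (y : ℕ) = x + 1) :
    weight home β ((Equiv.swap x y).trans σ) * acceptance home β ((Equiv.swap x y).trans σ) x y =
      weight home β σ * acceptance home β σ x y := by
  have hne : x ≠ y := fun h => by have := Fin.ext_iff.1 h; omega
  -- both sides vanish unless both arrangements are linear extensions
  have hlin : ∀ ρ : Fin n ≃ α, IsLinExt ρ → ¬ ρ y ≤ ρ x := fun ρ hρ h => by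
    have := Fin.le_def.1 (hρ _ _ h); omega
  have hval : ∀ ρ : Fin n ≃ α, IsLinExt ρ → ¬ ρ x ≤ ρ y →
      weight home β ρ * acceptance home β ρ x y =
        (∏ i ∈ (Finset.univ.erase x).erase y,
          wt β (((i : ℕ) : ℤ) - ((home.symm (ρ i) : ℕ) : ℤ))) *
        (wt β (((y : ℕ) : ℤ) - ((home.symm (ρ x) : ℕ) : ℤ)) *
          wt β (((y : ℕ) : ℤ) - ((home.symm (ρ y) : ℕ) : ℤ))) := by
    intro ρ h1 h2
    rw [weight, if_pos h1, acceptance, if_neg h2,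
      ← Finset.mul_prod_erase _ _ (Finset.mem_univ x),
      ← Finset.mul_prod_erase _ _ (Finset.mem_erase.2 ⟨hne.symm, Finset.mem_univ y⟩)]
    by_cases h3 : (((y : ℕ) : ℤ) - ((home.symm (ρ x) : ℕ) : ℤ)) ≤ ⌈β⌉
    · rw [wt_of_lt (β := β) (d := ((x : ℕ) : ℤ) - ((home.symm (ρ x) : ℕ) : ℤ)) (by omega)]
      ring
    · rw [wt_of_gt (not_le.1 h3)]; ring
  have hzero : ∀ ρ : Fin n ≃ α, ¬ (IsLinExt ρ ∧ ¬ ρ x ≤ ρ y) →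
      weight home β ρ * acceptance home β ρ x y = 0 := by
    intro ρ h
    by_cases h1 : IsLinExt ρ
    · have : ρ x ≤ ρ y := by by_contra h2; exact h ⟨h1, h2⟩
      rw [acceptance, if_pos this, mul_zero]
    · rw [weight, if_neg h1, zero_mul]
  have hback : (Equiv.swap x y).trans ((Equiv.swap x y).trans σ) = σ := by
    ext i; simp
  by_cases h : IsLinExt σ ∧ ¬ σ x ≤ σ y
  · have h' : IsLinExt ((Equiv.swap x y).trans σ) ∧
        ¬ ((Equiv.swap x y).trans σ) x ≤ ((Equiv.swap x y).trans σ) y :=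
      ⟨h.1.swap x y hxy h.2, by simpa using hlin σ h.1⟩
    rw [hval _ h.1 h.2, hval _ h'.1 h'.2]
    congr 1
    · refine Finset.prod_congr rfl fun i hi => ?_
      simp only [Finset.mem_erase] at hi
      rw [Equiv.trans_apply, Equiv.swap_apply_of_ne_of_ne hi.2.1 hi.1]
    · simp only [Equiv.trans_apply, Equiv.swap_apply_left, Equiv.swap_apply_right]
      ring
  · rw [hzero _ h, hzero]
    rintro ⟨h1, h2⟩
    apply h
    have h3 := h1.swap x y hxy h2
    rw [hback] at h3
    exact ⟨h3, by simpa using hlin _ h1⟩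

/-- Averaged over `C₂`, the transposition takes place with probability `acceptance`. -/
theorem chainStep_true_eq (home : Fin n ≃ α) (β : ℝ) (σ : Fin n ≃ α) (i : ℕ) (hi : i + 1 < n)
    (F : (Fin n ≃ α) → ENNReal) :
    ENNReal.ofReal (penalty β) * F (chainStep home β σ i true true) +
        ENNReal.ofReal (1 - penalty β) * F (chainStep home β σ i true false) =
      ENNReal.ofReal (acceptance home β σ ⟨i, Nat.lt_of_succ_lt hi⟩ ⟨i + 1, hi⟩) *
          F ((Equiv.swap ⟨i, Nat.lt_of_succ_lt hi⟩ ⟨i + 1, hi⟩).trans σ) +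
        ENNReal.ofReal (1 - acceptance home β σ ⟨i, Nat.lt_of_succ_lt hi⟩ ⟨i + 1, hi⟩) * F σ := by
  have hsum : ∀ y : ENNReal, ENNReal.ofReal (penalty β) * y +
      ENNReal.ofReal (1 - penalty β) * y = y := by
    intro y
    rw [← add_mul, ← ENNReal.ofReal_add (penalty_pos β).le
      (by linarith [penalty_le_one β])]
    simp
  unfold chainStep acceptance
  simp only [hi, dite_true, true_and]
  by_cases hc : σ ⟨i, Nat.lt_of_succ_lt hi⟩ ≤ σ ⟨i + 1, hi⟩
  · simp [hc, hsum]
  · simp only [hc, not_false_eq_true, true_and, if_false]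
    rcases lt_trichotomy (((i + 1 : ℕ) : ℤ) -
      ((home.symm (σ ⟨i, Nat.lt_of_succ_lt hi⟩) : ℕ) : ℤ)) ⌈β⌉ with h | h | h
    · rw [wt_of_lt h]
      have : ∀ c, MayAdvance home β (σ ⟨i, Nat.lt_of_succ_lt hi⟩) ⟨i, Nat.lt_of_succ_lt hi⟩ c :=
        fun c => Or.inl (by push_cast at h; exact h)
      simp [this, hsum]
    · rw [wt_of_eq h]
      have h1 : MayAdvance home β (σ ⟨i, Nat.lt_of_succ_lt hi⟩) ⟨i, Nat.lt_of_succ_lt hi⟩ true :=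
        Or.inr ⟨by push_cast at h; exact h, rfl⟩
      have h2 : ¬ MayAdvance home β (σ ⟨i, Nat.lt_of_succ_lt hi⟩) ⟨i, Nat.lt_of_succ_lt hi⟩
          false := by
        push_cast at h
        rintro (h3 | h3)
        · simp only at h3; omega
        · exact Bool.false_ne_true h3.2
      simp [h1, h2]
    · rw [wt_of_gt h]
      have : ∀ c, ¬ MayAdvance home β (σ ⟨i, Nat.lt_of_succ_lt hi⟩)
          ⟨i, Nat.lt_of_succ_lt hi⟩ c := by
        intro c h3
        have := h3.le
        push_cast at h
        simp only at this
        omega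
      simp [this, hsum]

theorem chainStep_false (home : Fin n ≃ α) (β : ℝ) (σ : Fin n ≃ α) (i : ℕ) (c₂ : Bool) :
    chainStep home β σ i false c₂ = σ := by
  simp [chainStep]

theorem acceptance_nonneg (home : Fin n ≃ α) (β : ℝ) (σ : Fin n ≃ α) (x y : Fin n) :
    0 ≤ acceptance home β σ x y := by
  unfold acceptance; split_ifs; exacts [le_rfl, wt_nonneg _ _]

theorem acceptance_le_one (home : Fin n ≃ α) (β : ℝ) (σ : Fin n ≃ α) (x y : Fin n) :
    acceptance home β σ x y ≤ 1 := by
  unfold acceptance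
  split_ifs
  · exact zero_le_one
  · exact max_le zero_le_one (min_le_left _ _)

/-- The transition operator of the chain. -/
def chainOp (home : Fin n ≃ α) (β : ℝ) (F : (Fin n ≃ α) → ENNReal) (σ : Fin n ≃ α) : ENNReal :=
  stepAvg n β fun i c₁ c₂ => F (chainStep home β σ i c₁ c₂)

variable [Fintype α]

/-- For each position separately, the step with `C₁ = 1` preserves the weighted distribution; this
is the summed form of the detailed balance `weight_mul_acceptance`. -/
theorem sum_weight_chainStep (home : Fin n ≃ α) (β : ℝ) (i : ℕ) (hi : i + 1 < n)
    (F : (Fin n ≃ α) → ENNReal) :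
    ∑ σ, ENNReal.ofReal (weight home β σ) *
      (ENNReal.ofReal (penalty β) * F (chainStep home β σ i true true) +
        ENNReal.ofReal (1 - penalty β) * F (chainStep home β σ i true false)) =
    ∑ σ, ENNReal.ofReal (weight home β σ) * F σ := by
  simp_rw [chainStep_true_eq home β _ i hi F]
  generalize hx : (⟨i, Nat.lt_of_succ_lt hi⟩ : Fin n) = x
  generalize hy : (⟨i + 1, hi⟩ : Fin n) = y
  have hxy : (y : ℕ) = x + 1 := by rw [← hx, ← hy]
  -- reindex the accepted transpositions by the involution `σ ↦ σ ∘ (x y)`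
  let e : (Fin n ≃ α) ≃ (Fin n ≃ α) :=
    Function.Involutive.toPerm (fun σ => (Equiv.swap x y).trans σ) fun σ => by ext i; simp
  have he : ∀ σ, e σ = (Equiv.swap x y).trans σ := fun σ => rfl
  have hre : ∑ σ, ENNReal.ofReal (weight home β σ) *
      (ENNReal.ofReal (acceptance home β σ x y) * F ((Equiv.swap x y).trans σ)) =
      ∑ σ, ENNReal.ofReal (weight home β σ) *
        (ENNReal.ofReal (acceptance home β σ x y) * F σ) := by
    rw [← Equiv.sum_comp e fun σ => ENNReal.ofReal (weight home β σ) *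
        (ENNReal.ofReal (acceptance home β σ x y) * F σ)]
    refine Finset.sum_congr rfl fun σ _ => ?_
    rw [← mul_assoc, ← mul_assoc, ← ENNReal.ofReal_mul (weight_nonneg _ _ _),
      ← ENNReal.ofReal_mul (weight_nonneg _ _ _), he, weight_mul_acceptance home β σ x y hxy]
  simp_rw [mul_add]
  rw [Finset.sum_add_distrib, hre, ← Finset.sum_add_distrib]
  refine Finset.sum_congr rfl fun σ _ => ?_
  rw [← mul_add, ← add_mul, ← ENNReal.ofReal_add (acceptance_nonneg _ _ _ _ _)
    (by linarith [acceptance_le_one home β σ x y])]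
  simp

/-- The weighted distribution is stationary for the chain. -/
theorem sum_weight_chainOp (home : Fin n ≃ α) (hn : 2 ≤ n) (β : ℝ) (F : (Fin n ≃ α) → ENNReal) :
    ∑ σ, ENNReal.ofReal (weight home β σ) * chainOp home β F σ =
      ∑ σ, ENNReal.ofReal (weight home β σ) * F σ := by
  have hsum : ∀ y : ENNReal, ENNReal.ofReal (penalty β) * y +
      ENNReal.ofReal (1 - penalty β) * y = y := by
    intro y
    rw [← add_mul, ← ENNReal.ofReal_add (penalty_pos β).le
      (by linarith [penalty_le_one β])]
    simp
  unfold chainOp stepAvg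
  simp_rw [Fintype.sum_bool, chainStep_false, hsum, Finset.mul_sum]
  rw [Finset.sum_comm]
  have hterm : ∀ i ∈ Finset.range (n - 1), ∑ σ, ENNReal.ofReal (weight home β σ) *
      (ENNReal.ofReal (1 / (n - 1 : ℕ)) * (2⁻¹ *
        (ENNReal.ofReal (penalty β) * F (chainStep home β σ i true true) +
          ENNReal.ofReal (1 - penalty β) * F (chainStep home β σ i true false) + F σ))) =
      ENNReal.ofReal (1 / (n - 1 : ℕ)) * ∑ σ, ENNReal.ofReal (weight home β σ) * F σ := by
    intro i hi
    have hi' : i + 1 < n := by have := Finset.mem_range.1 hi; omega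
    have h1 : ∀ σ, ENNReal.ofReal (weight home β σ) *
      (ENNReal.ofReal (1 / (n - 1 : ℕ)) * (2⁻¹ *
        (ENNReal.ofReal (penalty β) * F (chainStep home β σ i true true) +
          ENNReal.ofReal (1 - penalty β) * F (chainStep home β σ i true false) + F σ))) =
      ENNReal.ofReal (1 / (n - 1 : ℕ)) * 2⁻¹ * (ENNReal.ofReal (weight home β σ) *
        (ENNReal.ofReal (penalty β) * F (chainStep home β σ i true true) +
          ENNReal.ofReal (1 - penalty β) * F (chainStep home β σ i true false)) +
          ENNReal.ofReal (weight home β σ) * F σ) := fun σ => by ring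
    simp_rw [h1]
    rw [← Finset.mul_sum, Finset.sum_add_distrib, sum_weight_chainStep home β i hi' F, ← two_mul,
      mul_assoc, ← mul_assoc 2⁻¹, ENNReal.inv_mul_cancel (by norm_num) (by norm_num), one_mul]
  rw [Finset.sum_congr rfl hterm, ← Finset.sum_mul, Finset.sum_const, Finset.card_range,
    nsmul_eq_mul, ← ENNReal.ofReal_natCast, ← ENNReal.ofReal_mul (Nat.cast_nonneg _),
    mul_one_div_cancel (by exact_mod_cast (by omega : n - 1 ≠ 0)), ENNReal.ofReal_one, one_mul]

/-- The coin of the state is fair whatever the bounding state is. -/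
theorem stepAvg_coupledCoin (home : Fin n ≃ α) (β : ℝ) (F : (Fin n ≃ α) → ENNReal)
    (σ : Fin n ≃ α) (B : BState n α) :
    (stepAvg n β fun i c c₂ => F (chainStep home β σ i (coupledCoin σ B i c) c₂)) =
      chainOp home β F σ := by
  unfold chainOp stepAvg
  refine Finset.sum_congr rfl fun i _ => ?_
  simp only [Fintype.sum_bool, coupledCoin]
  split_ifs
  · simp only [Bool.not_true, Bool.not_false]; ring
  · rfl

end Stationary

/-! ### Measurability of the sampler -/

section Measurability

variable {n : ℕ} {α : Type*} [PartialOrder α] [Fintype α]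

/-- Bounding states and arrangements are discrete data: all sets of them are measurable. -/
instance : MeasurableSpace (Option α) := ⊤

instance : MeasurableSpace (Fin n ≃ α) := ⊤

/-- For given coins the Metropolis rule depends on `β` through `⌈β⌉` only. Hence the chains are
functions of countably many discrete data, and measurability jointly in `β` and the tape follows. -/
theorem mayAdvance_ceil (home : Fin n ≃ α) (β : ℝ) :
    MayAdvance home (⌈β⌉ : ℝ) = MayAdvance home β := by
  funext a i c₂
  simp only [MayAdvance, Int.ceil_intCast]

theorem boundStep_ceil (home : Fin n ≃ α) (β : ℝ) (B : BState n α) (i : ℕ) (c₃ c₂ : Bool) :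
    boundStep home (⌈β⌉ : ℝ) B i c₃ c₂ = boundStep home β B i c₃ c₂ := by
  unfold boundStep boundSwap
  rw [mayAdvance_ceil]

theorem chainStep_ceil (home : Fin n ≃ α) (β : ℝ) (σ : Fin n ≃ α) (i : ℕ) (c₁ c₂ : Bool) :
    chainStep home (⌈β⌉ : ℝ) σ i c₁ c₂ = chainStep home β σ i c₁ c₂ := by
  unfold chainStep
  rw [mayAdvance_ceil]

theorem measurable_boundRun (home : Fin n ≃ α) (s : ℕ) :
    Measurable fun q : ℝ × (ℕ → StepTape) => boundRun home q.1 q.2 s := by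
  induction s with
  | zero => exact measurable_const
  | succ s ih =>
    have h1 : Measurable fun q : ℝ × (ℕ → StepTape) => draw n q.1 (q.2 s) := by
      have h := (measurable_draw n).comp
        (measurable_fst.prodMk ((measurable_pi_apply s).comp measurable_snd) :
          Measurable fun q : ℝ × (ℕ → StepTape) => (q.1, q.2 s))
      exact h
    have h2 : Measurable fun q : ℝ × (ℕ → StepTape) => ⌈q.1⌉ :=
      Int.measurable_ceil.comp measurable_fst
    have h3 := (Measurable.of_discrete (f := fun p : ℤ × BState n α × (ℕ × Bool × Bool) =>
      boundStep home (p.1 : ℝ) p.2.1 p.2.2.1 p.2.2.2.1 p.2.2.2.2)).comp (h2.prodMk (ih.prodMk h1))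
    simpa only [boundRun, Function.comp_def, draw, boundStep_ceil] using h3

theorem measurable_coupledRun (home : Fin n ≃ α) (σ : Fin n ≃ α) (s : ℕ) :
    Measurable fun q : ℝ × (ℕ → StepTape) => coupledRun home q.1 q.2 σ s := by
  induction s with
  | zero => exact measurable_const
  | succ s ih =>
    have h1 : Measurable fun q : ℝ × (ℕ → StepTape) => draw n q.1 (q.2 s) := by
      have h := (measurable_draw n).comp
        (measurable_fst.prodMk ((measurable_pi_apply s).comp measurable_snd) :
          Measurable fun q : ℝ × (ℕ → StepTape) => (q.1, q.2 s))
      exact h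
    have h2 : Measurable fun q : ℝ × (ℕ → StepTape) => ⌈q.1⌉ :=
      Int.measurable_ceil.comp measurable_fst
    have h3 := (Measurable.of_discrete
      (f := fun p : ℤ × (Fin n ≃ α) × BState n α × (ℕ × Bool × Bool) =>
        chainStep home (p.1 : ℝ) p.2.1 p.2.2.2.1
          (coupledCoin p.2.1 p.2.2.1 p.2.2.2.1 p.2.2.2.2.1) p.2.2.2.2.2)).comp
      (h2.prodMk (ih.prodMk ((measurable_boundRun home s).prodMk h1)))
    simpa only [coupledRun, Function.comp_def, draw, chainStep_ceil] using h3

theorem measurable_blockBound (home : Fin n ≃ α) (t j : ℕ) :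
    Measurable fun q : ℝ × (ℕ → ℕ → StepTape) => blockBound home t q.1 q.2 j := by
  have h := (measurable_boundRun home (blockLength t j)).comp
    (measurable_fst.prodMk ((measurable_pi_apply j).comp measurable_snd) :
      Measurable fun q : ℝ × (ℕ → ℕ → StepTape) => (q.1, q.2 j))
  exact h

theorem measurableSet_coalesced (home : Fin n ≃ α) (t j : ℕ) :
    MeasurableSet {q : ℝ × (ℕ → ℕ → StepTape) | Coalesced home t q.1 q.2 j} :=
  measurable_blockBound home t j
    (MeasurableSet.of_discrete (s := {B : BState n α | ∀ i, B i ≠ none}))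

theorem measurable_replay (home : Fin n ≃ α) (t j : ℕ) (σ : Fin n ≃ α) :
    Measurable fun q : ℝ × (ℕ → ℕ → StepTape) => replay home t q.1 q.2 j σ := by
  induction j generalizing σ with
  | zero => exact measurable_const
  | succ j ih =>
    have h1 : Measurable fun q : ℝ × (ℕ → ℕ → StepTape) =>
        coupledRun home q.1 (q.2 j) σ (blockLength t j) := by
      have h := (measurable_coupledRun home σ (blockLength t j)).comp
        (measurable_fst.prodMk ((measurable_pi_apply j).comp measurable_snd) :
          Measurable fun q : ℝ × (ℕ → ℕ → StepTape) => (q.1, q.2 j))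
      exact h
    have h2 : Measurable fun p : (ℝ × (ℕ → ℕ → StepTape)) × (Fin n ≃ α) =>
        replay home t p.1.1 p.1.2 j p.2 :=
      measurable_from_prod_countable_left ih
    have h3 := h2.comp (measurable_id.prodMk h1)
    exact h3

theorem measurable_generate (home : Fin n ≃ α) (t : ℕ) :
    Measurable fun q : ℝ × (ℕ → ℕ → StepTape) => generate home t q.1 q.2 := by
  have h1 : ∀ j, Measurable fun q : ℝ × (ℕ → ℕ → StepTape) =>
      replay home t q.1 q.2 j (toArrangement home (blockBound home t q.1 q.2 j)) := by
    intro j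
    have h2 : Measurable fun p : (ℝ × (ℕ → ℕ → StepTape)) × (Fin n ≃ α) =>
        replay home t p.1.1 p.1.2 j p.2 :=
      measurable_from_prod_countable_left fun σ => measurable_replay home t j σ
    have h3 := (Measurable.of_discrete (f := toArrangement home)).comp
      (measurable_blockBound home t j)
    have h4 := h2.comp (measurable_id.prodMk h3)
    exact h4
  have h5 : Measurable fun p : (ℝ × (ℕ → ℕ → StepTape)) × ℕ =>
      replay home t p.1.1 p.1.2 p.2 (toArrangement home (blockBound home t p.1.1 p.1.2 p.2)) :=
    measurable_from_prod_countable_left h1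
  have h6 := measurable_sInf_nat
    (fun j (q : ℝ × (ℕ → ℕ → StepTape)) => Coalesced home t q.1 q.2 j)
    (measurableSet_coalesced home t)
  have h7 := h5.comp (measurable_id.prodMk h6)
  exact h7

end Measurability

/-! ### The law of the sample -/

section Law

variable {n : ℕ} {α : Type*} [PartialOrder α] [Fintype α]

/-- The law of a sequence of step tapes. -/
abbrev blockMeasure : Measure (ℕ → StepTape) := Measure.infinitePi fun _ : ℕ => stepMeasure

/-- The law of the step tapes of all blocks. -/
abbrev blocksMeasure : Measure (ℕ → ℕ → StepTape) := Measure.infinitePi fun _ : ℕ => blockMeasure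

theorem boundRun_update (home : Fin n ≃ α) (β : ℝ) (τ : ℕ → StepTape) (s : ℕ) (x : StepTape)
    {k : ℕ} (hk : k ≤ s) : boundRun home β (Function.update τ s x) k = boundRun home β τ k := by
  induction k with
  | zero => rfl
  | succ k ih =>
    simp only [boundRun]
    rw [ih (by omega), Function.update_of_ne (by omega)]

theorem coupledRun_update (home : Fin n ≃ α) (β : ℝ) (τ : ℕ → StepTape) (σ : Fin n ≃ α) (s : ℕ)
    (x : StepTape) {k : ℕ} (hk : k ≤ s) :
    coupledRun home β (Function.update τ s x) σ k = coupledRun home β τ σ k := by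
  induction k with
  | zero => rfl
  | succ k ih =>
    simp only [coupledRun]
    rw [ih (by omega), boundRun_update home β τ s x (by omega), Function.update_of_ne (by omega)]

theorem replay_update (home : Fin n ≃ α) (t : ℕ) (β : ℝ) (τ : ℕ → ℕ → StepTape) (s : ℕ)
    (x : ℕ → StepTape) {k : ℕ} (hk : k ≤ s) (σ : Fin n ≃ α) :
    replay home t β (Function.update τ s x) k σ = replay home t β τ k σ := by
  induction k generalizing σ with
  | zero => rfl
  | succ k ih =>
    simp only [replay]
    rw [ih (by omega), Function.update_of_ne (by omega)]

/-- Seen from the state alone, the coupled chain is the chain. -/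
theorem lintegral_coupledRun (home : Fin n ≃ α) (hn : 2 ≤ n) (β : ℝ) (σ : Fin n ≃ α) (s : ℕ)
    (F : (Fin n ≃ α) → ENNReal) :
    ∫⁻ τ, F (coupledRun home β τ σ s) ∂blockMeasure = (chainOp home β)^[s] F σ := by
  induction s generalizing F with
  | zero => simp [coupledRun]
  | succ s ih =>
    have hG : Measurable fun τ : ℕ → StepTape =>
        (coupledRun home β τ σ s, boundRun home β τ s) := by
      have h1 := (measurable_coupledRun home σ s).comp
        (measurable_const (a := β).prodMk measurable_id : Measurable fun τ : ℕ → StepTape => (β, τ))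
      have h2 := (measurable_boundRun home s).comp
        (measurable_const (a := β).prodMk measurable_id : Measurable fun τ : ℕ → StepTape => (β, τ))
      exact h1.prodMk h2
    let K : (Fin n ≃ α) × BState n α → StepTape → ENNReal := fun y x =>
      F (chainStep home β y.1 (drawPos n x) (coupledCoin y.1 y.2 (drawPos n x) x.2.1) (drawC₂ β x))
    have hK : Measurable (Function.uncurry K) := by
      have h1 : Measurable fun p : ((Fin n ≃ α) × BState n α) × StepTape => draw n β p.2 := by
        have h := (measurable_draw n).comp (measurable_const (a := β).prodMk measurable_snd :
          Measurable fun p : ((Fin n ≃ α) × BState n α) × StepTape => (β, p.2))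
        exact h
      have h2 := (Measurable.of_discrete
        (f := fun p : ((Fin n ≃ α) × BState n α) × (ℕ × Bool × Bool) =>
          F (chainStep home β p.1.1 p.2.1 (coupledCoin p.1.1 p.1.2 p.2.1 p.2.2.1) p.2.2.2))).comp
        (measurable_fst.prodMk h1)
      exact h2
    have hstep := lintegral_coord stepMeasure s
      (fun τ : ℕ → StepTape => (coupledRun home β τ σ s, boundRun home β τ s)) hG
      (fun τ x => by
        simp only [coupledRun_update home β τ σ s x le_rfl, boundRun_update home β τ s x le_rfl])
      K hK
    have hin : ∀ τ : ℕ → StepTape, ∫⁻ x, K (coupledRun home β τ σ s, boundRun home β τ s) x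
        ∂stepMeasure = chainOp home β F (coupledRun home β τ σ s) := by
      intro τ
      rw [← stepAvg_coupledCoin home β F _ (boundRun home β τ s)]
      exact lintegral_draw n hn β fun i c c₂ => F (chainStep home β (coupledRun home β τ σ s) i
        (coupledCoin (coupledRun home β τ σ s) (boundRun home β τ s) i c) c₂)
    rw [lintegral_congr hin] at hstep
    rw [Function.iterate_succ_apply, ← ih]
    exact hstep

/-- A block of the coupled chain preserves the weighted distribution. -/
theorem sum_weight_coupledRun (home : Fin n ≃ α) (hn : 2 ≤ n) (β : ℝ) (s : ℕ)
    (F : (Fin n ≃ α) → ENNReal) :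
    ∑ σ, ENNReal.ofReal (weight home β σ) * ∫⁻ τ, F (coupledRun home β τ σ s) ∂blockMeasure =
      ∑ σ, ENNReal.ofReal (weight home β σ) * F σ := by
  simp_rw [lintegral_coupledRun home hn β _ s F]
  induction s with
  | zero => rfl
  | succ s ih =>
    simp_rw [Function.iterate_succ_apply']
    rw [sum_weight_chainOp home hn β, ih]

theorem measurable_replay_right (home : Fin n ≃ α) (t : ℕ) (β : ℝ) (j : ℕ) (σ : Fin n ≃ α) :
    Measurable fun τ : ℕ → ℕ → StepTape => replay home t β τ j σ := by
  have h := (measurable_replay home t j σ).comp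
    (measurable_const (a := β).prodMk measurable_id :
      Measurable fun τ : ℕ → ℕ → StepTape => (β, τ))
  exact h

/-- If the chain is started from the weighted distribution, it has this distribution after the
blocks `j - 1, …, 0`. -/
theorem sum_weight_replay (home : Fin n ≃ α) (hn : 2 ≤ n) (t : ℕ) (β : ℝ) (j : ℕ)
    (F : (Fin n ≃ α) → ENNReal) :
    ∑ σ, ENNReal.ofReal (weight home β σ) * ∫⁻ τ, F (replay home t β τ j σ) ∂blocksMeasure =
      ∑ σ, ENNReal.ofReal (weight home β σ) * F σ := by
  induction j with
  | zero => simp [replay]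
  | succ j ih =>
    have hG : Measurable fun (τ : ℕ → ℕ → StepTape) (σ : Fin n ≃ α) => replay home t β τ j σ :=
      measurable_pi_lambda _ fun σ => measurable_replay_right home t β j σ
    have hrun : ∀ σ, Measurable fun x : ℕ → StepTape =>
        coupledRun home β x σ (blockLength t j) := by
      intro σ
      have h := (measurable_coupledRun home σ (blockLength t j)).comp
        (measurable_const (a := β).prodMk measurable_id :
          Measurable fun τ : ℕ → StepTape => (β, τ))
      exact h
    have hstep : ∀ σ, ∫⁻ τ, F (replay home t β τ (j + 1) σ) ∂blocksMeasure =
        ∫⁻ τ, ∫⁻ x, F (replay home t β τ j (coupledRun home β x σ (blockLength t j)))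
          ∂blockMeasure ∂blocksMeasure := by
      intro σ
      let K : ((Fin n ≃ α) → (Fin n ≃ α)) → (ℕ → StepTape) → ENNReal := fun y x =>
        F (y (coupledRun home β x σ (blockLength t j)))
      have hK : Measurable (Function.uncurry K) := by
        have h1 : Measurable fun p : ((Fin n ≃ α) → (Fin n ≃ α)) × (Fin n ≃ α) => F (p.1 p.2) :=
          Measurable.of_discrete
        have h2 := h1.comp (measurable_fst.prodMk ((hrun σ).comp measurable_snd) :
          Measurable fun p : ((Fin n ≃ α) → (Fin n ≃ α)) × (ℕ → StepTape) =>
            (p.1, coupledRun home β p.2 σ (blockLength t j)))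
        exact h2
      exact lintegral_coord blockMeasure j
        (fun τ : ℕ → ℕ → StepTape => fun σ => replay home t β τ j σ) hG
        (fun τ x => funext fun σ => replay_update home t β τ j x le_rfl σ) K hK
    have hmeas : ∀ σ, Measurable fun τ : ℕ → ℕ → StepTape =>
        ∫⁻ x, F (replay home t β τ j (coupledRun home β x σ (blockLength t j))) ∂blockMeasure := by
      intro σ
      have h1 : Measurable fun y : (Fin n ≃ α) → (Fin n ≃ α) =>
          ∫⁻ x, F (y (coupledRun home β x σ (blockLength t j))) ∂blockMeasure :=
        Measurable.of_discrete
      have h2 := h1.comp hG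
      exact h2
    simp_rw [hstep]
    rw [← ih]
    simp_rw [← lintegral_const_mul _ (hmeas _)]
    rw [← lintegral_finsetSum _ fun σ _ => (hmeas σ).const_mul _]
    have h3 : ∀ τ : ℕ → ℕ → StepTape, ∑ σ, ENNReal.ofReal (weight home β σ) *
        ∫⁻ x, F (replay home t β τ j (coupledRun home β x σ (blockLength t j))) ∂blockMeasure =
        ∑ σ, ENNReal.ofReal (weight home β σ) * F (replay home t β τ j σ) := fun τ =>
      sum_weight_coupledRun home hn β (blockLength t j) fun σ => F (replay home t β τ j σ)
    have hF : ∀ σ, Measurable fun τ : ℕ → ℕ → StepTape => F (replay home t β τ j σ) := fun σ => by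
      have h := (Measurable.of_discrete (f := F)).comp (measurable_replay_right home t β j σ)
      exact h
    rw [lintegral_congr h3, lintegral_finsetSum _ fun σ _ => (hF σ).const_mul _]
    simp_rw [lintegral_const_mul _ (hF _)]

/-- If one of the blocks `0, …, J - 1` coalesces, every start in block `J - 1` leads to the
sample. -/
theorem replay_eq_generate {home : Fin n ≃ α} (hhome : IsLinExt home) (hn : 0 < n) {t : ℕ} {β : ℝ}
    {τ : ℕ → ℕ → StepTape} {J : ℕ} (hJ : ∃ j < J, Coalesced home t β τ j) {σ : Fin n ≃ α}
    (hσ : InSupport home β σ) : replay home t β τ J σ = generate home t β τ := by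
  induction J generalizing σ with
  | zero => obtain ⟨j, hj, _⟩ := hJ; omega
  | succ J ih =>
    simp only [replay]
    by_cases h : ∃ j < J, Coalesced home t β τ j
    · exact ih h (inSupport_coupledRun hσ _ _)
    · obtain ⟨j, hj, hc⟩ := hJ
      have hjJ : j = J := by
        by_contra hne
        exact h ⟨j, by omega, hc⟩
      subst hjJ
      have hinf : sInf {j | Coalesced home t β τ j} = j := by
        refine le_antisymm (Nat.sInf_le hc) ?_
        by_contra hlt
        exact h ⟨_, not_le.1 hlt, Nat.sInf_mem (s := {j | Coalesced home t β τ j}) ⟨j, hc⟩⟩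
      rw [coupledRun_eq_of_coalesced hhome hn hc hσ]
      simp only [generate, hinf]

/-- The sum of the weights of all arrangements. -/
def totalWeight (home : Fin n ≃ α) (β : ℝ) : ℝ := ∑ σ, weight home β σ

/-- The correctness of the coupling from the past: if the blocks coalesce eventually, the sample has
the weighted distribution. -/
theorem blocksMeasure_generate {home : Fin n ≃ α} (hhome : IsLinExt home) (hn : 2 ≤ n) (t : ℕ)
    (β : ℝ) (hlim : Filter.Tendsto
      (fun J => blocksMeasure {τ | ∀ j < J, ¬ Coalesced home t β τ j}) Filter.atTop (nhds 0))
    (ρ : Fin n ≃ α) :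
    ENNReal.ofReal (totalWeight home β) * blocksMeasure {τ | generate home t β τ = ρ} =
      ENNReal.ofReal (weight home β ρ) := by
  set ε : ℕ → ENNReal := fun J => blocksMeasure {τ | ∀ j < J, ¬ Coalesced home t β τ j} with hε
  have hw : ENNReal.ofReal (totalWeight home β) = ∑ σ, ENNReal.ofReal (weight home β σ) :=
    ENNReal.ofReal_sum_of_nonneg fun σ _ => weight_nonneg _ _ _
  have hstat : ∀ J, ∑ σ, ENNReal.ofReal (weight home β σ) *
      blocksMeasure {τ | replay home t β τ J σ = ρ} = ENNReal.ofReal (weight home β ρ) := by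
    intro J
    have h := sum_weight_replay home hn t β J (Set.indicator {ρ} 1)
    have h1 : ∀ σ, ∫⁻ τ, Set.indicator {ρ} 1 (replay home t β τ J σ) ∂blocksMeasure =
        blocksMeasure {τ | replay home t β τ J σ = ρ} := by
      intro σ
      have hm : MeasurableSet {τ : ℕ → ℕ → StepTape | replay home t β τ J σ = ρ} :=
        measurable_replay_right home t β J σ (MeasurableSet.of_discrete (s := {ρ}))
      rw [← lintegral_indicator_one hm]
      rfl
    simp_rw [h1] at h
    rw [h, Finset.sum_eq_single ρ]
    · simp
    · intro σ _ hσ; simp [hσ]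
    · simp
  have hsub1 : ∀ J σ, InSupport home β σ → blocksMeasure {τ | replay home t β τ J σ = ρ} ≤
      blocksMeasure {τ | generate home t β τ = ρ} + ε J := by
    intro J σ hσ
    refine (measure_mono ?_).trans (measure_union_le _ _)
    intro τ hτ
    by_cases hc : ∃ j < J, Coalesced home t β τ j
    · exact Or.inl ((replay_eq_generate hhome (by omega) hc hσ).symm.trans hτ)
    · right
      push Not at hc
      exact hc
  have hsub2 : ∀ J σ, InSupport home β σ → blocksMeasure {τ | generate home t β τ = ρ} ≤
      blocksMeasure {τ | replay home t β τ J σ = ρ} + ε J := by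
    intro J σ hσ
    refine (measure_mono ?_).trans (measure_union_le _ _)
    intro τ hτ
    by_cases hc : ∃ j < J, Coalesced home t β τ j
    · exact Or.inl ((replay_eq_generate hhome (by omega) hc hσ).trans hτ)
    · right
      push Not at hc
      exact hc
  have hwle : ∀ σ (a b : ENNReal), (InSupport home β σ → a ≤ b) →
      ENNReal.ofReal (weight home β σ) * a ≤ ENNReal.ofReal (weight home β σ) * b := by
    intro σ a b h
    by_cases hσ : InSupport home β σ
    · exact mul_le_mul_right (h hσ) _
    · simp [weight_eq_zero hσ]
  have hzero : Filter.Tendsto (fun J => ENNReal.ofReal (totalWeight home β) * ε J) Filter.atTop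
      (nhds 0) := by
    have := ENNReal.Tendsto.const_mul (a := ENNReal.ofReal (totalWeight home β)) hlim
      (Or.inr ENNReal.ofReal_ne_top)
    simpa using this
  refine le_antisymm ?_ ?_
  · have hJ : ∀ J,
        ENNReal.ofReal (totalWeight home β) * blocksMeasure {τ | generate home t β τ = ρ} ≤
        ENNReal.ofReal (weight home β ρ) + ENNReal.ofReal (totalWeight home β) * ε J := by
      intro J
      rw [← hstat J, hw, Finset.sum_mul, Finset.sum_mul, ← Finset.sum_add_distrib]
      refine Finset.sum_le_sum fun σ _ => ?_
      rw [← mul_add]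
      exact hwle _ _ _ (hsub2 J σ)
    have := ge_of_tendsto' (hzero.const_add (ENNReal.ofReal (weight home β ρ))) hJ
    simpa using this
  · have hJ : ∀ J, ENNReal.ofReal (weight home β ρ) ≤
        ENNReal.ofReal (totalWeight home β) * blocksMeasure {τ | generate home t β τ = ρ} +
          ENNReal.ofReal (totalWeight home β) * ε J := by
      intro J
      rw [← hstat J, hw, Finset.sum_mul, Finset.sum_mul, ← Finset.sum_add_distrib]
      refine Finset.sum_le_sum fun σ _ => ?_
      rw [← mul_add]
      exact hwle _ _ _ (hsub1 J σ)
    have := ge_of_tendsto' (hzero.const_add (ENNReal.ofReal (totalWeight home β) *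
      blocksMeasure {τ | generate home t β τ = ρ})) hJ
    simpa using this

end Law

/-! ### The time to coalescence -/

section Walk

/-- One step of the lazy random walk on `{0, …, n - 1}` that is reflected at `0` and absorbed at
`n - 1`, as an operator on functions (truncated subtraction gives the reflection at `0`). -/
def walkOp (n : ℕ) (g : ℕ → ℝ) (i : ℕ) : ℝ :=
  if i + 1 < n then g i + 1 / (2 * (n - 1 : ℕ)) * (g (i + 1) + g (i - 1) - 2 * g i) else 0

/-- The function that is `1` before absorption and `0` at the absorbing position. -/
def aliveFun (n : ℕ) (i : ℕ) : ℝ := if i + 1 < n then 1 else 0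

/-- Decreasing functions that vanish at the absorbing position. -/
structure DecrFun (n : ℕ) (g : ℕ → ℝ) : Prop where
  anti : Antitone g
  zero : ∀ i, n ≤ i + 1 → g i = 0

theorem DecrFun.nonneg {n : ℕ} {g : ℕ → ℝ} (h : DecrFun n g) (i : ℕ) : 0 ≤ g i := by
  rw [← h.zero (i + n) (by omega)]
  exact h.anti (by omega)

theorem decrFun_aliveFun (n : ℕ) : DecrFun n (aliveFun n) := by
  refine ⟨antitone_nat_of_succ_le fun i => ?_, fun i hi => by simp [aliveFun, not_lt.2 hi]⟩
  unfold aliveFun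
  split_ifs <;> first | omega | norm_num

theorem laziness_le (n : ℕ) (hn : 2 ≤ n) :
    0 ≤ 1 / (2 * ((n - 1 : ℕ) : ℝ)) ∧ 1 / (2 * ((n - 1 : ℕ) : ℝ)) ≤ 1 / 2 := by
  have h : (1 : ℝ) ≤ (n - 1 : ℕ) := by exact_mod_cast (by omega : 1 ≤ n - 1)
  refine ⟨by positivity, ?_⟩
  rw [div_le_div_iff₀ (by positivity) (by norm_num)]
  linarith

/-- The laziness of the walk makes it monotone. -/
theorem DecrFun.walkOp {n : ℕ} (hn : 2 ≤ n) {g : ℕ → ℝ} (h : DecrFun n g) :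
    DecrFun n (walkOp n g) := by
  refine ⟨antitone_nat_of_succ_le fun i => ?_, fun i hi => by
    simp [LinExt.walkOp, not_lt.2 hi]⟩
  obtain ⟨ha0, ha1⟩ := laziness_le n hn
  unfold LinExt.walkOp
  generalize 1 / (2 * ((n - 1 : ℕ) : ℝ)) = a at *
  have h1 := h.anti (show i - 1 ≤ i by omega)
  have h2 := h.anti (show i ≤ i + 1 by omega)
  have h3 := h.anti (show i + 1 ≤ i + 1 + 1 by omega)
  have h4 := h.nonneg (i + 1)
  simp only [Nat.add_sub_cancel]
  split_ifs with hi hi' hi'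
  · nlinarith [mul_nonneg ha0 (sub_nonneg.2 h1), mul_nonneg ha0 (sub_nonneg.2 h3)]
  · omega
  · have h5 := h.zero (i + 1) (by omega)
    rw [h5] at h2 ⊢
    nlinarith [mul_nonneg ha0 (sub_nonneg.2 h1)]
  · exact le_rfl

theorem decrFun_iterate (n : ℕ) (hn : 2 ≤ n) (s : ℕ) : DecrFun n ((walkOp n)^[s] (aliveFun n)) := by
  induction s with
  | zero => exact decrFun_aliveFun n
  | succ s ih =>
    rw [Function.iterate_succ_apply']
    exact ih.walkOp hn

/-- The walk operator is symmetric. -/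
theorem sum_mul_walkOp (n : ℕ) (hn : 2 ≤ n) (f h : ℕ → ℝ) (hf : f (n - 1) = 0)
    (hh : h (n - 1) = 0) :
    ∑ i ∈ Finset.range (n - 1), f i * walkOp n h i =
      ∑ i ∈ Finset.range (n - 1), walkOp n f i * h i := by
  have key : ∀ m, ∑ i ∈ Finset.range m, (f i * (h (i + 1) + h (i - 1)) -
      h i * (f (i + 1) + f (i - 1))) = f (m - 1) * h m - h (m - 1) * f m := by
    intro m
    induction m with
    | zero => simp; ring
    | succ m ih => rw [Finset.sum_range_succ, ih]; simp only [Nat.add_sub_cancel]; ring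
  have hk := key (n - 1)
  rw [hf, hh] at hk
  rw [← sub_eq_zero, ← Finset.sum_sub_distrib]
  have : ∀ i ∈ Finset.range (n - 1), f i * walkOp n h i - walkOp n f i * h i =
      1 / (2 * (n - 1 : ℕ)) * (f i * (h (i + 1) + h (i - 1)) - h i * (f (i + 1) + f (i - 1))) := by
    intro i hi
    have hi' : i + 1 < n := by have := Finset.mem_range.1 hi; omega
    simp only [walkOp, hi', if_true]
    ring
  rw [Finset.sum_congr rfl this, ← Finset.mul_sum, hk]
  ring

/-- The positive eigenfunction of the walk operator. -/
def eigenFun (n : ℕ) (i : ℕ) : ℝ := Real.cos (Real.pi / (2 * n - 1) * (i + 1 / 2))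

/-- The largest eigenvalue of the walk operator. -/
def eigenVal (n : ℕ) : ℝ := 1 - 1 / (n - 1 : ℕ) * (1 - Real.cos (Real.pi / (2 * n - 1)))

theorem eigenFun_pos (n : ℕ) (i : ℕ) (hi : i + 1 < n) : 0 < eigenFun n i := by
  have hi' : (i : ℝ) + 2 ≤ n := by exact_mod_cast hi
  have hi0 : (0 : ℝ) ≤ i := Nat.cast_nonneg i
  have hD : (0 : ℝ) < 2 * n - 1 := by linarith
  have hpi := Real.pi_pos
  refine Real.cos_pos_of_mem_Ioo ⟨?_, ?_⟩
  · have : 0 ≤ Real.pi / (2 * n - 1) * (i + 1 / 2) := by positivity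
    linarith
  · rw [div_mul_eq_mul_div, div_lt_iff₀ hD]
    nlinarith

theorem eigenFun_last (n : ℕ) (hn : 2 ≤ n) : eigenFun n (n - 1) = 0 := by
  have hn' : (2 : ℝ) ≤ n := by exact_mod_cast hn
  have hD : (2 * n - 1 : ℝ) ≠ 0 := by linarith
  rw [eigenFun, Nat.cast_sub (by omega), Nat.cast_one]
  have : Real.pi / (2 * n - 1) * ((n : ℝ) - 1 + 1 / 2) = Real.pi / 2 := by
    field_simp; ring
  rw [this, Real.cos_pi_div_two]

/-- The product formula for the cosine; the half-integer shift makes the function even about `-1/2`,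
which is the reflection at `0`. -/
theorem walkOp_eigenFun (n : ℕ) (i : ℕ) (hi : i + 1 < n) :
    walkOp n (eigenFun n) i = eigenVal n * eigenFun n i := by
  have hn : (2 : ℝ) ≤ n := by exact_mod_cast (by omega : 2 ≤ n)
  have hN : ((n - 1 : ℕ) : ℝ) ≠ 0 := by exact_mod_cast (by omega : n - 1 ≠ 0)
  have hsum : eigenFun n (i + 1) + eigenFun n (i - 1) =
      2 * Real.cos (Real.pi / (2 * n - 1)) * eigenFun n i := by
    set κ := Real.pi / (2 * n - 1) with hκ
    have h1 : eigenFun n (i + 1) = Real.cos (κ * (i + 1 / 2) + κ) := by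
      rw [eigenFun]; congr 1; push_cast; ring
    have h2 : eigenFun n (i - 1) = Real.cos (κ * (i + 1 / 2) - κ) := by
      rcases Nat.eq_zero_or_pos i with rfl | h0
      · rw [← Real.cos_neg, eigenFun]; congr 1; push_cast; ring
      · rw [eigenFun, Nat.cast_sub h0]; congr 1; push_cast; ring
    rw [h1, h2, eigenFun, Real.cos_add, Real.cos_sub]
    ring
  rw [walkOp, if_pos hi, hsum, eigenVal]
  field_simp
  ring

theorem eigenVal_nonneg (n : ℕ) (hn : 2 ≤ n) : 0 ≤ eigenVal n := by
  have hn' : (2 : ℝ) ≤ n := by exact_mod_cast hn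
  have h1 : (1 : ℝ) ≤ (n - 1 : ℕ) := by exact_mod_cast (by omega : 1 ≤ n - 1)
  have hc : 0 ≤ Real.cos (Real.pi / (2 * n - 1)) := by
    have hpi := Real.pi_pos
    refine Real.cos_nonneg_of_mem_Icc ⟨?_, ?_⟩
    · have : 0 ≤ Real.pi / (2 * n - 1) := div_nonneg hpi.le (by linarith)
      linarith
    · exact div_le_div_of_nonneg_left hpi.le (by norm_num) (by linarith)
  have h2 : (1 : ℝ) / (n - 1 : ℕ) ≤ 1 := by rw [div_le_one (by linarith)]; exact h1
  have h3 : (0 : ℝ) ≤ 1 / (n - 1 : ℕ) := by positivity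
  unfold eigenVal
  nlinarith

/-- The Schur test: the norm of the walk operator is at most its eigenvalue for a positive
eigenfunction. -/
theorem sum_sq_walkOp_le (n : ℕ) (hn : 2 ≤ n) (g : ℕ → ℝ) (hg : g (n - 1) = 0) :
    ∑ i ∈ Finset.range (n - 1), walkOp n g i ^ 2 ≤
      eigenVal n ^ 2 * ∑ i ∈ Finset.range (n - 1), g i ^ 2 := by
  set f := eigenFun n with hf
  set h : ℕ → ℝ := fun i => g i ^ 2 / f i with hh
  have hf0 : f (n - 1) = 0 := eigenFun_last n hn
  have hh0 : h (n - 1) = 0 := by simp [hh, hg]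
  have hpos : ∀ i, i + 1 < n → 0 < f i := eigenFun_pos n
  obtain ⟨ha0, ha1⟩ := laziness_le n hn
  have hval : ∀ i, i < n → 0 ≤ f i ∧ 0 ≤ h i ∧ g i ^ 2 = f i * h i := by
    intro i hi
    by_cases hi' : i + 1 < n
    · have := hpos i hi'
      refine ⟨this.le, by positivity, ?_⟩
      rw [hh]; field_simp
    · have : i = n - 1 := by omega
      rw [this, hf0, hh0, hg]; simp
  -- the Cauchy inequality for `g = √f √h`, and `walkOp n f = eigenVal n * f`
  have hpoint : ∀ i ∈ Finset.range (n - 1),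
      walkOp n g i ^ 2 ≤ eigenVal n * (f i * walkOp n h i) := by
    intro i hi
    have hi' : i + 1 < n := by have := Finset.mem_range.1 hi; omega
    rw [← mul_assoc, hf, ← walkOp_eigenFun n i hi', ← hf]
    simp only [walkOp, hi', if_true]
    generalize 1 / (2 * ((n - 1 : ℕ) : ℝ)) = a at ha0 ha1 ⊢
    obtain ⟨f1, h1, e1⟩ := hval i (by omega)
    obtain ⟨f2, h2, e2⟩ := hval (i + 1) (by omega)
    obtain ⟨f3, h3, e3⟩ := hval (i - 1) (by omega)
    have hb : 0 ≤ 1 - 2 * a := by linarith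
    have hcs := Finset.sum_sq_le_sum_mul_sum_of_sq_le_mul (Finset.univ : Finset (Fin 3))
      (r := ![(1 - 2 * a) * g i, a * g (i + 1), a * g (i - 1)])
      (f := ![(1 - 2 * a) * f i, a * f (i + 1), a * f (i - 1)])
      (g := ![(1 - 2 * a) * h i, a * h (i + 1), a * h (i - 1)])
      (by
        intro j _
        fin_cases j <;> simp <;> positivity)
      (by
        intro j _
        fin_cases j <;> simp <;> positivity)
      (by
        intro j _
        refine le_of_eq ?_
        fin_cases j
        · simp [mul_pow, e1]; ring
        · simp [mul_pow, e2]; ring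
        · simp [mul_pow, e3]; ring)
    simp only [Fin.sum_univ_three, Matrix.cons_val_zero, Matrix.cons_val_one,
      Matrix.cons_val] at hcs
    refine (le_of_eq ?_).trans (hcs.trans (le_of_eq ?_))
    · ring
    · ring
  calc ∑ i ∈ Finset.range (n - 1), walkOp n g i ^ 2
      ≤ ∑ i ∈ Finset.range (n - 1), eigenVal n * (f i * walkOp n h i) := Finset.sum_le_sum hpoint
    _ = eigenVal n * ∑ i ∈ Finset.range (n - 1), walkOp n f i * h i := by
        rw [← Finset.mul_sum, sum_mul_walkOp n hn f h hf0 hh0]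
    _ = eigenVal n ^ 2 * ∑ i ∈ Finset.range (n - 1), g i ^ 2 := by
        rw [pow_two, mul_assoc]
        congr 1
        rw [Finset.mul_sum]
        refine Finset.sum_congr rfl fun i hi => ?_
        have hi' : i + 1 < n := by have := Finset.mem_range.1 hi; omega
        rw [hf, walkOp_eigenFun n i hi', ← hf, mul_assoc, (hval i (by omega)).2.2]

/-- The sum of the survival probabilities of the walk over all starting positions. -/
theorem sum_iterate_walkOp_le (n : ℕ) (hn : 2 ≤ n) (s : ℕ) :
    ∑ i ∈ Finset.range (n - 1), (walkOp n)^[s] (aliveFun n) i ≤ (n - 1 : ℕ) * eigenVal n ^ s := by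
  have hsq : ∑ i ∈ Finset.range (n - 1), (walkOp n)^[s] (aliveFun n) i ^ 2 ≤
      (n - 1 : ℕ) * (eigenVal n ^ s) ^ 2 := by
    induction s with
    | zero =>
      simp only [Function.iterate_zero, id_eq, pow_zero, one_pow, mul_one]
      refine (Finset.sum_le_card_nsmul _ _ 1 fun i _ => ?_).trans (by simp)
      unfold aliveFun; split_ifs <;> norm_num
    | succ s ih =>
      rw [Function.iterate_succ_apply']
      refine (sum_sq_walkOp_le n hn _ ((decrFun_iterate n hn s).zero _ (by omega))).trans ?_
      calc eigenVal n ^ 2 * ∑ i ∈ Finset.range (n - 1), (walkOp n)^[s] (aliveFun n) i ^ 2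
          ≤ eigenVal n ^ 2 * ((n - 1 : ℕ) * (eigenVal n ^ s) ^ 2) :=
            mul_le_mul_of_nonneg_left ih (sq_nonneg _)
        _ = (n - 1 : ℕ) * (eigenVal n ^ (s + 1)) ^ 2 := by ring
  have hcs := sq_sum_le_card_mul_sum_sq (s := Finset.range (n - 1))
    (f := fun i => (walkOp n)^[s] (aliveFun n) i)
  rw [Finset.card_range] at hcs
  have hle : (∑ i ∈ Finset.range (n - 1), (walkOp n)^[s] (aliveFun n) i) ^ 2 ≤
      ((n - 1 : ℕ) * eigenVal n ^ s) ^ 2 := by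
    refine hcs.trans ((mul_le_mul_of_nonneg_left hsq (Nat.cast_nonneg _)).trans_eq ?_)
    ring
  exact le_of_sq_le_sq hle (mul_nonneg (Nat.cast_nonneg _) (pow_nonneg (eigenVal_nonneg n hn) s))

/-- A lower bound for the spectral gap `1 - eigenVal n`, times `n - 1`. -/
theorem one_le_gap (n : ℕ) (hn : 2 ≤ n) :
    1 ≤ 0.82 * ((n : ℝ) ^ 2 - n + 1) * (1 - Real.cos (Real.pi / (2 * n - 1))) := by
  have hn' : (2 : ℝ) ≤ n := by exact_mod_cast hn
  obtain ⟨D, hD⟩ : ∃ D : ℝ, D = 2 * n - 1 := ⟨_, rfl⟩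
  have hD3 : 3 ≤ D := by linarith
  have hpi1 := Real.pi_gt_d2
  have hpi2 := Real.pi_lt_d2
  rw [← hD]
  set x := Real.pi / (2 * D) with hx
  have hx0 : 0 < x := by positivity
  have hx1 : x ≤ 1 := by rw [hx, div_le_one (by linarith)]; linarith
  have hcos : 1 - Real.cos (Real.pi / D) = 2 * Real.sin x ^ 2 := by
    have h2 : Real.pi / D = 2 * x := by rw [hx]; field_simp
    rw [h2, Real.cos_two_mul, Real.cos_sq']
    ring
  have hsin : x * (1 - x ^ 2 / 4) ≤ Real.sin x := by
    have := Real.sin_gt_sub_cube hx0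
    nlinarith [pow_pos hx0 3]
  have hn2 : (n : ℝ) ^ 2 - n + 1 = (D ^ 2 + 3) / 4 := by rw [hD]; ring
  have hsq : x ^ 2 * (1 - x ^ 2 / 2) ≤ Real.sin x ^ 2 := by
    have h0 : 0 ≤ x * (1 - x ^ 2 / 4) := by
      refine mul_nonneg hx0.le ?_
      nlinarith
    have h1 := pow_le_pow_left₀ h0 hsin 2
    nlinarith [sq_nonneg (x ^ 3)]
  have hxD : x ^ 2 * D ^ 2 = Real.pi ^ 2 / 4 := by rw [hx]; field_simp; ring
  have hpisq1 : 9.8596 ≤ Real.pi ^ 2 := by nlinarith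
  have hpisq2 : Real.pi ^ 2 ≤ 9.9225 := by nlinarith
  rw [hcos, hn2]
  have hx2 : x ^ 2 ≤ 0.28 := by
    have : x ^ 2 * 9 ≤ x ^ 2 * D ^ 2 := by
      refine mul_le_mul_of_nonneg_left ?_ (sq_nonneg x)
      nlinarith
    nlinarith
  -- `(D² + 3) x² (1 - x² / 2) = π² / 4 + x² (3 - π² / 8 - 3 x² / 2)`
  have hexp : (D ^ 2 + 3) * (x ^ 2 * (1 - x ^ 2 / 2)) =
      Real.pi ^ 2 / 4 + x ^ 2 * (3 - Real.pi ^ 2 / 8 - 3 * x ^ 2 / 2) := by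
    linear_combination (1 - x ^ 2 / 2) * hxD
  have hmul := mul_le_mul_of_nonneg_left hsq (by positivity : 0 ≤ D ^ 2 + 3)
  have hrest : 0 ≤ x ^ 2 * (3 - Real.pi ^ 2 / 8 - 3 * x ^ 2 / 2) :=
    mul_nonneg (sq_nonneg x) (by linarith)
  linarith

end Walk

/-! ### The walk of the symbols `θ` -/

section Drift

variable {n : ℕ} {α : Type*} [PartialOrder α] [Fintype α]

/-- The sum of `g` over the positions of the symbols `θ`. -/
def thetaSum (g : ℕ → ℝ) (B : BState n α) : ℝ := ∑ i : Fin n, if B i = none then g i else 0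

theorem thetaSum_nonneg {g : ℕ → ℝ} (hg : DecrFun n g) (B : BState n α) : 0 ≤ thetaSum g B :=
  Finset.sum_nonneg fun i _ => by split_ifs; exacts [hg.nonneg _, le_rfl]

/-- Filling removes a `θ` at the last position only, where `g` vanishes. -/
theorem thetaSum_boundFill (home : Fin n ≃ α) {g : ℕ → ℝ} (hg : DecrFun n g) (B : BState n α) :
    thetaSum g (boundFill home B) = thetaSum g B := by
  refine Finset.sum_congr rfl fun i _ => ?_
  by_cases hi : (i : ℕ) + 1 = n
  · simp [hg.zero i hi.ge]
  · simp [boundFill, hi]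

theorem thetaSum_swap (g : ℕ → ℝ) (B : BState n α) (x y : Fin n) :
    thetaSum g (B ∘ Equiv.swap x y) = thetaSum g B +
      ((if B x = none then 1 else 0) - (if B y = none then 1 else 0)) * (g y - g x) := by
  by_cases hxy : x = y
  · subst hxy; simp
  have h1 : thetaSum g (B ∘ Equiv.swap x y) =
      ∑ i : Fin n, if B i = none then g (Equiv.swap x y i) else 0 := by
    unfold thetaSum
    rw [← Equiv.sum_comp (Equiv.swap x y)]
    simp
  rw [h1, thetaSum, ← sub_eq_iff_eq_add', ← Finset.sum_sub_distrib]
  rw [← Finset.add_sum_erase _ _ (Finset.mem_univ x),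
    ← Finset.add_sum_erase _ _ (Finset.mem_erase.2 ⟨Ne.symm hxy, Finset.mem_univ y⟩),
    Finset.sum_eq_zero (s := (Finset.univ.erase x).erase y)]
  · simp only [Equiv.swap_apply_left, Equiv.swap_apply_right]
    split_ifs <;> ring
  · intro i hi
    simp only [Finset.mem_erase] at hi
    rw [Equiv.swap_apply_of_ne_of_ne hi.2.1 hi.1, sub_self]

/-- If `C₃ = 1`, a `θ` at `i` moves to `i + 1`, since it may always advance, and if `θ` is at `i +
1` only, it moves to `i` at most. As `g` decreases, the sum is at most what it would be if every
transposition were allowed. -/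
theorem thetaSum_boundStep_le (home : Fin n ≃ α) (β : ℝ) {g : ℕ → ℝ} (hg : DecrFun n g)
    (B : BState n α) (i : ℕ) (hi : i + 1 < n) (c₂ : Bool) :
    thetaSum g (boundStep home β B i true c₂) ≤ thetaSum g B +
      ((if B ⟨i, Nat.lt_of_succ_lt hi⟩ = none then 1 else 0) -
        (if B ⟨i + 1, hi⟩ = none then 1 else 0)) * (g (i + 1) - g i) := by
  rw [boundStep, thetaSum_boundFill home hg]
  unfold boundSwap
  simp only [hi, dite_true, true_and]
  have hdec := hg.anti (show i ≤ i + 1 by omega)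
  split_ifs with h1 h2 h3 h3 h2 h3 h3
  all_goals first
    | (rw [thetaSum_swap]; simp [*])
    | skip
  -- an unmoved `θ` at `i` is impossible, since `θ` may always advance
  all_goals first
    | (exfalso; apply h1; constructor <;> simp [h2])
    | nlinarith

theorem thetaSum_boundStep_false (home : Fin n ≃ α) (β : ℝ) {g : ℕ → ℝ} (hg : DecrFun n g)
    (B : BState n α) (i : ℕ) (c₂ : Bool) :
    thetaSum g (boundStep home β B i false c₂) = thetaSum g B := by
  rw [boundStep, thetaSum_boundFill home hg]
  simp [boundSwap]

/-- Summation by parts turns the expected change of `thetaSum g` into the walk operator. -/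
theorem thetaSum_walkOp (hn : 2 ≤ n) (g : ℕ → ℝ) (hg : DecrFun n g) (B : BState n α)
    (hB : ∀ j : Fin n, (j : ℕ) + 1 = n → B j ≠ none) :
    thetaSum (walkOp n g) B = thetaSum g B + 1 / (2 * (n - 1 : ℕ)) *
      ∑ i ∈ Finset.range (n - 1), (if h : i + 1 < n then
        ((if B ⟨i, Nat.lt_of_succ_lt h⟩ = none then (1 : ℝ) else 0) -
          (if B ⟨i + 1, h⟩ = none then 1 else 0)) * (g (i + 1) - g i) else 0) := by
  set T : ℕ → ℝ := fun i => if h : i < n then (if B ⟨i, h⟩ = none then 1 else 0) else 0 with hT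
  have hsum : ∀ g' : ℕ → ℝ, thetaSum g' B = ∑ i ∈ Finset.range (n - 1), T i * g' i := by
    intro g'
    have h1 : thetaSum g' B = ∑ i : Fin n, (fun j : ℕ => T j * g' j) i := by
      refine Finset.sum_congr rfl fun i _ => ?_
      simp [hT]
    rw [h1, Fin.sum_univ_eq_sum_range (fun j : ℕ => T j * g' j) n]
    obtain ⟨m, rfl⟩ : ∃ m, n = m + 1 := ⟨n - 1, by omega⟩
    rw [Finset.sum_range_succ]
    have : T m = 0 := by
      simp only [hT]
      rw [dif_pos (by omega), if_neg (hB ⟨m, by omega⟩ rfl)]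
    rw [this]; simp
  have hTlast : T (n - 1) = 0 := by
    simp only [hT]
    rw [dif_pos (by omega), if_neg (hB ⟨n - 1, by omega⟩ (by simp; omega))]
  have key : ∀ m, ∑ i ∈ Finset.range m, (T i - T (i + 1)) * (g (i + 1) - g i) =
      ∑ i ∈ Finset.range m, T i * (g (i + 1) + g (i - 1) - 2 * g i) -
        T m * (g m - g (m - 1)) := by
    intro m
    induction m with
    | zero => simp
    | succ m ih =>
      rw [Finset.sum_range_succ, ih, Finset.sum_range_succ]
      simp only [Nat.add_sub_cancel]; ring
  have h2 : ∑ i ∈ Finset.range (n - 1), (if h : i + 1 < n then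
        ((if B ⟨i, Nat.lt_of_succ_lt h⟩ = none then (1 : ℝ) else 0) -
          (if B ⟨i + 1, h⟩ = none then 1 else 0)) * (g (i + 1) - g i) else 0) =
      ∑ i ∈ Finset.range (n - 1), (T i - T (i + 1)) * (g (i + 1) - g i) := by
    refine Finset.sum_congr rfl fun i hi => ?_
    have hi' : i + 1 < n := by have := Finset.mem_range.1 hi; omega
    have hi'' : i < n := by omega
    simp only [hT, hi', hi'', dite_true]
  rw [h2, key, hTlast, hsum, hsum, zero_mul, sub_zero, Finset.mul_sum, ← Finset.sum_add_distrib]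
  refine Finset.sum_congr rfl fun i hi => ?_
  have hi' : i + 1 < n := by have := Finset.mem_range.1 hi; omega
  rw [walkOp, if_pos hi']
  ring

/-- The expected sum of `g` over the symbols `θ` after a step of the bounding chain is at most the
one after a step of the walk for each symbol. -/
theorem stepAvg_thetaSum_le (home : Fin n ≃ α) (hn : 2 ≤ n) (β : ℝ) {g : ℕ → ℝ} (hg : DecrFun n g)
    (B : BState n α) (hB : ∀ j : Fin n, (j : ℕ) + 1 = n → B j ≠ none) :
    (stepAvg n β fun i c₃ c₂ => ENNReal.ofReal (thetaSum g (boundStep home β B i c₃ c₂))) ≤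
      ENNReal.ofReal (thetaSum (walkOp n g) B) := by
  set d : ℕ → ℝ := fun i => if h : i + 1 < n then
        ((if B ⟨i, Nat.lt_of_succ_lt h⟩ = none then (1 : ℝ) else 0) -
          (if B ⟨i + 1, h⟩ = none then 1 else 0)) * (g (i + 1) - g i) else 0 with hd
  have hN : (0 : ℝ) < (n - 1 : ℕ) := by exact_mod_cast (by omega : 0 < n - 1)
  have hφ := thetaSum_nonneg hg B
  have hdi : ∀ i, i + 1 < n → ∀ c₂, thetaSum g (boundStep home β B i true c₂) ≤
      thetaSum g B + d i := by
    intro i hi c₂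
    have := thetaSum_boundStep_le home β hg B i hi c₂
    simpa only [hd, hi, dite_true] using this
  have hpos : ∀ i, i + 1 < n → 0 ≤ thetaSum g B + d i := fun i hi =>
    (thetaSum_nonneg hg _).trans (hdi i hi true)
  have hsum : ∀ y : ENNReal, ENNReal.ofReal (penalty β) * y +
      ENNReal.ofReal (1 - penalty β) * y = y := by
    intro y
    rw [← add_mul, ← ENNReal.ofReal_add (penalty_pos β).le
      (by linarith [penalty_le_one β])]
    simp
  have hterm : ∀ i ∈ Finset.range (n - 1), ENNReal.ofReal (1 / (n - 1 : ℕ)) *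
      (2⁻¹ * ∑ c : Bool, (ENNReal.ofReal (penalty β) *
          ENNReal.ofReal (thetaSum g (boundStep home β B i c true)) +
        ENNReal.ofReal (1 - penalty β) *
          ENNReal.ofReal (thetaSum g (boundStep home β B i c false)))) ≤
      ENNReal.ofReal (1 / (n - 1 : ℕ) * (1 / 2 * (2 * thetaSum g B + d i))) := by
    intro i hi
    have hi' : i + 1 < n := by have := Finset.mem_range.1 hi; omega
    rw [Fintype.sum_bool, thetaSum_boundStep_false home β hg, thetaSum_boundStep_false home β hg,
      hsum]
    have h1 : ENNReal.ofReal (penalty β) *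
          ENNReal.ofReal (thetaSum g (boundStep home β B i true true)) +
        ENNReal.ofReal (1 - penalty β) *
          ENNReal.ofReal (thetaSum g (boundStep home β B i true false)) ≤
        ENNReal.ofReal (thetaSum g B + d i) := by
      rw [← hsum (ENNReal.ofReal (thetaSum g B + d i))]
      gcongr
      · exact hdi i hi' true
      · exact hdi i hi' false
    rw [ENNReal.ofReal_mul (by positivity), ENNReal.ofReal_mul (by norm_num)]
    have h2 : ENNReal.ofReal (1 / 2) = 2⁻¹ := by
      rw [one_div, ENNReal.ofReal_inv_of_pos (by norm_num)]; simp
    rw [h2]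
    gcongr
    calc _ ≤ ENNReal.ofReal (thetaSum g B + d i) + ENNReal.ofReal (thetaSum g B) :=
          add_le_add h1 le_rfl
      _ = ENNReal.ofReal (2 * thetaSum g B + d i) := by
          rw [← ENNReal.ofReal_add (hpos i hi') hφ]; congr 1; ring
  refine (Finset.sum_le_sum hterm).trans ?_
  rw [← ENNReal.ofReal_sum_of_nonneg]
  · refine ENNReal.ofReal_le_ofReal (le_of_eq ?_)
    rw [thetaSum_walkOp hn g hg B hB, ← hd, ← Finset.mul_sum, ← Finset.mul_sum,
      Finset.sum_add_distrib, Finset.sum_const, Finset.card_range, nsmul_eq_mul]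
    field_simp
  · intro i hi
    have hi' : i + 1 < n := by have := Finset.mem_range.1 hi; omega
    have := hpos i hi'
    have h3 : 0 ≤ 2 * thetaSum g B + d i := by linarith
    positivity

/-- The sum of `g` over the symbols `θ` after `s` steps, compared with `s` steps of the walk started
from all positions that hold `θ` initially. -/
theorem lintegral_thetaSum_boundRun_le {home : Fin n ≃ α} (hhome : IsLinExt home) (hn : 2 ≤ n)
    (β : ℝ) {g : ℕ → ℝ} (hg : DecrFun n g) (s : ℕ) :
    ∫⁻ τ, ENNReal.ofReal (thetaSum g (boundRun home β τ s)) ∂blockMeasure ≤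
      ENNReal.ofReal (thetaSum ((walkOp n)^[s] g) (initBound home)) := by
  induction s generalizing g with
  | zero => simp [boundRun]
  | succ s ih =>
    rw [Function.iterate_succ_apply]
    refine le_trans ?_ (ih (hg.walkOp hn))
    have hG : Measurable fun τ : ℕ → StepTape => boundRun home β τ s := by
      have h2 := (measurable_boundRun home s).comp
        (measurable_const (a := β).prodMk measurable_id : Measurable fun τ : ℕ → StepTape => (β, τ))
      exact h2
    let K : BState n α → StepTape → ENNReal := fun y x => ENNReal.ofReal (thetaSum g
      (boundStep home β y (drawPos n x) x.2.1 (drawC₂ β x)))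
    have hK : Measurable (Function.uncurry K) := by
      have h1 : Measurable fun p : BState n α × StepTape => draw n β p.2 := by
        have h := (measurable_draw n).comp (measurable_const (a := β).prodMk measurable_snd :
          Measurable fun p : BState n α × StepTape => (β, p.2))
        exact h
      have h2 := (Measurable.of_discrete
        (f := fun p : BState n α × (ℕ × Bool × Bool) => ENNReal.ofReal (thetaSum g
          (boundStep home β p.1 p.2.1 p.2.2.1 p.2.2.2)))).comp (measurable_fst.prodMk h1)
      exact h2
    have hstep := lintegral_coord stepMeasure s (fun τ : ℕ → StepTape => boundRun home β τ s) hG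
      (fun τ x => boundRun_update home β τ s x le_rfl) K hK
    refine le_trans (le_of_eq hstep) (lintegral_mono fun τ => ?_)
    refine le_trans (le_of_eq ?_) (stepAvg_thetaSum_le home hn β hg (boundRun home β τ s)
      (goodBound_boundRun hhome (by omega) β τ s).2)
    exact lintegral_draw n hn β fun i c₃ c₂ =>
      ENNReal.ofReal (thetaSum g (boundStep home β (boundRun home β τ s) i c₃ c₂))

/-- The probability that some `θ` is left after `s` steps. -/
theorem blockMeasure_theta_le {home : Fin n ≃ α} (hhome : IsLinExt home) (hn : 2 ≤ n) (β : ℝ)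
    (s : ℕ) : blockMeasure {τ | ¬ ∀ i, boundRun home β τ s i ≠ none} ≤
      ENNReal.ofReal ((n - 1 : ℕ) * eigenVal n ^ s) := by
  have hg := decrFun_iterate n hn s
  have h1 : thetaSum ((walkOp n)^[s] (aliveFun n)) (initBound home) ≤
      (n - 1 : ℕ) * eigenVal n ^ s := by
    refine le_trans ?_ (sum_iterate_walkOp_le n hn s)
    obtain ⟨m, rfl⟩ : ∃ m, n = m + 1 := ⟨n - 1, by omega⟩
    have : thetaSum ((walkOp (m + 1))^[s] (aliveFun (m + 1))) (initBound home) ≤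
        ∑ i : Fin (m + 1), (walkOp (m + 1))^[s] (aliveFun (m + 1)) i :=
      Finset.sum_le_sum fun i _ => by split_ifs; exacts [le_rfl, hg.nonneg _]
    refine this.trans (le_of_eq ?_)
    rw [Fin.sum_univ_eq_sum_range (fun j : ℕ => (walkOp (m + 1))^[s] (aliveFun (m + 1)) j) (m + 1),
      Finset.sum_range_succ, hg.zero m le_rfl, add_zero, Nat.add_sub_cancel]
  refine le_trans ?_ ((lintegral_thetaSum_boundRun_le hhome hn β (decrFun_aliveFun n) s).trans
    (ENNReal.ofReal_le_ofReal h1))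
  have hm : MeasurableSet {τ | ¬ ∀ i, boundRun home β τ s i ≠ none} := by
    have h2 := (measurable_boundRun home s).comp
      (measurable_const (a := β).prodMk measurable_id : Measurable fun τ : ℕ → StepTape => (β, τ))
    exact h2 (MeasurableSet.of_discrete (s := {B : BState n α | ¬ ∀ i, B i ≠ none}))
  rw [← lintegral_indicator_one hm]
  refine lintegral_mono fun τ => ?_
  by_cases hτ : τ ∈ {τ | ¬ ∀ i, boundRun home β τ s i ≠ none}
  · rw [Set.indicator_of_mem hτ]
    simp only [Set.mem_ofPred_eq, not_forall, not_not] at hτ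
    obtain ⟨i, hi⟩ := hτ
    have hlast : (i : ℕ) + 1 < n := by
      have := (goodBound_boundRun hhome (by omega) β τ s).2 i
      have h3 : (i : ℕ) + 1 ≠ n := fun h => this h hi
      have := i.2
      omega
    rw [Pi.one_apply, ← ENNReal.ofReal_one]
    refine ENNReal.ofReal_le_ofReal ?_
    have hterm := Finset.single_le_sum (s := (Finset.univ : Finset (Fin n)))
      (f := fun j : Fin n => if boundRun home β τ s j = none then aliveFun n j else 0)
      (fun j _ => by split_ifs; exacts [(decrFun_aliveFun n).nonneg _, le_rfl]) (Finset.mem_univ i)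
    simp only [hi, aliveFun, hlast, if_true] at hterm
    exact hterm
  · rw [Set.indicator_of_notMem hτ]; exact zero_le

end Drift

/-! ### The cost of the sampler -/

section Cost

variable {n : ℕ} {α : Type*} [PartialOrder α] [Fintype α]

/-- The indicator of the event that block `j` is drawn. -/
def blockDrawn (home : Fin n ≃ α) (t : ℕ) (β : ℝ) (j : ℕ) (τ : ℕ → ℕ → StepTape) : ENNReal :=
  if ∀ j' < j, ¬ Coalesced home t β τ j' then 1 else 0

theorem measurableSet_blockDrawn (home : Fin n ≃ α) (t j : ℕ) : MeasurableSet
    {q : ℝ × (ℕ → ℕ → StepTape) | ∀ j' < j, ¬ Coalesced home t q.1 q.2 j'} := by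
  have : {q : ℝ × (ℕ → ℕ → StepTape) | ∀ j' < j, ¬ Coalesced home t q.1 q.2 j'} =
      ⋂ j' ∈ Finset.range j, {q | Coalesced home t q.1 q.2 j'}ᶜ := by
    ext q; simp
  rw [this]
  exact Finset.measurableSet_biInter _ fun j' _ => (measurableSet_coalesced home t j').compl

theorem measurableSet_blockDrawn_right (home : Fin n ≃ α) (t : ℕ) (β : ℝ) (j : ℕ) : MeasurableSet
    {τ : ℕ → ℕ → StepTape | ∀ j' < j, ¬ Coalesced home t β τ j'} := by
  have h := (measurable_const (a := β).prodMk measurable_id :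
    Measurable fun τ : ℕ → ℕ → StepTape => (β, τ)) (measurableSet_blockDrawn home t j)
  exact h

theorem measurable_blockDrawn (home : Fin n ≃ α) (t : ℕ) (β : ℝ) (j : ℕ) :
    Measurable (blockDrawn home t β j) :=
  Measurable.ite (measurableSet_blockDrawn_right home t β j) measurable_const measurable_const

theorem blockDrawn_update (home : Fin n ≃ α) (t : ℕ) (β : ℝ) (j : ℕ) (τ : ℕ → ℕ → StepTape)
    (x : ℕ → StepTape) : blockDrawn home t β j (Function.update τ j x) =
      blockDrawn home t β j τ := by
  have : ∀ j' < j, (Coalesced home t β (Function.update τ j x) j' ↔ Coalesced home t β τ j') := by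
    intro j' hj'
    unfold Coalesced blockBound
    rw [Function.update_of_ne hj'.ne]
  unfold blockDrawn
  congr 1
  exact propext (forall₂_congr fun j' hj' => not_congr (this j' hj'))

theorem lintegral_blockDrawn (home : Fin n ≃ α) (t : ℕ) (β : ℝ) (j : ℕ) :
    ∫⁻ τ, blockDrawn home t β j τ ∂blocksMeasure =
      blocksMeasure {τ | ∀ j' < j, ¬ Coalesced home t β τ j'} := by
  rw [← lintegral_indicator_one (measurableSet_blockDrawn_right home t β j)]
  refine lintegral_congr fun τ => ?_
  simp only [blockDrawn, Set.indicator, Set.mem_ofPred_eq, Pi.one_apply]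

/-- The blocks are independent, and the exponents of the earlier ones sum to `1 + 2 + ⋯ + 2 ^ (j -
1) = 2 ^ j - 1`. -/
theorem blocksMeasure_blockDrawn_le (home : Fin n ≃ α) (t : ℕ) (β : ℝ) (q : ENNReal)
    (hq : ∀ j, blockMeasure {τ | ¬ ∀ i, boundRun home β τ (blockLength t j) i ≠ none} ≤ q ^ 2 ^ j)
    (j : ℕ) : blocksMeasure {τ | ∀ j' < j, ¬ Coalesced home t β τ j'} ≤ q ^ (2 ^ j - 1) := by
  induction j with
  | zero => simp
  | succ j ih =>
    have hm : MeasurableSet {τ : ℕ → StepTape |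
        ¬ ∀ i, boundRun home β τ (blockLength t j) i ≠ none} := by
      have h2 := (measurable_boundRun home (blockLength t j)).comp
        (measurable_const (a := β).prodMk measurable_id : Measurable fun τ : ℕ → StepTape => (β, τ))
      exact h2 (MeasurableSet.of_discrete (s := {B : BState n α | ¬ ∀ i, B i ≠ none}))
    have key := lintegral_coord_mul blockMeasure j (blockDrawn home t β j)
      (measurable_blockDrawn home t β j) (blockDrawn_update home t β j)
      (Set.indicator {τ : ℕ → StepTape |
        ¬ ∀ i, boundRun home β τ (blockLength t j) i ≠ none} 1) (measurable_one.indicator hm)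
    rw [lintegral_indicator_one hm, lintegral_blockDrawn] at key
    have hpow : q ^ (2 ^ (j + 1) - 1) = q ^ (2 ^ j - 1) * q ^ 2 ^ j := by
      rw [← pow_add]
      congr 1
      have := Nat.one_le_two_pow (n := j)
      rw [pow_succ]; omega
    rw [← lintegral_blockDrawn, hpow]
    refine le_trans (le_of_eq ?_) (mul_le_mul' ih (hq j))
    rw [← key]
    refine lintegral_congr fun τ => ?_
    have hiff : (∀ j' < j + 1, ¬ Coalesced home t β τ j') ↔
        (∀ j' < j, ¬ Coalesced home t β τ j') ∧ ¬ Coalesced home t β τ j := by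
      constructor
      · exact fun h => ⟨fun j' hj' => h j' (by omega), h j (by omega)⟩
      · rintro ⟨h1, h2⟩ j' hj'
        rcases Nat.lt_succ_iff_lt_or_eq.1 hj' with h3 | rfl
        exacts [h1 j' h3, h2]
    have hind : Set.indicator {τ : ℕ → StepTape |
        ¬ ∀ i, boundRun home β τ (blockLength t j) i ≠ none} (1 : (ℕ → StepTape) → ENNReal) (τ j) =
        if ¬ Coalesced home t β τ j then 1 else 0 := by
      by_cases h : Coalesced home t β τ j
      · rw [if_neg (not_not.2 h), Set.indicator_of_notMem]
        exact fun h' => h' h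
      · rw [if_pos h, Set.indicator_of_mem, Pi.one_apply]
        exact h
    rw [hind]
    unfold blockDrawn
    simp only [hiff]
    split_ifs <;> simp_all

theorem measurable_generateCost (home : Fin n ≃ α) (t : ℕ) (w : ℝ → StepTape → ENNReal)
    (hw : Measurable (Function.uncurry w)) : Measurable fun q : ℝ × (ℕ → ℕ → StepTape) =>
      generateCost home t (w q.1) q.1 q.2 := by
  unfold generateCost
  refine Measurable.tsum fun j => Measurable.ite (measurableSet_blockDrawn home t j) ?_
    measurable_const
  refine Finset.measurable_sum _ fun s _ => ?_
  have h1 : Measurable fun q : ℝ × (ℕ → ℕ → StepTape) => q.2 j :=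
    (measurable_pi_apply j).comp measurable_snd
  have h2 : Measurable fun q : ℝ × (ℕ → ℕ → StepTape) => q.2 j s :=
    (measurable_pi_apply s).comp h1
  have h := hw.comp (measurable_fst.prodMk h2)
  exact h

/-- The expected cost of a sample. -/
theorem lintegral_generateCost_le (home : Fin n ≃ α) (t : ℕ) (β : ℝ) (q : ENNReal)
    (hq : ∀ j, blockMeasure {τ | ¬ ∀ i, boundRun home β τ (blockLength t j) i ≠ none} ≤ q ^ 2 ^ j)
    (w : StepTape → ENNReal) (hw : Measurable w) :
    ∫⁻ τ, generateCost home t w β τ ∂blocksMeasure ≤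
      t * (∑' j : ℕ, 2 ^ j * q ^ (2 ^ j - 1)) * ∫⁻ x, w x ∂stepMeasure := by
  have hws : ∀ s, Measurable fun x : ℕ → StepTape => w (x s) :=
    fun s => hw.comp (measurable_pi_apply s)
  have hF : ∀ j, Measurable fun x : ℕ → StepTape => ∑ s ∈ Finset.range (blockLength t j), w (x s) :=
    fun j => Finset.measurable_sum _ fun s _ => hws s
  have hterm : ∀ τ j, (if ∀ j' < j, ¬ Coalesced home t β τ j' then
      ∑ s ∈ Finset.range (blockLength t j), w (τ j s) else 0) =
      blockDrawn home t β j τ * ∑ s ∈ Finset.range (blockLength t j), w (τ j s) := by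
    intro τ j
    unfold blockDrawn
    split_ifs <;> simp
  unfold generateCost
  simp_rw [hterm]
  have hm : ∀ j, Measurable fun τ : ℕ → ℕ → StepTape =>
      blockDrawn home t β j τ * ∑ s ∈ Finset.range (blockLength t j), w (τ j s) := fun j => by
    have h := (hF j).comp (measurable_pi_apply j :
      Measurable fun τ : ℕ → ℕ → StepTape => τ j)
    exact (measurable_blockDrawn home t β j).mul h
  rw [lintegral_tsum fun j => (hm j).aemeasurable]
  rw [mul_assoc, ← ENNReal.tsum_mul_right, ← ENNReal.tsum_mul_left]
  refine ENNReal.tsum_le_tsum fun j => ?_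
  rw [lintegral_coord_mul blockMeasure j _ (measurable_blockDrawn home t β j)
    (blockDrawn_update home t β j) _ (hF j), lintegral_blockDrawn,
    lintegral_finsetSum _ fun s _ => hws s]
  simp_rw [lintegral_eval stepMeasure _ w hw]
  rw [Finset.sum_const, Finset.card_range, nsmul_eq_mul]
  calc _ ≤ q ^ (2 ^ j - 1) * ((blockLength t j : ENNReal) * ∫⁻ x, w x ∂stepMeasure) :=
        mul_le_mul' (blocksMeasure_blockDrawn_le home t β q hq j) le_rfl
    _ = _ := by
        rw [blockLength]; push_cast; ring

end Cost

/-! ### The total weight -/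

section TotalWeight

variable {n : ℕ} {α : Type*} [PartialOrder α] [Fintype α]

theorem wt_mono {b β : ℝ} (h : b ≤ β) (d : ℤ) : wt b d ≤ wt β d :=
  max_le_max le_rfl (min_le_min le_rfl (by linarith))

theorem continuous_wt (d : ℤ) : Continuous fun β => wt β d := by
  unfold wt; fun_prop

theorem weight_mono (home : Fin n ≃ α) {b β : ℝ} (h : b ≤ β) (σ : Fin n ≃ α) :
    weight home b σ ≤ weight home β σ := by
  unfold weight
  split_ifs
  · exact Finset.prod_le_prod (fun i _ => wt_nonneg _ _) fun i _ => wt_mono h _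
  · exact le_rfl

theorem totalWeight_mono (home : Fin n ≃ α) : Monotone (totalWeight home) :=
  fun _ _ h => Finset.sum_le_sum fun σ _ => weight_mono home h σ

theorem continuous_totalWeight (home : Fin n ≃ α) : Continuous (totalWeight home) := by
  refine continuous_finsetSum _ fun σ _ => ?_
  unfold weight
  split_ifs
  · exact continuous_finsetProd _ fun i _ => continuous_wt _
  · exact continuous_const

theorem weight_home {home : Fin n ≃ α} (hhome : IsLinExt home) {β : ℝ} (hβ : 0 ≤ β) :
    weight home β home = 1 := by
  rw [weight, if_pos hhome]
  refine Finset.prod_eq_one fun i _ => ?_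
  rw [wt, Equiv.symm_apply_apply, sub_self, min_eq_left (by push_cast; linarith),
    max_eq_right zero_le_one]

theorem one_le_totalWeight {home : Fin n ≃ α} (hhome : IsLinExt home) {β : ℝ} (hβ : 0 ≤ β) :
    1 ≤ totalWeight home β := by
  rw [← weight_home hhome hβ]
  exact Finset.single_le_sum (f := weight home β) (fun σ _ => weight_nonneg _ _ _)
    (Finset.mem_univ home)

/-- Only `home` has no item to the right of its home position. -/
theorem totalWeight_zero {home : Fin n ≃ α} (hhome : IsLinExt home) : totalWeight home 0 = 1 := by
  rw [totalWeight, Finset.sum_eq_single home, weight_home hhome le_rfl]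
  · intro σ _ hσ
    refine weight_eq_zero fun h => hσ ?_
    have hle : ∀ i : Fin n, i ≤ home.symm (σ i) := fun i => by
      have := h.2 i
      rw [Int.ceil_zero] at this
      exact Fin.le_def.2 (by omega)
    have hid : ∀ j : Fin n, σ.symm (home j) = j := by
      intro j
      induction j using WellFoundedLT.induction with
      | ind j ih =>
        have h1 : σ.symm (home j) ≤ j := by simpa using hle (σ.symm (home j))
        rcases lt_or_eq_of_le h1 with h2 | h2
        · have h3 := ih _ h2
          have h4 := home.injective (σ.symm.injective h3)
          exact absurd h4 h2.ne
        · exact h2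
    exact Equiv.ext fun i => by rw [← σ.apply_symm_apply (home i), hid i]
  · simp

/-- At `β = n` every linear extension has weight `1`, since no displacement reaches `n`. -/
theorem totalWeight_n (home : Fin n ≃ α) : totalWeight home n = numLinExt n α := by
  have h1 : ∀ σ, weight home n σ = if IsLinExt σ then 1 else 0 := by
    intro σ
    unfold weight
    split_ifs
    · refine Finset.prod_eq_one fun i _ => wt_of_lt ?_
      rw [Int.ceil_natCast]
      have := i.2
      omega
    · rfl
  unfold totalWeight numLinExt
  simp_rw [h1]
  rw [Finset.sum_boole, Nat.card_eq_fintype_card, Fintype.card_subtype]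

end TotalWeight

/-! ### One sample of TPA -/

section Next

variable {n : ℕ} {α : Type*} [PartialOrder α] [Fintype α]

/-- The distance by which the coordinate of `a` exceeds the home position of `a`. -/
def excess (home : Fin n ≃ α) (β : ℝ) (σ : Fin n ≃ α) (u : α → unitInterval) (a : α) : ℝ :=
  embed home β σ u a - (((home.symm a : ℕ) : ℝ) + 1)

theorem embed_bounds (home : Fin n ≃ α) (β : ℝ) (σ : Fin n ≃ α) (u : α → unitInterval) (a : α) :
    ((σ.symm a : ℕ) : ℝ) ≤ embed home β σ u a ∧ embed home β σ u a ≤ ((σ.symm a : ℕ) : ℝ) + 1 := by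
  have h0 := (u a).2.1
  have h1 := (u a).2.2
  have hp0 := penalty_pos β
  have hp1 := penalty_le_one β
  unfold embed
  split_ifs
  · constructor <;> linarith
  · constructor <;> nlinarith

theorem excess_le (home : Fin n ≃ α) (β : ℝ) (σ : Fin n ≃ α) (u : α → unitInterval) (a : α) :
    excess home β σ u a ≤ n := by
  have h1 := (embed_bounds home β σ u a).2
  have h2 : ((σ.symm a : ℕ) : ℝ) + 1 ≤ n := by exact_mod_cast (σ.symm a).2
  have h3 : (0 : ℝ) ≤ ((home.symm a : ℕ) : ℝ) := Nat.cast_nonneg _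
  unfold excess
  linarith

/-- The rounded coordinates are the positions of the items in a linear extension. -/
def RoundsToLinExt (x : α → ℝ) (n : ℕ) : Prop :=
  ∃ σ : Fin n ≃ α, IsLinExt σ ∧ ∀ a, ⌈x a⌉ = ((σ.symm a : ℕ) : ℤ) + 1

/-- The infimum is attained at the largest excess, or at `0` if that is negative. The set is empty
if `X` does not round to a linear extension, as can happen when a uniform number is `0`; its infimum
is then `0`. -/
theorem nextBeta_le_iff (home : Fin n ≃ α) (t : ℕ) (β : ℝ) (ω : SampleTape α) (c : ℝ) :
    nextBeta home t β ω ≤ c ↔ 0 ≤ c ∧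
      (¬ RoundsToLinExt (embed home β (generate home t β ω.1) ω.2) n ∨
        ∀ a, excess home β (generate home t β ω.1) ω.2 a ≤ c) := by
  set x := embed home β (generate home t β ω.1) ω.2 with hx
  set S : Set ℝ := {β' | β' ∈ Set.Icc (0 : ℝ) n ∧ x ∈ shell home β'} with hS
  have hnext : nextBeta home t β ω = sInf S := rfl
  have hn0 : (0 : ℝ) ≤ n := Nat.cast_nonneg n
  have hbdd : BddBelow S := ⟨0, fun y hy => hy.1.1⟩
  have hnonneg : 0 ≤ sInf S := Real.sInf_nonneg fun y hy => hy.1.1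
  rw [hnext]
  by_cases hr : RoundsToLinExt x n
  · have hmem : ∀ y, y ∈ S ↔ y ∈ Set.Icc (0 : ℝ) n ∧
        ∀ a, excess home β (generate home t β ω.1) ω.2 a ≤ y := by
      intro y
      simp only [hS, shell, Set.mem_ofPred_eq]
      exact and_congr_right fun _ => ⟨fun h => h.2, fun h => ⟨hr, h⟩⟩
    have hnS : (n : ℝ) ∈ S := (hmem _).2 ⟨⟨hn0, le_rfl⟩, fun a => excess_le _ _ _ _ a⟩
    simp only [hr, not_true, false_or]
    constructor
    · intro h
      refine ⟨hnonneg.trans h, fun a => le_trans ?_ h⟩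
      exact le_csInf ⟨_, hnS⟩ fun y hy => ((hmem y).1 hy).2 a
    · rintro ⟨h0, h1⟩
      refine (csInf_le hbdd ((hmem (min c n)).2 ⟨⟨le_min h0 hn0, min_le_right _ _⟩,
        fun a => le_min (h1 a) (excess_le _ _ _ _ a)⟩)).trans (min_le_left _ _)
  · have : S = ∅ := by
      ext y
      simp only [hS, shell, Set.mem_ofPred_eq, Set.mem_empty_iff_false, iff_false]
      exact fun h => hr h.2.1
    rw [this, Real.sInf_empty]
    simp [hr]

theorem nextBeta_nonneg (home : Fin n ≃ α) (t : ℕ) (β : ℝ) (ω : SampleTape α) :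
    0 ≤ nextBeta home t β ω := ((nextBeta_le_iff home t β ω _).1 le_rfl).1

theorem nextBeta_le_n (home : Fin n ≃ α) (t : ℕ) (β : ℝ) (ω : SampleTape α) :
    nextBeta home t β ω ≤ n :=
  (nextBeta_le_iff home t β ω n).2 ⟨Nat.cast_nonneg n, Or.inr fun a => excess_le _ _ _ _ a⟩

theorem measurable_embed (home : Fin n ≃ α) (t : ℕ) (a : α) : Measurable fun q : ℝ × SampleTape α =>
    embed home q.1 (generate home t q.1 q.2.1) q.2.2 a := by
  have h1 : ∀ σ : Fin n ≃ α, Measurable fun q : ℝ × SampleTape α => embed home q.1 σ q.2.2 a := by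
    intro σ
    have hu : Measurable fun q : ℝ × SampleTape α => (q.2.2 a : ℝ) :=
      measurable_subtype_coe.comp ((measurable_pi_apply a).comp measurable_snd.snd)
    have hp : Measurable fun q : ℝ × SampleTape α => penalty q.1 :=
      measurable_penalty.comp measurable_fst
    have hc : Measurable fun q : ℝ × SampleTape α => ⌈q.1⌉ :=
      Int.measurable_ceil.comp measurable_fst
    unfold embed
    refine measurable_const.add (Measurable.ite ?_ hu (hp.mul hu))
    exact hc (MeasurableSet.of_discrete
      (s := {z : ℤ | ((σ.symm a : ℕ) : ℤ) - ((home.symm a : ℕ) : ℤ) < z}))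
  have h2 : Measurable fun p : (ℝ × SampleTape α) × (Fin n ≃ α) =>
      embed home p.1.1 p.2 p.1.2.2 a :=
    measurable_from_prod_countable_left h1
  have h3 : Measurable fun q : ℝ × SampleTape α => (q.1, q.2.1) :=
    measurable_fst.prodMk measurable_snd.fst
  have h4 := (measurable_generate home t).comp h3
  have h5 := h2.comp (measurable_id.prodMk h4)
  exact h5

theorem measurable_nextBeta (home : Fin n ≃ α) (t : ℕ) :
    Measurable fun q : ℝ × SampleTape α => nextBeta home t q.1 q.2 := by
  refine measurable_of_Iic fun c => ?_
  have : (fun q : ℝ × SampleTape α => nextBeta home t q.1 q.2) ⁻¹' Set.Iic c =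
      {q | 0 ≤ c ∧ (¬ RoundsToLinExt (embed home q.1 (generate home t q.1 q.2.1) q.2.2) n ∨
        ∀ a, excess home q.1 (generate home t q.1 q.2.1) q.2.2 a ≤ c)} := by
    ext q; exact nextBeta_le_iff home t q.1 q.2 c
  rw [this]
  have hm := measurable_embed home t
  have h1 : MeasurableSet {q : ℝ × SampleTape α |
      RoundsToLinExt (embed home q.1 (generate home t q.1 q.2.1) q.2.2) n} := by
    have : {q : ℝ × SampleTape α |
        RoundsToLinExt (embed home q.1 (generate home t q.1 q.2.1) q.2.2) n} =
        ⋃ σ ∈ {σ : Fin n ≃ α | IsLinExt σ}, ⋂ a,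
          {q | ⌈embed home q.1 (generate home t q.1 q.2.1) q.2.2 a⌉ =
            ((σ.symm a : ℕ) : ℤ) + 1} := by
      ext q; simp [RoundsToLinExt]
    rw [this]
    refine MeasurableSet.biUnion (Set.to_countable _) fun σ _ => MeasurableSet.iInter fun a => ?_
    have h := Int.measurable_ceil.comp (hm a)
    exact h (measurableSet_singleton (((σ.symm a : ℕ) : ℤ) + 1))
  have h2 : MeasurableSet {q : ℝ × SampleTape α |
      ∀ a, excess home q.1 (generate home t q.1 q.2.1) q.2.2 a ≤ c} := by
    have : {q : ℝ × SampleTape α | ∀ a, excess home q.1 (generate home t q.1 q.2.1) q.2.2 a ≤ c} =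
        ⋂ a, {q | excess home q.1 (generate home t q.1 q.2.1) q.2.2 a ≤ c} := by
      ext q; simp
    rw [this]
    refine MeasurableSet.iInter fun a => measurableSet_le ?_ measurable_const
    unfold excess
    exact (hm a).sub measurable_const
  exact (MeasurableSet.const _).inter (h1.compl.union h2)

theorem measurable_nextBeta_right (home : Fin n ≃ α) (t : ℕ) (β : ℝ) :
    Measurable (nextBeta home t β) := by
  have h := (measurable_nextBeta home t).comp
    (measurable_const (a := β).prodMk measurable_id : Measurable fun ω : SampleTape α => (β, ω))
  exact h

theorem volume_coe_le (c : ℝ) :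
    (volume : Measure unitInterval) {u | (u : ℝ) ≤ c} = ENNReal.ofReal (min 1 c) := by
  rcases lt_or_ge c 0 with h0 | h0
  · have : {u : unitInterval | (u : ℝ) ≤ c} = ∅ := by
      ext u
      simp only [Set.mem_ofPred_eq, Set.mem_empty_iff_false, iff_false, not_le]
      exact h0.trans_le u.2.1
    rw [this, measure_empty, ENNReal.ofReal_of_nonpos ((min_le_right _ _).trans h0.le)]
  · rcases le_or_gt c 1 with h1 | h1
    · have : {u : unitInterval | (u : ℝ) ≤ c} = Set.Iic ⟨c, h0, h1⟩ := by
        ext u; simp [← Subtype.coe_le_coe]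
      rw [this, unitInterval.volume_Iic, min_eq_right h1]
    · have : {u : unitInterval | (u : ℝ) ≤ c} = Set.univ := by
        ext u; simpa using u.2.2.trans h1.le
      rw [this, measure_univ, min_eq_left h1.le, ENNReal.ofReal_one]

/-- The probability that a coordinate drawn at parameter value `β` exceeds the home position by at
most `b` is the quotient of the weights. -/
theorem volume_excess_le (home : Fin n ≃ α) {b β : ℝ} (hb : b ≤ β) (σ : Fin n ≃ α) (a : α)
    (hd : ((σ.symm a : ℕ) : ℤ) - ((home.symm a : ℕ) : ℤ) ≤ ⌈β⌉) :
    ENNReal.ofReal (wt β (((σ.symm a : ℕ) : ℤ) - ((home.symm a : ℕ) : ℤ))) *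
      (volume : Measure unitInterval) {v : unitInterval | ((σ.symm a : ℕ) : ℝ) +
        (if ((σ.symm a : ℕ) : ℤ) - ((home.symm a : ℕ) : ℤ) < ⌈β⌉ then (v : ℝ)
          else penalty β * (v : ℝ)) - (((home.symm a : ℕ) : ℝ) + 1) ≤ b} =
      ENNReal.ofReal (wt b (((σ.symm a : ℕ) : ℤ) - ((home.symm a : ℕ) : ℤ))) := by
  obtain ⟨d, hdd⟩ : ∃ d : ℤ, d = ((σ.symm a : ℕ) : ℤ) - ((home.symm a : ℕ) : ℤ) := ⟨_, rfl⟩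
  have hdr : (d : ℝ) = ((σ.symm a : ℕ) : ℝ) - ((home.symm a : ℕ) : ℝ) := by
    rw [hdd]; push_cast; ring
  have hofmax : ∀ y : ℝ, ENNReal.ofReal (max 0 y) = ENNReal.ofReal y := fun y => by
    rcases le_total y 0 with h | h
    · rw [max_eq_left h, ENNReal.ofReal_zero, ENNReal.ofReal_of_nonpos h]
    · rw [max_eq_right h]
  rw [← hdd] at hd ⊢
  rcases lt_or_eq_of_le hd with h | h
  · rw [wt_of_lt h, ENNReal.ofReal_one, one_mul]
    have : {v : unitInterval | ((σ.symm a : ℕ) : ℝ) + (if d < ⌈β⌉ then (v : ℝ)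
        else penalty β * (v : ℝ)) - (((home.symm a : ℕ) : ℝ) + 1) ≤ b} =
        {v : unitInterval | (v : ℝ) ≤ b - d + 1} := by
      ext v
      simp only [h, if_true, Set.mem_ofPred_eq]
      constructor <;> intro h' <;> linarith
    rw [this, volume_coe_le, wt, hofmax]
  · rw [wt_of_eq h]
    have hp := penalty_pos β
    have hp1 := penalty_le_one β
    have hle : b - d + 1 ≤ penalty β := by rw [h, penalty]; linarith
    have : {v : unitInterval | ((σ.symm a : ℕ) : ℝ) + (if d < ⌈β⌉ then (v : ℝ)
        else penalty β * (v : ℝ)) - (((home.symm a : ℕ) : ℝ) + 1) ≤ b} =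
        {v : unitInterval | (v : ℝ) ≤ (b - d + 1) / penalty β} := by
      ext v
      simp only [h.not_lt, if_false, Set.mem_ofPred_eq]
      rw [le_div_iff₀ hp]
      constructor <;> intro h' <;> linarith
    rw [this, volume_coe_le, ← ENNReal.ofReal_mul hp.le, wt, hofmax,
      min_eq_right ((div_le_one hp).2 hle), min_eq_right (hle.trans hp1),
      mul_div_cancel₀ _ hp.ne']

/-- The coordinates are independent, so the weights of `σ` at `b` and `β` differ by the probability
that no excess is larger than `b`. -/
theorem weight_mul_pi_excess_le (home : Fin n ≃ α) {b β : ℝ} (hb : b ≤ β) {σ : Fin n ≃ α}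
    (hσ : InSupport home β σ) :
    ENNReal.ofReal (weight home β σ) * (Measure.pi fun _ : α => (volume : Measure unitInterval))
      {u | ∀ a, excess home β σ u a ≤ b} = ENNReal.ofReal (weight home b σ) := by
  have hprod : ∀ β' : ℝ, ENNReal.ofReal (weight home β' σ) =
      ∏ a, ENNReal.ofReal (wt β' (((σ.symm a : ℕ) : ℤ) - ((home.symm a : ℕ) : ℤ))) := by
    intro β'
    rw [weight, if_pos hσ.1, ENNReal.ofReal_prod_of_nonneg fun i _ => wt_nonneg _ _,
      ← Equiv.prod_comp σ]
    simp
  have hset : {u : α → unitInterval | ∀ a, excess home β σ u a ≤ b} = Set.pi Set.univ fun a =>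
      {v : unitInterval | ((σ.symm a : ℕ) : ℝ) +
        (if ((σ.symm a : ℕ) : ℤ) - ((home.symm a : ℕ) : ℤ) < ⌈β⌉ then (v : ℝ)
          else penalty β * (v : ℝ)) - (((home.symm a : ℕ) : ℝ) + 1) ≤ b} := by
    ext u; simp [excess, embed]
  rw [hset, Measure.pi_pi, hprod, hprod, ← Finset.prod_mul_distrib]
  refine Finset.prod_congr rfl fun a _ => volume_excess_le home hb σ a ?_
  simpa using hσ.2 (σ.symm a)

/-- Almost surely some block of the coupling from the past coalesces. -/
def Coalesces (home : Fin n ≃ α) (t : ℕ) (β : ℝ) : Prop :=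
  Filter.Tendsto (fun J => blocksMeasure {τ | ∀ j < J, ¬ Coalesced home t β τ j})
    Filter.atTop (nhds 0)

/-- Almost surely no uniform number is `0`, so the coordinates round up to the positions. -/
theorem ae_pos_sampleMeasure : ∀ᵐ ω ∂(sampleMeasure α), ∀ a, 0 < ((ω.2 a : unitInterval) : ℝ) := by
  have h1 : ∀ a : α, ∀ᵐ u ∂(Measure.pi fun _ : α => (volume : Measure unitInterval)),
      0 < ((u a : unitInterval) : ℝ) := by
    intro a
    have h2 : ∀ᵐ v : unitInterval ∂volume, 0 < (v : ℝ) := by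
      have h3 : {v : unitInterval | ¬ 0 < (v : ℝ)} = {v : unitInterval | (v : ℝ) ≤ 0} := by
        ext; simp only [Set.mem_ofPred_eq, not_lt]
      refine ae_iff.2 ((congrArg (volume : Measure unitInterval) h3).trans ?_)
      rw [volume_coe_le]
      simp
    exact (measurePreserving_eval (fun _ : α => (volume : Measure unitInterval))
      a).quasiMeasurePreserving.ae h2
  exact Measure.quasiMeasurePreserving_snd.ae (ae_all_iff.2 h1)

/-- The law of the next parameter value: its distribution function is the quotient of the total
weights. -/
theorem totalWeight_mul_nextBeta_le {home : Fin n ≃ α} (hhome : IsLinExt home) (hn : 2 ≤ n) {t : ℕ}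
    {b β : ℝ} (hb0 : 0 ≤ b) (hb : b ≤ β) (hco : Coalesces home t β) :
    ENNReal.ofReal (totalWeight home β) * sampleMeasure α {ω | nextBeta home t β ω ≤ b} =
      ENNReal.ofReal (totalWeight home b) := by
  have hgen : ∀ σ, MeasurableSet {τ : ℕ → ℕ → StepTape | generate home t β τ = σ} := by
    intro σ
    have h := (measurable_generate home t).comp (measurable_const (a := β).prodMk measurable_id :
      Measurable fun τ : ℕ → ℕ → StepTape => (β, τ))
    exact h (MeasurableSet.of_discrete (s := {σ}))
  have hsplit : sampleMeasure α {ω | nextBeta home t β ω ≤ b} =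
      ∑ σ, sampleMeasure α {ω | generate home t β ω.1 = σ ∧ nextBeta home t β ω ≤ b} := by
    have : {ω : SampleTape α | nextBeta home t β ω ≤ b} =
        ⋃ σ ∈ (Finset.univ : Finset (Fin n ≃ α)),
          {ω | generate home t β ω.1 = σ ∧ nextBeta home t β ω ≤ b} := by
      ext ω; simp
    rw [this, measure_biUnion_finset]
    · intro σ _ σ' _ hne
      exact Set.disjoint_left.2 fun ω h h' => hne (h.1.symm.trans h'.1)
    · intro σ _
      have h1 : MeasurableSet {ω : SampleTape α | generate home t β ω.1 = σ} :=
        measurable_fst (hgen σ)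
      exact h1.inter (measurable_nextBeta_right home t β measurableSet_Iic)
  have hrect : ∀ σ, IsLinExt σ →
      sampleMeasure α {ω | generate home t β ω.1 = σ ∧ nextBeta home t β ω ≤ b} =
      blocksMeasure {τ | generate home t β τ = σ} *
        (Measure.pi fun _ : α => (volume : Measure unitInterval))
          {u | ∀ a, excess home β σ u a ≤ b} := by
    intro σ hσ
    rw [← Measure.prod_prod]
    refine measure_congr ?_
    filter_upwards [ae_pos_sampleMeasure (α := α)] with ω hω
    refine propext (and_congr_right fun hg => ?_)
    have hg' : generate home t β ω.1 = σ := hg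
    -- off a null set, rounding a coordinate up gives the position of its item
    have hr : RoundsToLinExt (embed home β σ ω.2) n := by
      refine ⟨σ, hσ, fun a => ?_⟩
      rw [Int.ceil_eq_iff]
      have h1 := (embed_bounds home β σ ω.2 a).2
      have h2 := hω a
      have h3 := penalty_pos β
      push_cast
      refine ⟨?_, h1⟩
      unfold embed
      split_ifs
      · linarith
      · have := mul_pos h3 h2; linarith
    refine (nextBeta_le_iff home t β ω b).trans ?_
    rw [hg']
    simp only [hb0, true_and, hr, not_true, false_or]
    rfl
  rw [hsplit, Finset.mul_sum]
  unfold totalWeight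
  rw [ENNReal.ofReal_sum_of_nonneg fun σ _ => weight_nonneg home b σ]
  refine Finset.sum_congr rfl fun σ _ => ?_
  have hlaw := blocksMeasure_generate hhome hn t β hco σ
  by_cases hσ : InSupport home β σ
  · rw [hrect σ hσ.1, ← mul_assoc]
    exact (congrArg (· * _) hlaw).trans (weight_mul_pi_excess_le home hb hσ)
  · have hz := weight_eq_zero hσ
    have hz' : weight home b σ = 0 :=
      le_antisymm (hz ▸ weight_mono home hb σ) (weight_nonneg _ _ _)
    rw [hz', ENNReal.ofReal_zero]
    rw [hz, ENNReal.ofReal_zero] at hlaw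
    refine le_antisymm ?_ zero_le
    refine le_trans (mul_le_mul_right ?_ _) hlaw.le
    refine (measure_mono (t := {τ | generate home t β τ = σ} ×ˢ Set.univ) ?_).trans ?_
    · exact fun ω hω => ⟨hω.1, trivial⟩
    · unfold sampleMeasure
      rw [Measure.prod_prod, measure_univ, mul_one]

/-- Given that the next parameter value is positive, the total weight there is uniformly distributed
on the interval from `1` to the present total weight `v`; this event has probability
`(v - 1) / v`. -/
theorem lintegral_nextBeta {home : Fin n ≃ α} (hhome : IsLinExt home) (hn : 2 ≤ n) {t : ℕ}
    {β : ℝ} (hβ : 0 ≤ β) (hco : Coalesces home t β) (g : ℝ → ENNReal) (hg : Measurable g) :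
    ENNReal.ofReal (totalWeight home β) * ∫⁻ ω, (if 0 < nextBeta home t β ω then
        g (totalWeight home (nextBeta home t β ω)) else 0) ∂(sampleMeasure α) =
      ∫⁻ w in Set.Ioc 1 (totalWeight home β), g w := by
  set v := totalWeight home β with hv
  set Z := totalWeight home with hZ
  have hv1 : 1 ≤ v := one_le_totalWeight hhome hβ
  have hmN := measurable_nextBeta_right home t β
  have hmZ : Measurable fun ω => Z (nextBeta home t β ω) :=
    (continuous_totalWeight home).measurable.comp hmN
  have hmpos : MeasurableSet {ω | 0 < nextBeta home t β ω} := hmN measurableSet_Ioi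
  have hlaw : ∀ b, 0 ≤ b → b ≤ β → ENNReal.ofReal v *
      sampleMeasure α {ω | nextBeta home t β ω ≤ b} = ENNReal.ofReal (Z b) :=
    fun b hb0 hb => totalWeight_mul_nextBeta_le hhome hn hb0 hb hco
  have hv0 : ENNReal.ofReal v ≠ 0 := by
    rw [Ne, ENNReal.ofReal_eq_zero, not_le]; linarith
  have hae : ∀ᵐ ω ∂(sampleMeasure α), nextBeta home t β ω ≤ β := by
    have h1 := hlaw β hβ le_rfl
    have h2 : sampleMeasure α {ω | nextBeta home t β ω ≤ β} = 1 := by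
      have h3 : ENNReal.ofReal v * sampleMeasure α {ω | nextBeta home t β ω ≤ β} =
          ENNReal.ofReal v * 1 := by rw [h1, mul_one]
      exact (ENNReal.mul_right_inj hv0 ENNReal.ofReal_ne_top).1 h3
    exact (prob_compl_eq_zero_iff (hmN measurableSet_Iic)).2 h2
  have hmeas : ENNReal.ofReal v • ((sampleMeasure α).restrict
      {ω | 0 < nextBeta home t β ω}).map (fun ω => Z (nextBeta home t β ω)) =
      volume.restrict (Set.Ioc 1 v) := by
    have hfin : IsFiniteMeasure (ENNReal.ofReal v • ((sampleMeasure α).restrict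
      {ω | 0 < nextBeta home t β ω}).map (fun ω => Z (nextBeta home t β ω))) :=
      Measure.smul_finite _ ENNReal.ofReal_ne_top
    refine Measure.ext_of_Iic _ _ fun w => ?_
    rw [Measure.smul_apply, smul_eq_mul, Measure.map_apply hmZ measurableSet_Iic,
      Measure.restrict_apply (hmZ measurableSet_Iic), Measure.restrict_apply measurableSet_Iic]
    have hI : Set.Iic w ∩ Set.Ioc 1 v = Set.Ioc 1 (min w v) := by
      ext y; simp only [Set.mem_inter_iff, Set.mem_Iic, Set.mem_Ioc, le_min_iff]; tauto
    rw [hI, Real.volume_Ioc]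
    rcases lt_or_ge w 1 with hw | hw
    · have : (fun ω => Z (nextBeta home t β ω)) ⁻¹' Set.Iic w ∩
          {ω | 0 < nextBeta home t β ω} = ∅ := by
        ext ω
        simp only [Set.mem_inter_iff, Set.mem_preimage, Set.mem_Iic, Set.mem_ofPred_eq,
          Set.mem_empty_iff_false, iff_false, not_and, not_lt]
        intro h
        have := one_le_totalWeight hhome (nextBeta_nonneg home t β ω)
        exact absurd (this.trans h) (not_le.2 hw)
      rw [this, measure_empty, mul_zero, ENNReal.ofReal_of_nonpos]
      linarith [min_le_left w v]
    · set w' := min w v with hw'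
      have hw1 : 1 ≤ w' := le_min hw hv1
      -- the largest parameter value at which the total weight is at most `w'`
      have hcpt : IsCompact (Set.Icc 0 β ∩ Z ⁻¹' Set.Iic w') :=
        isCompact_Icc.inter_right (isClosed_Iic.preimage (continuous_totalWeight home))
      obtain ⟨b₀, hb₀, hZb₀⟩ := intermediate_value_Icc hβ
        (continuous_totalWeight home).continuousOn
        (show w' ∈ Set.Icc (totalWeight home 0) (totalWeight home β) by
          rw [totalWeight_zero hhome]; exact ⟨hw1, min_le_right _ _⟩)
      obtain ⟨b, hb, hmax⟩ := hcpt.exists_isGreatest ⟨b₀, hb₀, hZb₀.le⟩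
      have hZb : Z b = w' := le_antisymm hb.2
        (hZb₀ ▸ totalWeight_mono home (hmax ⟨hb₀, hZb₀.le⟩))
      have hset : sampleMeasure α ((fun ω => Z (nextBeta home t β ω)) ⁻¹' Set.Iic w ∩
          {ω | 0 < nextBeta home t β ω}) = sampleMeasure α
          ({ω | nextBeta home t β ω ≤ b} \ {ω | nextBeta home t β ω ≤ 0}) := by
        refine measure_congr ?_
        filter_upwards [hae] with ω hω
        refine propext ?_
        change (Z (nextBeta home t β ω) ≤ w ∧ 0 < nextBeta home t β ω) ↔
          (nextBeta home t β ω ≤ b ∧ ¬ nextBeta home t β ω ≤ 0)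
        rw [not_le]
        refine and_congr_left fun _ => ⟨fun h => ?_, fun h => ?_⟩
        · exact hmax ⟨⟨nextBeta_nonneg _ _ _ _, hω⟩, le_min h (totalWeight_mono home hω)⟩
        · exact (totalWeight_mono home h).trans (hZb.le.trans (min_le_left _ _))
      have hsub : {ω | nextBeta home t β ω ≤ 0} ⊆ {ω | nextBeta home t β ω ≤ b} :=
        fun ω hω => le_trans hω hb.1.1
      rw [hset, measure_sdiff hsub
        (hmN measurableSet_Iic).nullMeasurableSet (measure_ne_top _ _),
        ENNReal.mul_sub fun _ _ => ENNReal.ofReal_ne_top, hlaw b hb.1.1 hb.1.2, hlaw 0 le_rfl hβ,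
        hZb, ← ENNReal.ofReal_sub _ (by rw [hZ, totalWeight_zero hhome]; norm_num), hZ,
        totalWeight_zero hhome]
  rw [← hmeas, lintegral_smul_measure, lintegral_map hg hmZ, smul_eq_mul,
    ← lintegral_indicator hmpos]
  congr 1

/-- A run stops at the present sample with probability `1 / Z(β)`, where `Z` is the total weight. -/
theorem sampleMeasure_nextBeta_le_zero {home : Fin n ≃ α} (hhome : IsLinExt home) (hn : 2 ≤ n)
    {t : ℕ} {β : ℝ} (hβ : 0 ≤ β) (hco : Coalesces home t β) :
    ENNReal.ofReal (totalWeight home β) * sampleMeasure α {ω | nextBeta home t β ω ≤ 0} = 1 := by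
  rw [totalWeight_mul_nextBeta_le hhome hn le_rfl hβ hco, totalWeight_zero hhome,
    ENNReal.ofReal_one]

end Next

/-! ### A run of TPA -/

section Runs

variable {n : ℕ} {α : Type*} [PartialOrder α] [Fintype α]

/-- The law of the randomness of a run. -/
abbrev runMeasure (α : Type*) [Fintype α] : Measure (ℕ → SampleTape α) :=
  Measure.infinitePi fun _ : ℕ => sampleMeasure α

theorem runBeta_mem (home : Fin n ≃ α) (t : ℕ) (ω : ℕ → SampleTape α) (s : ℕ) :
    runBeta home t ω s ∈ Set.Icc (0 : ℝ) n := by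
  induction s with
  | zero => simp [runBeta]
  | succ s ih =>
    simp only [runBeta]
    split_ifs
    · exact ⟨nextBeta_nonneg _ _ _ _, nextBeta_le_n _ _ _ _⟩
    · exact ih

theorem runBeta_update (home : Fin n ≃ α) (t : ℕ) (ω : ℕ → SampleTape α) (s : ℕ)
    (x : SampleTape α) {k : ℕ} (hk : k ≤ s) :
    runBeta home t (Function.update ω s x) k = runBeta home t ω k := by
  induction k with
  | zero => rfl
  | succ k ih =>
    simp only [runBeta]
    rw [ih (by omega), Function.update_of_ne (by omega)]

theorem measurable_runBeta (home : Fin n ≃ α) (t s : ℕ) :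
    Measurable fun ω : ℕ → SampleTape α => runBeta home t ω s := by
  induction s with
  | zero => exact measurable_const
  | succ s ih =>
    have h := (measurable_nextBeta home t).comp (ih.prodMk
      (measurable_pi_apply s : Measurable fun ω : ℕ → SampleTape α => ω s))
    exact Measurable.ite (ih measurableSet_Ioi) h ih

theorem measurableSet_alive (home : Fin n ≃ α) (t s : ℕ) :
    MeasurableSet {ω : ℕ → SampleTape α | 0 < runBeta home t ω s} :=
  measurable_runBeta home t s measurableSet_Ioi

theorem runBeta_succ_of_pos {home : Fin n ≃ α} {t : ℕ} {ω : ℕ → SampleTape α} {s : ℕ}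
    (h : 0 < runBeta home t ω s) :
    runBeta home t ω (s + 1) = nextBeta home t (runBeta home t ω s) (ω s) := by
  simp [runBeta, h]

theorem runBeta_pos_of_succ {home : Fin n ≃ α} {t : ℕ} {ω : ℕ → SampleTape α} {s : ℕ}
    (h : 0 < runBeta home t ω (s + 1)) : 0 < runBeta home t ω s := by
  by_contra h0
  simp only [runBeta, if_neg h0] at h
  exact h0 h

/-- A sample is independent of the parameter at which it is drawn. -/
theorem lintegral_alive (home : Fin n ≃ α) (t s : ℕ) (F : ℝ → SampleTape α → ENNReal)
    (hF : Measurable (Function.uncurry F)) :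
    ∫⁻ ω, (if 0 < runBeta home t ω s then F (runBeta home t ω s) (ω s) else 0) ∂(runMeasure α) =
      ∫⁻ ω, (if 0 < runBeta home t ω s then
        ∫⁻ x, F (runBeta home t ω s) x ∂(sampleMeasure α) else 0) ∂(runMeasure α) := by
  have h := lintegral_coord (sampleMeasure α) s (fun ω => runBeta home t ω s)
    (measurable_runBeta home t s) (fun ω x => runBeta_update home t ω s x le_rfl)
    (fun β x => if 0 < β then F β x else 0)
    (Measurable.ite (measurable_fst measurableSet_Ioi) hF measurable_const)
  refine h.trans (lintegral_congr fun ω => ?_)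
  split_ifs <;> simp

/-- The expectation of a function of the next parameter value, conditioned on the present one. -/
theorem lintegral_alive_succ (home : Fin n ≃ α) (t s : ℕ) (H : ℝ → ENNReal) (hH : Measurable H) :
    ∫⁻ ω, (if 0 < runBeta home t ω (s + 1) then H (runBeta home t ω (s + 1)) else 0)
        ∂(runMeasure α) =
      ∫⁻ ω, (if 0 < runBeta home t ω s then
        ∫⁻ x, (if 0 < nextBeta home t (runBeta home t ω s) x then
          H (nextBeta home t (runBeta home t ω s) x) else 0) ∂(sampleMeasure α) else 0)
        ∂(runMeasure α) := by
  rw [← lintegral_alive home t s (fun β x => if 0 < nextBeta home t β x then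
    H (nextBeta home t β x) else 0)]
  · refine lintegral_congr fun ω => ?_
    by_cases h : 0 < runBeta home t ω s
    · rw [if_pos h, runBeta_succ_of_pos h]
    · rw [if_neg h, if_neg fun h' => h (runBeta_pos_of_succ h')]
  · exact Measurable.ite (measurable_nextBeta home t measurableSet_Ioi)
      (hH.comp (measurable_nextBeta home t)) measurable_const

theorem eq_ofReal_div {v R : ℝ} (hv : 0 < v) {I : ENNReal}
    (h : ENNReal.ofReal v * I = ENNReal.ofReal R) : I = ENNReal.ofReal (R / v) := by
  rw [ENNReal.ofReal_div_of_pos hv, ← h, mul_comm, ENNReal.mul_div_cancel_right]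
  · simpa using hv
  · exact ENNReal.ofReal_ne_top

/-- The integral of `w ^ c` over the interval from `1` to `Z(β)`, divided by `Z(β)`. -/
theorem lintegral_nextBeta_rpow {home : Fin n ≃ α} (hhome : IsLinExt home) (hn : 2 ≤ n) {t : ℕ}
    {β : ℝ} (hβ : 0 ≤ β) (hco : Coalesces home t β) {c : ℝ} (hc : -1 < c) :
    ∫⁻ ω, (if 0 < nextBeta home t β ω then
        ENNReal.ofReal (totalWeight home (nextBeta home t β ω) ^ c) else 0) ∂(sampleMeasure α) =
      ENNReal.ofReal ((totalWeight home β ^ (c + 1) - 1) / (c + 1) / totalWeight home β) := by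
  have hv := one_le_totalWeight hhome hβ
  refine eq_ofReal_div (by linarith) ?_
  rw [lintegral_nextBeta hhome hn hβ hco (fun w => ENNReal.ofReal (w ^ c)) (by fun_prop),
    ← ofReal_integral_eq_lintegral_ofReal, ← intervalIntegral.integral_of_le hv,
    integral_rpow (Or.inl hc), Real.one_rpow]
  · exact (intervalIntegrable_iff_integrableOn_Ioc_of_le hv).1
      (intervalIntegral.intervalIntegrable_rpow' hc)
  · refine (ae_restrict_iff' measurableSet_Ioc).2 (Filter.Eventually.of_forall fun w hw => ?_)
    exact Real.rpow_nonneg (by linarith [hw.1]) _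

/-- The integral of `1 + ln w` over the interval from `1` to `Z(β)`, divided by `Z(β)`. -/
theorem lintegral_nextBeta_log {home : Fin n ≃ α} (hhome : IsLinExt home) (hn : 2 ≤ n) {t : ℕ}
    {β : ℝ} (hβ : 0 ≤ β) (hco : Coalesces home t β) :
    ∫⁻ ω, (if 0 < nextBeta home t β ω then
        ENNReal.ofReal (1 + Real.log (totalWeight home (nextBeta home t β ω))) else 0)
          ∂(sampleMeasure α) =
      ENNReal.ofReal (Real.log (totalWeight home β)) := by
  have hv := one_le_totalWeight hhome hβ
  have h : Real.log (totalWeight home β) =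
      totalWeight home β * Real.log (totalWeight home β) / totalWeight home β := by
    field_simp
  rw [h]
  refine eq_ofReal_div (by linarith) ?_
  rw [lintegral_nextBeta hhome hn hβ hco (fun w => ENNReal.ofReal (1 + Real.log w))
    (by fun_prop), ← ofReal_integral_eq_lintegral_ofReal, ← intervalIntegral.integral_of_le hv,
    intervalIntegral.integral_add (by simp) intervalIntegral.intervalIntegrable_log', integral_log]
  · simp
  · exact (intervalIntegrable_iff_integrableOn_Ioc_of_le hv).1
      ((by simp : IntervalIntegrable (fun _ => (1 : ℝ)) volume _ _).add
        intervalIntegral.intervalIntegrable_log')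
  · refine (ae_restrict_iff' measurableSet_Ioc).2 (Filter.Eventually.of_forall fun w hw => ?_)
    have := Real.log_nonneg hw.1.le
    simp only [Pi.zero_apply]; linarith

theorem sampleMeasure_nextBeta_le_zero' {home : Fin n ≃ α} (hhome : IsLinExt home) (hn : 2 ≤ n)
    {t : ℕ} {β : ℝ} (hβ : 0 ≤ β) (hco : Coalesces home t β) :
    sampleMeasure α {ω | nextBeta home t β ω ≤ 0} = ENNReal.ofReal (1 / totalWeight home β) := by
  refine eq_ofReal_div (by linarith [one_le_totalWeight hhome hβ]) ?_
  rw [sampleMeasure_nextBeta_le_zero hhome hn hβ hco, ENNReal.ofReal_one]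

/-- The potential `1 + ln Z(β)` of a run, where `Z` is the total weight, decreases by one on average
with every sample. -/
theorem lintegral_logPotential {home : Fin n ≃ α} (hhome : IsLinExt home) (hn : 2 ≤ n) {t : ℕ}
    (hco : ∀ β : ℝ, 0 < β → β ≤ n → Coalesces home t β) (s : ℕ) :
    ∫⁻ ω, (if 0 < runBeta home t ω s then
        ENNReal.ofReal (1 + Real.log (totalWeight home (runBeta home t ω s))) else 0)
          ∂(runMeasure α) =
      runMeasure α {ω | 0 < runBeta home t ω s} +
      ∫⁻ ω, (if 0 < runBeta home t ω (s + 1) then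
        ENNReal.ofReal (1 + Real.log (totalWeight home (runBeta home t ω (s + 1)))) else 0)
          ∂(runMeasure α) := by
  have hm := measurableSet_alive (α := α) home t s
  have hZ := (continuous_totalWeight home).measurable
  rw [lintegral_alive_succ home t s (fun β => ENNReal.ofReal (1 + Real.log (totalWeight home β)))
    (by fun_prop), ← lintegral_indicator_one hm,
    ← lintegral_add_left (measurable_one.indicator hm)]
  refine lintegral_congr fun ω => ?_
  by_cases h : 0 < runBeta home t ω s
  · have hb := (runBeta_mem home t ω s).2
    have hv := Real.log_nonneg (one_le_totalWeight hhome h.le)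
    simp only [h, if_true]
    rw [lintegral_nextBeta_log hhome hn h.le (hco _ h hb), Set.indicator_of_mem (by exact h),
      ENNReal.ofReal_add zero_le_one hv]
    simp
  · simp [h]

/-- The expected number of samples in a run is at most the initial value `1 + ln L(P)` of the
potential. -/
theorem sum_alive_le {home : Fin n ≃ α} (hhome : IsLinExt home) (hn : 2 ≤ n) {t : ℕ}
    (hco : ∀ β : ℝ, 0 < β → β ≤ n → Coalesces home t β) :
    ∑' s, runMeasure α {ω | 0 < runBeta home t ω s} ≤
      ENNReal.ofReal (1 + Real.log (numLinExt n α)) := by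
  set U : ℕ → ENNReal := fun s => ∫⁻ ω, (if 0 < runBeta home t ω s then
        ENNReal.ofReal (1 + Real.log (totalWeight home (runBeta home t ω s))) else 0)
          ∂(runMeasure α) with hU
  have h0 : U 0 = ENNReal.ofReal (1 + Real.log (numLinExt n α)) := by
    have : (0 : ℝ) < n := by exact_mod_cast (by omega : 0 < n)
    simp [hU, runBeta, this, totalWeight_n]
  have h1 : ∀ s, U 0 = ∑ k ∈ Finset.range s, runMeasure α {ω | 0 < runBeta home t ω k} + U s := by
    intro s
    induction s with
    | zero => simp
    | succ s ih =>
      rw [ih, Finset.sum_range_succ, add_assoc, ← lintegral_logPotential hhome hn hco s]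
  rw [← h0, ENNReal.tsum_eq_iSup_nat]
  exact iSup_le fun s => (h1 s) ▸ le_self_add

/-- Almost surely a run ends. -/
theorem ae_dies {home : Fin n ≃ α} (hhome : IsLinExt home) (hn : 2 ≤ n) {t : ℕ}
    (hco : ∀ β : ℝ, 0 < β → β ≤ n → Coalesces home t β) :
    ∀ᵐ ω ∂(runMeasure α), ∃ s, runBeta home t ω s ≤ 0 := by
  have hne : ∑' s, runMeasure α {ω | 0 < runBeta home t ω s} ≠ ⊤ :=
    ne_top_of_le_ne_top ENNReal.ofReal_ne_top (sum_alive_le hhome hn hco)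
  have h := measure_setOfPred_frequently_eq_zero hne
  rw [ae_iff]
  refine measure_mono_null (fun ω hω => ?_) h
  simp only [Set.mem_ofPred_eq, not_exists, not_le] at hω ⊢
  exact (Filter.Eventually.of_forall hω).frequently

/-- If a run ends, the sample with number `runCount` (counted from `0`) is its last. -/
theorem runCount_spec {home : Fin n ≃ α} (hn : 2 ≤ n) {t : ℕ} {ω : ℕ → SampleTape α}
    (h : ∃ s, runBeta home t ω s ≤ 0) : 0 < runBeta home t ω (runCount home t ω) ∧
      runBeta home t ω (runCount home t ω + 1) ≤ 0 := by
  have h1 : sInf {s | runBeta home t ω s ≤ 0} ∈ {s | runBeta home t ω s ≤ 0} := Nat.sInf_mem h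
  have h2 : sInf {s | runBeta home t ω s ≤ 0} ≠ 0 := by
    intro h0
    rw [h0] at h1
    have : (0 : ℝ) < n := by exact_mod_cast (by omega : 0 < n)
    exact not_lt.2 (show (n : ℝ) ≤ 0 from h1) this
  have h3 : runCount home t ω + 1 = sInf {s | runBeta home t ω s ≤ 0} := by
    unfold runCount; omega
  refine ⟨not_le.1 fun h4 => ?_, by rw [h3]; exact h1⟩
  have : sInf {s | runBeta home t ω s ≤ 0} ≤ runCount home t ω := Nat.sInf_le h4
  omega

theorem measurable_runCount (home : Fin n ≃ α) (t : ℕ) : Measurable (runCount (α := α) home t) := by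
  have h := measurable_sInf_nat (fun s (ω : ℕ → SampleTape α) => runBeta home t ω s ≤ 0)
    fun s => measurable_runBeta home t s measurableSet_Iic
  exact (measurable_from_top (f := fun k : ℕ => k - 1)).comp h

/-- The number of samples in a run exceeds its count by one, so the expected count is at most
`ln L(P)`. -/
theorem lintegral_runCount_le {home : Fin n ≃ α} (hhome : IsLinExt home) (hn : 2 ≤ n) {t : ℕ}
    (hco : ∀ β : ℝ, 0 < β → β ≤ n → Coalesces home t β) :
    ∫⁻ ω, (runCount home t ω : ENNReal) ∂(runMeasure α) ≤
      ENNReal.ofReal (Real.log (numLinExt n α)) := by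
  have hA : 0 ≤ Real.log (numLinExt n α) := Real.log_natCast_nonneg _
  have h1 : ∫⁻ ω, (1 + (runCount home t ω : ENNReal)) ∂(runMeasure α) ≤
      1 + ENNReal.ofReal (Real.log (numLinExt n α)) := by
    rw [← ENNReal.ofReal_one, ← ENNReal.ofReal_add zero_le_one hA, ENNReal.ofReal_one]
    refine le_trans ?_ (sum_alive_le hhome hn hco)
    have h2 : ∀ s, runMeasure α {ω | 0 < runBeta home t ω s} =
        ∫⁻ ω, {ω | 0 < runBeta home t ω s}.indicator 1 ω ∂(runMeasure α) :=
      fun s => (lintegral_indicator_one (measurableSet_alive home t s)).symm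
    simp_rw [h2]
    rw [← lintegral_tsum fun s =>
      (measurable_one.indicator (measurableSet_alive home t s)).aemeasurable]
    refine lintegral_mono_ae ?_
    filter_upwards [ae_dies hhome hn hco] with ω hω
    have hpos : ∀ k ≤ runCount home t ω, 0 < runBeta home t ω k := fun k hk => by
      refine Nat.decreasingInduction' (fun j _ _ hj => runBeta_pos_of_succ hj) hk
        (runCount_spec hn hω).1
    refine le_trans (le_of_eq ?_) (ENNReal.sum_le_tsum (Finset.range (runCount home t ω + 1)))
    rw [Finset.sum_congr rfl fun k hk => Set.indicator_of_mem (show ω ∈ {ω | 0 < runBeta home t ω k}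
      from hpos k (Nat.lt_succ_iff.1 (Finset.mem_range.1 hk))) _]
    simp [add_comm]
  rw [lintegral_add_left measurable_const] at h1
  simp only [measure_univ, mul_one, lintegral_const] at h1
  exact (ENNReal.add_le_add_iff_left ENNReal.one_ne_top).1 h1

/-- The potential `e ^ (θ s) Z(β) ^ c`, with `c + 1 = e ^ θ`, is conserved on average as long as the
run lasts; what a run leaves behind when it stops is `e ^ (θ s)`. -/
theorem lintegral_expPotential {home : Fin n ≃ α} (hhome : IsLinExt home) (hn : 2 ≤ n) {t : ℕ}
    (hco : ∀ β : ℝ, 0 < β → β ≤ n → Coalesces home t β) (θ : ℝ) (s : ℕ) :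
    ∫⁻ ω, (if 0 < runBeta home t ω s then
        ENNReal.ofReal (totalWeight home (runBeta home t ω s) ^ (Real.exp θ - 1)) else 0)
          ∂(runMeasure α) =
      runMeasure α {ω | 0 < runBeta home t ω s ∧ runBeta home t ω (s + 1) ≤ 0} +
      ENNReal.ofReal (Real.exp θ) * ∫⁻ ω, (if 0 < runBeta home t ω (s + 1) then
        ENNReal.ofReal (totalWeight home (runBeta home t ω (s + 1)) ^ (Real.exp θ - 1)) else 0)
          ∂(runMeasure α) := by
  have hm := measurableSet_alive (α := α) home t s
  have hm' : MeasurableSet {ω : ℕ → SampleTape α |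
      0 < runBeta home t ω s ∧ runBeta home t ω (s + 1) ≤ 0} :=
    hm.inter (measurable_runBeta home t (s + 1) measurableSet_Iic)
  have hZ := (continuous_totalWeight home).measurable
  have hdie : runMeasure α {ω | 0 < runBeta home t ω s ∧ runBeta home t ω (s + 1) ≤ 0} =
      ∫⁻ ω, (if 0 < runBeta home t ω s then
        sampleMeasure α {x | nextBeta home t (runBeta home t ω s) x ≤ 0} else 0)
          ∂(runMeasure α) := by
    have hind : ∀ β, sampleMeasure α {x | nextBeta home t β x ≤ 0} =
        ∫⁻ x, (if nextBeta home t β x ≤ 0 then 1 else 0) ∂(sampleMeasure α) := by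
      intro β
      have h := lintegral_indicator_one (μ := sampleMeasure α)
        (measurable_nextBeta_right home t β (measurableSet_Iic (a := (0 : ℝ))))
      exact h.symm
    simp_rw [hind]
    rw [← lintegral_alive home t s (fun β x => if nextBeta home t β x ≤ 0 then 1 else 0)
      (Measurable.ite (measurable_nextBeta home t measurableSet_Iic) measurable_const
        measurable_const), ← lintegral_indicator_one hm']
    refine lintegral_congr fun ω => ?_
    by_cases h : 0 < runBeta home t ω s
    · simp only [Set.indicator, Set.mem_ofPred_eq, h, true_and, if_true, runBeta_succ_of_pos h,
        Pi.one_apply]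
    · simp [Set.indicator, h]
  rw [hdie, lintegral_alive_succ home t s (fun β => ENNReal.ofReal (totalWeight home β ^ _))
    (by fun_prop), ← lintegral_const_mul' _ _ ENNReal.ofReal_ne_top]
  rw [← lintegral_add_left']
  · refine lintegral_congr fun ω => ?_
    by_cases h : 0 < runBeta home t ω s
    · have hb := (runBeta_mem home t ω s).2
      have hv := one_le_totalWeight hhome h.le
      have hv0 : 0 < totalWeight home (runBeta home t ω s) := by linarith
      have he := Real.exp_pos θ
      simp only [h, if_true]
      rw [lintegral_nextBeta_rpow hhome hn h.le (hco _ h hb) (by linarith),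
        sampleMeasure_nextBeta_le_zero' hhome hn h.le (hco _ h hb), ← ENNReal.ofReal_mul he.le,
        ← ENNReal.ofReal_add (by positivity)]
      · congr 1
        rw [sub_add_cancel, Real.rpow_sub_one hv0.ne']
        field_simp
        ring
      · rw [sub_add_cancel]
        have := Real.one_le_rpow hv he.le
        have : 0 ≤ totalWeight home (runBeta home t ω s) ^ Real.exp θ - 1 := by linarith
        positivity
    · simp [h]
  · have hd : Measurable fun β => sampleMeasure α {x | nextBeta home t β x ≤ 0} :=
      measurable_measure_prodMk_left (measurable_nextBeta home t measurableSet_Iic)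
    exact (Measurable.ite hm (hd.comp (measurable_runBeta home t s))
      measurable_const).aemeasurable

/-- Summing the losses of the potential over all samples gives at most its initial value `L(P) ^ c`.
-/
theorem sum_stop_le {home : Fin n ≃ α} (hhome : IsLinExt home) (hn : 2 ≤ n) {t : ℕ}
    (hco : ∀ β : ℝ, 0 < β → β ≤ n → Coalesces home t β) (θ : ℝ) :
    ∑' s : ℕ, ENNReal.ofReal (Real.exp θ) ^ s *
        runMeasure α {ω | 0 < runBeta home t ω s ∧ runBeta home t ω (s + 1) ≤ 0} ≤
      ENNReal.ofReal (Real.exp (Real.log (numLinExt n α) * (Real.exp θ - 1))) := by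
  set U : ℕ → ENNReal := fun s => ∫⁻ ω, (if 0 < runBeta home t ω s then
        ENNReal.ofReal (totalWeight home (runBeta home t ω s) ^ (Real.exp θ - 1)) else 0)
          ∂(runMeasure α) with hU
  have hn0 : (0 : ℝ) < n := by exact_mod_cast (by omega : 0 < n)
  have h0 : U 0 = ENNReal.ofReal (Real.exp (Real.log (numLinExt n α) * (Real.exp θ - 1))) := by
    have h1 : (0 : ℝ) < numLinExt n α := by
      have := one_le_totalWeight hhome hn0.le
      rw [totalWeight_n] at this; linarith
    simp [hU, runBeta, hn0, totalWeight_n, Real.rpow_def_of_pos h1]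
  have h1 : ∀ s, U 0 = ∑ k ∈ Finset.range s, ENNReal.ofReal (Real.exp θ) ^ k *
      runMeasure α {ω | 0 < runBeta home t ω k ∧ runBeta home t ω (k + 1) ≤ 0} +
      ENNReal.ofReal (Real.exp θ) ^ s * U s := by
    intro s
    induction s with
    | zero => simp
    | succ s ih =>
      rw [ih, Finset.sum_range_succ, add_assoc, pow_succ, mul_assoc _ _ (U (s + 1)), ← mul_add,
        ← lintegral_expPotential hhome hn hco θ s]
  rw [← h0, ENNReal.tsum_eq_iSup_nat]
  exact iSup_le fun s => (h1 s) ▸ le_self_add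

/-- The count of a run has at most the exponential moments of a Poisson variable with mean
`ln L(P)`. -/
theorem lintegral_exp_runCount_le {home : Fin n ≃ α} (hhome : IsLinExt home) (hn : 2 ≤ n) {t : ℕ}
    (hco : ∀ β : ℝ, 0 < β → β ≤ n → Coalesces home t β) (θ : ℝ) :
    ∫⁻ ω, ENNReal.ofReal (Real.exp (θ * runCount home t ω)) ∂(runMeasure α) ≤
      ENNReal.ofReal (Real.exp (Real.log (numLinExt n α) * (Real.exp θ - 1))) := by
  refine le_trans ?_ (sum_stop_le hhome hn hco θ)
  have hm : ∀ s, MeasurableSet {ω : ℕ → SampleTape α |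
      0 < runBeta home t ω s ∧ runBeta home t ω (s + 1) ≤ 0} := fun s =>
    (measurableSet_alive home t s).inter (measurable_runBeta home t (s + 1) measurableSet_Iic)
  have h2 : ∀ s, ENNReal.ofReal (Real.exp θ) ^ s *
      runMeasure α {ω | 0 < runBeta home t ω s ∧ runBeta home t ω (s + 1) ≤ 0} =
      ∫⁻ ω, {ω | 0 < runBeta home t ω s ∧ runBeta home t ω (s + 1) ≤ 0}.indicator
        (fun _ => ENNReal.ofReal (Real.exp θ) ^ s) ω ∂(runMeasure α) :=
    fun s => (lintegral_indicator_const (hm s) _).symm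
  simp_rw [h2]
  rw [← lintegral_tsum fun s => (measurable_const.indicator (hm s)).aemeasurable]
  refine lintegral_mono_ae ?_
  filter_upwards [ae_dies hhome hn hco] with ω hω
  refine le_trans (le_of_eq ?_) (ENNReal.le_tsum (runCount home t ω))
  rw [Set.indicator_of_mem (show ω ∈ {ω' | 0 < runBeta home t ω' (runCount home t ω) ∧
    runBeta home t ω' (runCount home t ω + 1) ≤ 0} from runCount_spec hn hω), mul_comm,
    Real.exp_nat_mul, ENNReal.ofReal_pow (Real.exp_pos θ).le]

theorem measurable_runCost (home : Fin n ≃ α) (t : ℕ) (w : ℝ → StepTape → ENNReal)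
    (hw : Measurable (Function.uncurry w)) : Measurable (runCost home t w) := by
  unfold runCost
  refine Measurable.tsum fun s => Measurable.ite (measurableSet_alive home t s) ?_ measurable_const
  have h := (measurable_generateCost home t w hw).comp ((measurable_runBeta home t s).prodMk
    (measurable_fst.comp (measurable_pi_apply s : Measurable fun ω : ℕ → SampleTape α => ω s)))
  exact h

/-- The expected cost of a run: it makes at most `1 + ln L(P)` samples on average, and the cost of a
sample is independent of the parameter value at which it is drawn. -/
theorem lintegral_runCost_le {home : Fin n ≃ α} (hhome : IsLinExt home) (hn : 2 ≤ n) {t : ℕ}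
    (hco : ∀ β : ℝ, 0 < β → β ≤ n → Coalesces home t β) (w : ℝ → StepTape → ENNReal)
    (hw : Measurable (Function.uncurry w)) (c : ENNReal) (hc : ∀ β : ℝ, 0 < β → β ≤ n →
      ∫⁻ τ, generateCost home t (w β) β τ ∂blocksMeasure ≤ c) :
    ∫⁻ ω, runCost home t w ω ∂(runMeasure α) ≤
      c * ENNReal.ofReal (1 + Real.log (numLinExt n α)) := by
  have hF : Measurable (Function.uncurry fun (β : ℝ) (x : SampleTape α) =>
      generateCost home t (w β) β x.1) := by
    have h := (measurable_generateCost home t w hw).comp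
      ((measurable_fst : Measurable fun p : ℝ × SampleTape α => p.1).prodMk
        (measurable_fst.comp (measurable_snd : Measurable fun p : ℝ × SampleTape α => p.2)))
    exact h
  have hs : ∀ s, ∫⁻ ω, (if 0 < runBeta home t ω s then
      generateCost home t (w (runBeta home t ω s)) (runBeta home t ω s) (ω s).1 else 0)
        ∂(runMeasure α) ≤ c * runMeasure α {ω | 0 < runBeta home t ω s} := by
    intro s
    rw [lintegral_alive home t s (fun β x => generateCost home t (w β) β x.1) hF,
      ← lintegral_indicator_one (measurableSet_alive home t s),
      ← lintegral_const_mul _ (measurable_one.indicator (measurableSet_alive home t s))]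
    refine lintegral_mono fun ω => ?_
    by_cases h : 0 < runBeta home t ω s
    · have hcost := hc _ h (runBeta_mem home t ω s).2
      rw [if_pos h, Set.indicator_of_mem (show ω ∈ {ω | 0 < runBeta home t ω s} from h),
        Pi.one_apply, mul_one]
      refine le_trans (le_of_eq ?_) hcost
      have hfst := (measurePreserving_fst (μ := blocksMeasure)
        (ν := Measure.pi fun _ : α => (volume : Measure unitInterval)))
      have hmeas : Measurable fun τ : ℕ → ℕ → StepTape =>
          generateCost home t (w (runBeta home t ω s)) (runBeta home t ω s) τ := by
        have h := (measurable_generateCost home t w hw).comp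
          (measurable_const (a := runBeta home t ω s).prodMk measurable_id)
        exact h
      exact hfst.lintegral_comp hmeas
    · simp [h]
  unfold runCost
  rw [lintegral_tsum]
  · refine (ENNReal.tsum_le_tsum hs).trans ?_
    rw [ENNReal.tsum_mul_left]
    exact mul_le_mul_right (sum_alive_le hhome hn hco) c
  · intro s
    refine (Measurable.ite (measurableSet_alive home t s) ?_ measurable_const).aemeasurable
    have h := hF.comp ((measurable_runBeta home t s).prodMk
      (measurable_pi_apply s : Measurable fun ω : ℕ → SampleTape α => ω s))
    exact h

end Runs

/-! ### Concentration over independent runs -/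

section Phases

variable {n : ℕ} {α : Type*} [PartialOrder α] [Fintype α]

theorem phaseMeasure_eq : phaseMeasure α = Measure.infinitePi fun _ : ℕ => runMeasure α := rfl

/-- The counter `k` after `r` runs. -/
def phaseCount (home : Fin n ≃ α) (t r : ℕ) (ω : PhaseTape α) : ℕ :=
  ∑ i ∈ Finset.range r, runCount home t (ω i)

theorem measurable_phaseCount (home : Fin n ≃ α) (t r : ℕ) :
    Measurable (phaseCount (α := α) home t r) := by
  unfold phaseCount
  refine Finset.measurable_sum _ fun i _ => ?_
  have h := (measurable_runCount home t).comp
    (measurable_pi_apply i : Measurable fun ω : PhaseTape α => ω i)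
  exact h

theorem tpaLog_eq (home : Fin n ≃ α) (t r : ℕ) (ω : PhaseTape α) :
    tpaLog home t r ω = (phaseCount home t r ω : ℝ) / r := rfl

theorem tpaLog_nonneg (home : Fin n ≃ α) (t r : ℕ) (ω : PhaseTape α) : 0 ≤ tpaLog home t r ω := by
  rw [tpaLog_eq]; positivity

theorem measurable_tpaLog (home : Fin n ≃ α) (t r : ℕ) : Measurable (tpaLog (α := α) home t r) := by
  have h := (measurable_from_top (f := fun k : ℕ => (k : ℝ) / r)).comp
    (measurable_phaseCount home t r)
  exact h

theorem measurable_tpaLog_prod (home : Fin n ≃ α) (t : ℕ) :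
    Measurable fun p : ℕ × PhaseTape α => tpaLog home t p.1 p.2 :=
  measurable_from_prod_countable_right fun r => measurable_tpaLog home t r

/-- The runs are independent, so the counter has at most the exponential moments of a Poisson
variable with mean `r ln L(P)`. -/
theorem lintegral_exp_phaseCount_le {home : Fin n ≃ α} (hhome : IsLinExt home) (hn : 2 ≤ n) {t : ℕ}
    (hco : ∀ β : ℝ, 0 < β → β ≤ n → Coalesces home t β) (θ : ℝ) (r : ℕ) :
    ∫⁻ ω, ENNReal.ofReal (Real.exp (θ * phaseCount home t r ω)) ∂(phaseMeasure α) ≤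
      ENNReal.ofReal (Real.exp (r * (Real.log (numLinExt n α) * (Real.exp θ - 1)))) := by
  have hm : Measurable fun ω : ℕ → SampleTape α =>
      ENNReal.ofReal (Real.exp (θ * runCount home t ω)) := by
    have h := (measurable_from_top (f := fun k : ℕ => ENNReal.ofReal (Real.exp (θ * k)))).comp
      (measurable_runCount home t)
    exact h
  have h1 : ∀ ω : PhaseTape α, ENNReal.ofReal (Real.exp (θ * phaseCount home t r ω)) =
      ∏ i ∈ Finset.range r, ENNReal.ofReal (Real.exp (θ * runCount home t (ω i))) := by
    intro ω
    rw [← ENNReal.ofReal_prod_of_nonneg fun _ _ => (Real.exp_pos _).le, ← Real.exp_sum,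
      ← Finset.mul_sum, phaseCount, Nat.cast_sum]
  simp_rw [h1]
  rw [phaseMeasure_eq, lintegral_prod_range _ r _ hm, Real.exp_nat_mul,
    ENNReal.ofReal_pow (Real.exp_pos _).le]
  exact pow_le_pow_left' (lintegral_exp_runCount_le hhome hn hco θ) r

/-- The Chernoff bound for the counter; negative `θ` gives the lower tail. -/
theorem phaseMeasure_tail_le {home : Fin n ≃ α} (hhome : IsLinExt home) (hn : 2 ≤ n) {t : ℕ}
    (hco : ∀ β : ℝ, 0 < β → β ≤ n → Coalesces home t β) (θ k : ℝ) (r : ℕ) :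
    phaseMeasure α {ω | k ≤ θ * phaseCount home t r ω} ≤
      ENNReal.ofReal (Real.exp (r * (Real.log (numLinExt n α) * (Real.exp θ - 1)) - k)) := by
  have hm : Measurable fun ω : PhaseTape α =>
      ENNReal.ofReal (Real.exp (θ * phaseCount home t r ω)) := by
    have h := (measurable_from_top (f := fun k : ℕ => ENNReal.ofReal (Real.exp (θ * k)))).comp
      (measurable_phaseCount home t r)
    exact h
  have h1 := mul_meas_ge_le_lintegral (μ := phaseMeasure α) hm (ENNReal.ofReal (Real.exp k))
  have h2 : {ω | k ≤ θ * phaseCount home t r ω} ⊆ {ω : PhaseTape α | ENNReal.ofReal (Real.exp k) ≤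
      ENNReal.ofReal (Real.exp (θ * phaseCount home t r ω))} := fun ω hω =>
    ENNReal.ofReal_le_ofReal (Real.exp_le_exp.2 hω)
  have h3 := (mul_le_mul_right (measure_mono h2) (ENNReal.ofReal (Real.exp k))).trans
    (h1.trans (lintegral_exp_phaseCount_le hhome hn hco θ r))
  rw [Real.exp_sub, ENNReal.ofReal_div_of_pos (Real.exp_pos k),
    ENNReal.le_div_iff_mul_le (Or.inl (by simp [Real.exp_pos])) (Or.inl ENNReal.ofReal_ne_top),
    mul_comm]
  exact h3

theorem exp_neg_le_quadratic {u : ℝ} (hu : 0 ≤ u) : Real.exp (-u) ≤ 1 - u + u ^ 2 / 2 := by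
  rw [Real.exp_neg, inv_le_comm₀ (Real.exp_pos u) (by nlinarith [sq_nonneg (u - 1)])]
  refine le_trans ?_ (Real.quadratic_le_exp_of_nonneg hu)
  rw [inv_le_iff_one_le_mul₀ (by nlinarith [sq_nonneg (u - 1)])]
  nlinarith [sq_nonneg (u ^ 2)]

theorem exp_le_cubic {u : ℝ} (h0 : 0 ≤ u) (h1 : u ≤ 1) :
    Real.exp u ≤ 1 + u + u ^ 2 / 2 + 2 / 9 * u ^ 3 := by
  have h := Real.exp_bound (x := u) (by rwa [abs_of_nonneg h0]) (n := 3) (by norm_num)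
  rw [abs_of_nonneg h0] at h
  have h2 := (abs_le.1 h).2
  norm_num [Finset.sum_range_succ, Nat.factorial] at h2
  linarith

/-- In the first phase the estimate falls short of `A = ln L(P)` by `√A` with small probability
only. -/
theorem first_phase_tail {home : Fin n ≃ α} (hhome : IsLinExt home) (hn : 2 ≤ n) {t : ℕ}
    (hco : ∀ β : ℝ, 0 < β → β ≤ n → Coalesces home t β) {A : ℝ}
    (hA : A = Real.log (numLinExt n α)) (hA0 : 0 < A) {r : ℕ} (hr : 0 < r) :
    phaseMeasure α {ω | tpaLog home t r ω ≤ A - √A} ≤ ENNReal.ofReal (Real.exp (-(r / 2))) := by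
  set a := √A with ha
  have ha0 : 0 < a := Real.sqrt_pos.2 hA0
  have haA : a ^ 2 = A := Real.sq_sqrt hA0.le
  have hr' : (0 : ℝ) < r := by exact_mod_cast hr
  refine le_trans (measure_mono fun ω hω => ?_)
    ((phaseMeasure_tail_le hhome hn hco (-(1 / a)) (-(1 / a) * (r * (A - a))) r).trans
      (ENNReal.ofReal_le_ofReal (Real.exp_le_exp.2 ?_)))
  · have h : tpaLog home t r ω ≤ A - a := hω
    rw [tpaLog_eq, div_le_iff₀ hr'] at h
    have : 0 < 1 / a := by positivity
    change -(1 / a) * (r * (A - a)) ≤ -(1 / a) * phaseCount home t r ω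
    nlinarith
  · rw [← hA]
    have h1 := exp_neg_le_quadratic (u := 1 / a) (by positivity)
    have h2 : r * (A * (Real.exp (-(1 / a)) - 1)) ≤ r * (A * (-(1 / a) + (1 / a) ^ 2 / 2)) := by
      gcongr; linarith
    refine (sub_le_sub_right h2 _).trans (le_of_eq ?_)
    rw [← haA]
    field_simp
    ring

/-- An estimate of `A` that falls short of it by less than `√A` leads to sufficiently many runs. -/
theorem le_add_sqrt_add_two {A b : ℝ} (hA : 0 ≤ A) (hb : 0 ≤ b) (h : A - √A < b) :
    A ≤ b + √b + 2 := by
  obtain ⟨a, ha, rfl⟩ : ∃ a, 0 ≤ a ∧ A = a ^ 2 := ⟨√A, Real.sqrt_nonneg A, (Real.sq_sqrt hA).symm⟩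
  obtain ⟨s, hs, rfl⟩ : ∃ s, 0 ≤ s ∧ b = s ^ 2 := ⟨√b, Real.sqrt_nonneg b, (Real.sq_sqrt hb).symm⟩
  rw [Real.sqrt_sq ha] at h
  rw [Real.sqrt_sq hs]
  rcases le_or_gt a (s + 1) with h1 | h1
  · linarith
  · nlinarith

/-- Both tails of the estimate in the second phase: the Chernoff bound with `θ = ± x / A`. The lower
bound on `A` absorbs the cubic term of the exponential series into the one with `x³`. -/
theorem second_phase_tail {home : Fin n ≃ α} (hhome : IsLinExt home) (hn : 2 ≤ n) {t : ℕ}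
    (hco : ∀ β : ℝ, 0 < β → β ≤ n → Coalesces home t β) {A x : ℝ}
    (hA : A = Real.log (numLinExt n α)) (hA0 : 4 / 9 ≤ A) (hx : 0 < x) (hxA : x ≤ A) {r : ℕ}
    (hr : 0 < r) :
    phaseMeasure α {ω | x ≤ |tpaLog home t r ω - A|} ≤
      ENNReal.ofReal (2 * Real.exp (-(r * (x ^ 2 - x ^ 3) / (2 * A)))) := by
  have hA' : 0 < A := by linarith
  have hr' : (0 : ℝ) < r := by exact_mod_cast hr
  set θ := x / A with hθ
  have hθ0 : 0 < θ := by positivity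
  have hxθ : x = θ * A := by rw [hθ]; field_simp
  have hθ1 : θ ≤ 1 := (div_le_one hA').2 hxA
  have hexp : -(r * (x ^ 2 - x ^ 3) / (2 * A)) = r * (A * (-θ ^ 2 / 2 + A * θ ^ 3 / 2)) := by
    rw [hxθ]; field_simp; ring
  rw [hexp]
  have hup : phaseMeasure α {ω | θ * (r * (A + x)) ≤ θ * phaseCount home t r ω} ≤
      ENNReal.ofReal (Real.exp (r * (A * (-θ ^ 2 / 2 + A * θ ^ 3 / 2)))) := by
    refine (phaseMeasure_tail_le hhome hn hco θ (θ * (r * (A + x))) r).trans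
      (ENNReal.ofReal_le_ofReal (Real.exp_le_exp.2 ?_))
    rw [← hA]
    have h1 := exp_le_cubic hθ0.le hθ1
    have h2 : r * (A * (Real.exp θ - 1)) ≤ r * (A * (θ + θ ^ 2 / 2 + A * θ ^ 3 / 2)) := by
      have : 4 / 9 * θ ^ 3 ≤ A * θ ^ 3 := by gcongr
      gcongr; linarith
    refine (sub_le_sub_right h2 _).trans (le_of_eq ?_)
    rw [hxθ]; ring
  have hlow : phaseMeasure α {ω | -θ * (r * (A - x)) ≤ -θ * phaseCount home t r ω} ≤
      ENNReal.ofReal (Real.exp (r * (A * (-θ ^ 2 / 2 + A * θ ^ 3 / 2)))) := by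
    refine (phaseMeasure_tail_le hhome hn hco (-θ) (-θ * (r * (A - x))) r).trans
      (ENNReal.ofReal_le_ofReal (Real.exp_le_exp.2 ?_))
    rw [← hA]
    have h1 := exp_neg_le_quadratic hθ0.le
    have h2 : r * (A * (Real.exp (-θ) - 1)) ≤ r * (A * (-θ + θ ^ 2 / 2 + A * θ ^ 3 / 2)) := by
      have : 0 ≤ A * θ ^ 3 / 2 := by positivity
      gcongr; linarith
    refine (sub_le_sub_right h2 _).trans (le_of_eq ?_)
    rw [hxθ]; ring
  rw [two_mul, ENNReal.ofReal_add (Real.exp_pos _).le (Real.exp_pos _).le]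
  refine le_trans (measure_mono fun ω hω => ?_) ((measure_union_le _ _).trans (add_le_add hup hlow))
  rcases le_abs.1 (show x ≤ |tpaLog home t r ω - A| from hω) with h | h
  · refine Or.inl (mul_le_mul_of_nonneg_left ?_ hθ0.le)
    have : A + x ≤ tpaLog home t r ω := by linarith
    rw [tpaLog_eq, le_div_iff₀ hr'] at this
    linarith
  · have : tpaLog home t r ω ≤ A - x := by linarith
    rw [tpaLog_eq, div_le_iff₀ hr'] at this
    refine Or.inr ?_
    change -θ * (r * (A - x)) ≤ -θ * phaseCount home t r ω
    nlinarith

theorem lintegral_phaseCount_le {home : Fin n ≃ α} (hhome : IsLinExt home) (hn : 2 ≤ n) {t : ℕ}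
    (hco : ∀ β : ℝ, 0 < β → β ≤ n → Coalesces home t β) (r : ℕ) :
    ∫⁻ ω, (phaseCount home t r ω : ENNReal) ∂(phaseMeasure α) ≤
      r * ENNReal.ofReal (Real.log (numLinExt n α)) := by
  have hm : Measurable fun ω : ℕ → SampleTape α => (runCount home t ω : ENNReal) := by
    have h := (measurable_from_top (f := fun k : ℕ => (k : ENNReal))).comp
      (measurable_runCount home t)
    exact h
  simp only [phaseCount, Nat.cast_sum]
  rw [lintegral_finsetSum]
  · simp_rw [phaseMeasure_eq, lintegral_eval (runMeasure α) _ _ hm]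
    rw [Finset.sum_const, Finset.card_range, nsmul_eq_mul]
    exact mul_le_mul_right (lintegral_runCount_le hhome hn hco) _
  · intro i _
    have h := hm.comp (measurable_pi_apply i : Measurable fun ω : PhaseTape α => ω i)
    exact h

theorem lintegral_tpaLog_le {home : Fin n ≃ α} (hhome : IsLinExt home) (hn : 2 ≤ n) {t : ℕ}
    (hco : ∀ β : ℝ, 0 < β → β ≤ n → Coalesces home t β) (r : ℕ) :
    ∫⁻ ω, ENNReal.ofReal (tpaLog home t r ω) ∂(phaseMeasure α) ≤
      ENNReal.ofReal (Real.log (numLinExt n α)) := by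
  rcases Nat.eq_zero_or_pos r with rfl | hr
  · simp [tpaLog]
  have hr' : (0 : ℝ) < r := by exact_mod_cast hr
  have h1 : ∀ ω : PhaseTape α, ENNReal.ofReal (tpaLog home t r ω) =
      (r : ENNReal)⁻¹ * (phaseCount home t r ω : ENNReal) := by
    intro ω
    rw [tpaLog_eq, ENNReal.ofReal_div_of_pos hr', ENNReal.ofReal_natCast, ENNReal.ofReal_natCast,
      ENNReal.div_eq_inv_mul]
  simp_rw [h1]
  rw [lintegral_const_mul' _ _ (by simp [hr.ne'])]
  refine (mul_le_mul_right (lintegral_phaseCount_le hhome hn hco r) _).trans (le_of_eq ?_)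
  rw [← mul_assoc, ENNReal.inv_mul_cancel (by simp [hr.ne']) (by simp), one_mul]

/-- If there is only one linear extension, the counter vanishes almost surely, since its expectation
does. -/
theorem ae_tpaLog_eq_zero {home : Fin n ≃ α} (hhome : IsLinExt home) (hn : 2 ≤ n) {t : ℕ}
    (hco : ∀ β : ℝ, 0 < β → β ≤ n → Coalesces home t β)
    (hA : Real.log (numLinExt n α) = 0) (r : ℕ) :
    ∀ᵐ ω ∂(phaseMeasure α), tpaLog home t r ω = 0 := by
  have h := lintegral_tpaLog_le hhome hn hco r
  rw [hA, ENNReal.ofReal_zero, nonpos_iff_eq_zero, lintegral_eq_zero_iff] at h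
  · filter_upwards [h] with ω hω
    exact le_antisymm (ENNReal.ofReal_eq_zero.1 hω) (tpaLog_nonneg _ _ _ _)
  · exact (measurable_tpaLog home t r).ennreal_ofReal

/-- Jensen's inequality for the square root. -/
theorem lintegral_sqrt_tpaLog_le {home : Fin n ≃ α} (hhome : IsLinExt home) (hn : 2 ≤ n) {t : ℕ}
    (hco : ∀ β : ℝ, 0 < β → β ≤ n → Coalesces home t β) (r : ℕ) :
    ∫⁻ ω, ENNReal.ofReal √(tpaLog home t r ω) ∂(phaseMeasure α) ≤
      ENNReal.ofReal √(Real.log (numLinExt n α)) := by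
  rcases (Real.log_natCast_nonneg (numLinExt n α)).eq_or_lt with hA | hA
  · refine le_of_eq_of_le ?_ zero_le
    rw [lintegral_eq_zero_iff (measurable_tpaLog home t r).sqrt.ennreal_ofReal]
    filter_upwards [ae_tpaLog_eq_zero hhome hn hco hA.symm r] with ω hω
    simp [hω]
  · set a := √(Real.log (numLinExt n α)) with ha
    have ha0 : 0 < a := Real.sqrt_pos.2 hA
    have haA : a ^ 2 = Real.log (numLinExt n α) := Real.sq_sqrt hA.le
    -- the tangent to the square root at `ln L(P)`
    have h1 : ∀ ω : PhaseTape α, ENNReal.ofReal √(tpaLog home t r ω) ≤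
        ENNReal.ofReal (a / 2) + ENNReal.ofReal (1 / (2 * a)) *
          ENNReal.ofReal (tpaLog home t r ω) := by
      intro ω
      have h0 := tpaLog_nonneg home t r ω
      rw [← ENNReal.ofReal_mul (by positivity), ← ENNReal.ofReal_add (by positivity)
        (by positivity)]
      refine ENNReal.ofReal_le_ofReal ?_
      set s := √(tpaLog home t r ω)
      have hs : s ^ 2 = tpaLog home t r ω := Real.sq_sqrt h0
      rw [← hs]
      have : a / 2 + 1 / (2 * a) * s ^ 2 = s + (s - a) ^ 2 / (2 * a) := by field_simp; ring
      rw [this]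
      exact le_add_of_nonneg_right (by positivity)
    refine (lintegral_mono h1).trans ?_
    rw [lintegral_add_left measurable_const, lintegral_const_mul' _ _ ENNReal.ofReal_ne_top,
      lintegral_const, measure_univ, mul_one]
    refine (add_le_add_right (mul_le_mul_right (lintegral_tpaLog_le hhome hn hco r) _) _).trans
      (le_of_eq ?_)
    rw [← haA, ← ENNReal.ofReal_mul (by positivity), ← ENNReal.ofReal_add (by positivity)
      (by positivity)]
    congr 1
    field_simp
    ring

theorem measurable_tpaCost (home : Fin n ≃ α) (t r : ℕ) (w : ℝ → StepTape → ENNReal)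
    (hw : Measurable (Function.uncurry w)) : Measurable (tpaCost home t r w) := by
  unfold tpaCost
  refine Finset.measurable_sum _ fun i _ => ?_
  have h := (measurable_runCost home t w hw).comp
    (measurable_pi_apply i : Measurable fun ω : PhaseTape α => ω i)
  exact h

theorem lintegral_tpaCost (home : Fin n ≃ α) (t r : ℕ) (w : ℝ → StepTape → ENNReal)
    (hw : Measurable (Function.uncurry w)) :
    ∫⁻ ω, tpaCost home t r w ω ∂(phaseMeasure α) =
      r * ∫⁻ ω, runCost home t w ω ∂(runMeasure α) := by
  have hm := measurable_runCost home t w hw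
  unfold tpaCost
  rw [lintegral_finsetSum]
  · simp_rw [phaseMeasure_eq, lintegral_eval (runMeasure α) _ _ hm]
    rw [Finset.sum_const, Finset.card_range, nsmul_eq_mul]
  · intro i _
    have h := hm.comp (measurable_pi_apply i : Measurable fun ω : PhaseTape α => ω i)
    exact h

end Phases

/-! ### The two phases -/

section TwoPhases

variable {n : ℕ} {α : Type*} [PartialOrder α] [Fintype α]

/-- The number of runs in the second phase is `2 (a + √a + 2)` times this factor, rounded up. -/
def runFactor (ε δ : ℝ) : ℝ :=
  (Real.log (1 + ε) ^ 2 - Real.log (1 + ε) ^ 3)⁻¹ * Real.log (4 / δ)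

theorem log_one_add_pos {ε : ℝ} (h0 : 0 < ε) : 0 < Real.log (1 + ε) :=
  Real.log_pos (by linarith)

theorem log_one_add_le {ε : ℝ} (h0 : 0 < ε) (h1 : ε ≤ 1) : Real.log (1 + ε) ≤ Real.log 2 :=
  Real.log_le_log (by linarith) (by linarith)

theorem sq_sub_cube_pos {ε : ℝ} (h0 : 0 < ε) (h1 : ε ≤ 1) :
    0 < Real.log (1 + ε) ^ 2 - Real.log (1 + ε) ^ 3 := by
  have hx := log_one_add_pos h0
  have hx1 : Real.log (1 + ε) < 1 := (log_one_add_le h0 h1).trans_lt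
    (Real.log_two_lt_d9.trans (by norm_num))
  have : Real.log (1 + ε) ^ 2 - Real.log (1 + ε) ^ 3 =
      Real.log (1 + ε) ^ 2 * (1 - Real.log (1 + ε)) := by ring
  rw [this]
  exact mul_pos (by positivity) (by linarith)

theorem log_four_div_pos {δ : ℝ} (h0 : 0 < δ) (h1 : δ < 1) : 0 < Real.log (4 / δ) :=
  Real.log_pos (by rw [lt_div_iff₀ h0]; linarith)

theorem log_two_div_pos {δ : ℝ} (h0 : 0 < δ) (h1 : δ < 1) : 0 < Real.log (2 / δ) :=
  Real.log_pos (by rw [lt_div_iff₀ h0]; linarith)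

theorem runFactor_pos {ε δ : ℝ} (hε0 : 0 < ε) (hε1 : ε ≤ 1) (hδ0 : 0 < δ) (hδ1 : δ < 1) :
    0 < runFactor ε δ :=
  mul_pos (inv_pos.2 (sq_sub_cube_pos hε0 hε1)) (log_four_div_pos hδ0 hδ1)

theorem runs₂_eq (ε δ a : ℝ) : runs₂ ε δ a = ⌈2 * (a + √a + 2) * runFactor ε δ⌉₊ := by
  rw [runs₂, runFactor, mul_assoc]

theorem measurable_runs₂ (ε δ : ℝ) : Measurable (runs₂ ε δ) := by
  unfold runs₂
  exact Nat.measurable_ceil.comp (by fun_prop)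

/-- If the first phase has not fallen short of `A` by `√A`, then the second phase, with the
prescribed number of runs, fails with probability at most `δ / 2`. -/
theorem secondRuns_tail {home : Fin n ≃ α} (hhome : IsLinExt home) (hn : 2 ≤ n) {t : ℕ}
    (hco : ∀ β : ℝ, 0 < β → β ≤ n → Coalesces home t β) {ε δ A b : ℝ} (hε0 : 0 < ε) (hε1 : ε ≤ 1)
    (hδ0 : 0 < δ) (hδ1 : δ < 1) (hA : A = Real.log (numLinExt n α)) (hA0 : Real.log 2 ≤ A)
    (hb : 0 ≤ b) (hbA : A - √A < b) :
    phaseMeasure α {ω | Real.log (1 + ε) ≤ |tpaLog home t (runs₂ ε δ b) ω - A|} ≤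
      ENNReal.ofReal (δ / 2) := by
  have hx := log_one_add_pos hε0
  have hA1 : 0.6931 < A := lt_of_lt_of_le (lt_trans (by norm_num) Real.log_two_gt_d9) hA0
  have hA' : 0 < A := by linarith
  have hxx := sq_sub_cube_pos hε0 hε1
  have hD := runFactor_pos hε0 hε1 hδ0 hδ1
  have hle : 2 * A * runFactor ε δ ≤ runs₂ ε δ b := by
    rw [runs₂_eq]
    refine le_trans ?_ (Nat.le_ceil _)
    have := le_add_sqrt_add_two hA'.le hb hbA
    gcongr
  have hpos : 0 < runs₂ ε δ b := by
    have : (0 : ℝ) < runs₂ ε δ b := lt_of_lt_of_le (by positivity) hle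
    exact_mod_cast this
  refine (second_phase_tail hhome hn hco hA (by linarith) hx ((log_one_add_le hε0 hε1).trans hA0)
    hpos).trans (ENNReal.ofReal_le_ofReal ?_)
  have h1 : Real.log (4 / δ) ≤
      runs₂ ε δ b * (Real.log (1 + ε) ^ 2 - Real.log (1 + ε) ^ 3) / (2 * A) := by
    rw [le_div_iff₀ (by linarith)]
    refine le_trans (le_of_eq ?_) (mul_le_mul_of_nonneg_right hle hxx.le)
    rw [runFactor, mul_assoc (2 * A), mul_comm _⁻¹, inv_mul_cancel_right₀ hxx.ne', mul_comm]
  have h2 : Real.exp (-(runs₂ ε δ b * (Real.log (1 + ε) ^ 2 - Real.log (1 + ε) ^ 3) / (2 * A))) ≤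
      δ / 4 := by
    refine (Real.exp_le_exp.2 (neg_le_neg h1)).trans (le_of_eq ?_)
    rw [Real.exp_neg, Real.exp_log (by positivity), inv_div]
  linarith

/-- With the prescribed number of runs, the first phase falls short of `A` by `√A` with probability
at most `δ / 2`. -/
theorem runs₁_tail {home : Fin n ≃ α} (hhome : IsLinExt home) (hn : 2 ≤ n) {t : ℕ}
    (hco : ∀ β : ℝ, 0 < β → β ≤ n → Coalesces home t β) {δ A : ℝ}
    (hδ0 : 0 < δ) (hδ1 : δ < 1) (hA : A = Real.log (numLinExt n α)) (hA0 : 0 < A) :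
    phaseMeasure α {ω | tpaLog home t (runs₁ δ) ω ≤ A - √A} ≤ ENNReal.ofReal (δ / 2) := by
  have hlog := log_two_div_pos hδ0 hδ1
  have hle : 2 * Real.log (2 / δ) ≤ runs₁ δ := Nat.le_ceil _
  have hpos : 0 < runs₁ δ := Nat.ceil_pos.2 (by positivity)
  refine (first_phase_tail hhome hn hco hA hA0 hpos).trans (ENNReal.ofReal_le_ofReal ?_)
  refine (Real.exp_le_exp.2 (neg_le_neg (show Real.log (2 / δ) ≤ runs₁ δ / 2 by linarith))).trans
    (le_of_eq ?_)
  rw [Real.exp_neg, Real.exp_log (by positivity), inv_div]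

theorem measurable_secondRuns (home : Fin n ≃ α) (t : ℕ) (ε δ : ℝ) :
    Measurable fun ω : PhaseTape α => runs₂ ε δ (tpaLog home t (runs₁ δ) ω) := by
  have h := (measurable_runs₂ ε δ).comp (measurable_tpaLog (α := α) home t (runs₁ δ))
  exact h

theorem one_le_numLinExt {home : Fin n ≃ α} (hhome : IsLinExt home) : 1 ≤ numLinExt n α := by
  have h := one_le_totalWeight hhome (Nat.cast_nonneg n)
  rw [totalWeight_n] at h
  exact_mod_cast h

/-- The estimate is within a factor `1 + ε` of `L(P)` with probability at least `1 - δ`. -/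
theorem estimate_accurate {home : Fin n ≃ α} (hhome : IsLinExt home) (hn : 2 ≤ n) {t : ℕ}
    (hco : ∀ β : ℝ, 0 < β → β ≤ n → Coalesces home t β) {ε δ : ℝ} (hε0 : 0 < ε) (hε1 : ε ≤ 1)
    (hδ0 : 0 < δ) (hδ1 : δ < 1) :
    1 - δ ≤ (tapeMeasure α).real {ω | (1 + ε)⁻¹ ≤ estimate home t ε δ ω / numLinExt n α ∧
      estimate home t ε δ ω / numLinExt n α ≤ 1 + ε} := by
  set S := {ω : Tape α | (1 + ε)⁻¹ ≤ estimate home t ε δ ω / numLinExt n α ∧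
      estimate home t ε δ ω / numLinExt n α ≤ 1 + ε} with hS
  suffices h : tapeMeasure α Sᶜ ≤ ENNReal.ofReal δ by
    have h1 : (1 : ENNReal) ≤ tapeMeasure α S + ENNReal.ofReal δ := by
      rw [← measure_univ (μ := tapeMeasure α), ← Set.union_compl_self S]
      exact (measure_union_le _ _).trans (add_le_add_right h _)
    have h2 := ENNReal.toReal_mono (ENNReal.add_ne_top.2 ⟨measure_ne_top _ _,
      ENNReal.ofReal_ne_top⟩) h1
    rw [ENNReal.toReal_one, ENNReal.toReal_add (measure_ne_top _ _) ENNReal.ofReal_ne_top,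
      ENNReal.toReal_ofReal hδ0.le] at h2
    rw [Measure.real]
    linarith
  have hL1 := one_le_numLinExt hhome
  have hL0 : (0 : ℝ) < numLinExt n α := by exact_mod_cast hL1
  have hgood : ∀ ω : Tape α, |tpaLog home t (secondRuns home t ε δ ω) ω.2 -
      Real.log (numLinExt n α)| < Real.log (1 + ε) → ω ∈ S := by
    intro ω hω
    have hest : estimate home t ε δ ω / numLinExt n α =
        Real.exp (tpaLog home t (secondRuns home t ε δ ω) ω.2 - Real.log (numLinExt n α)) := by
      rw [Real.exp_sub, Real.exp_log hL0, estimate]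
    have hexp : Real.exp (Real.log (1 + ε)) = 1 + ε := Real.exp_log (by linarith)
    obtain ⟨h1, h2⟩ := abs_lt.1 hω
    change _ ∧ _
    rw [hest]
    constructor
    · rw [← hexp, ← Real.exp_neg]
      exact Real.exp_le_exp.2 h1.le
    · rw [← hexp]
      exact Real.exp_le_exp.2 h2.le
  rcases hL1.eq_or_lt with hL | hL
  · -- a single linear extension: both counters vanish almost surely
    have hA : Real.log (numLinExt n α) = 0 := by rw [← hL]; simp
    have h0 : ∀ᵐ ω ∂(tapeMeasure α), ∀ r, tpaLog home t r ω.2 = 0 := by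
      have h1 : ∀ᵐ ω ∂(phaseMeasure α), ∀ r, tpaLog home t r ω = 0 :=
        ae_all_iff.2 fun r => ae_tpaLog_eq_zero hhome hn hco hA r
      exact Measure.quasiMeasurePreserving_snd.ae h1
    have h2 : tapeMeasure α Sᶜ = 0 := by
      refine mem_ae_iff.1 ?_
      filter_upwards [h0] with ω hω
      refine hgood ω ?_
      rw [hω, hA, sub_zero, abs_zero]
      exact log_one_add_pos hε0
    rw [h2]
    exact zero_le
  · set A := Real.log (numLinExt n α) with hA
    have hA2 : Real.log 2 ≤ A := Real.log_le_log (by norm_num) (by exact_mod_cast hL)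
    have hA0 : 0 < A := (Real.log_pos (by norm_num)).trans_le hA2
    set R : PhaseTape α → ℕ := fun ω => runs₂ ε δ (tpaLog home t (runs₁ δ) ω) with hR
    set bad₁ : Set (PhaseTape α) := {ω | tpaLog home t (runs₁ δ) ω ≤ A - √A} with hbad₁
    set bad₂ : Set (Tape α) := {ω | ω.1 ∉ bad₁ ∧ Real.log (1 + ε) ≤ |tpaLog home t (R ω.1) ω.2 - A|}
      with hbad₂
    have hm₁ : MeasurableSet bad₁ := measurable_tpaLog home t _ measurableSet_Iic
    have hm₂ : MeasurableSet bad₂ := by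
      have h1 : Measurable fun ω : Tape α => tpaLog home t (R ω.1) ω.2 := by
        have h := (measurable_tpaLog_prod home t).comp
          (((measurable_secondRuns home t ε δ).comp
            (measurable_fst : Measurable fun ω : Tape α => ω.1)).prodMk
            (measurable_snd : Measurable fun ω : Tape α => ω.2))
        exact h
      exact (measurable_fst hm₁.compl).inter
        (measurableSet_le measurable_const (h1.sub measurable_const).abs)
    have hsub : Sᶜ ⊆ (bad₁ ×ˢ Set.univ) ∪ bad₂ := by
      intro ω hω
      by_cases h1 : ω.1 ∈ bad₁
      · exact Or.inl ⟨h1, trivial⟩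
      · refine Or.inr ⟨h1, not_lt.1 fun h2 => hω (hgood ω h2)⟩
    have hδ : ENNReal.ofReal δ = ENNReal.ofReal (δ / 2) + ENNReal.ofReal (δ / 2) := by
      rw [← ENNReal.ofReal_add (by linarith) (by linarith), add_halves]
    refine (measure_mono hsub).trans ((measure_union_le _ _).trans ?_)
    rw [hδ]
    refine add_le_add ?_ ?_
    · rw [tapeMeasure, Measure.prod_prod, measure_univ, mul_one]
      exact runs₁_tail hhome hn hco hδ0 hδ1 hA hA0
    · rw [tapeMeasure, Measure.prod_apply hm₂]
      have h1 : ∀ ω₁ : PhaseTape α, phaseMeasure α (Prod.mk ω₁ ⁻¹' bad₂) ≤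
          ENNReal.ofReal (δ / 2) := by
        intro ω₁
        by_cases h : ω₁ ∈ bad₁
        · have : Prod.mk ω₁ ⁻¹' bad₂ = ∅ := by
            ext ω₂; simp [hbad₂, h]
          rw [this, measure_empty]
          exact zero_le
        · have hlt : A - √A < tpaLog home t (runs₁ δ) ω₁ := not_le.1 h
          refine (measure_mono fun ω₂ hω₂ => ?_).trans
            (secondRuns_tail hhome hn hco hε0 hε1 hδ0 hδ1 hA hA2 (tpaLog_nonneg home t _ ω₁) hlt)
          exact hω₂.2
      refine (lintegral_mono h1).trans ?_
      rw [lintegral_const, measure_univ, mul_one]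

/-- The expected number of runs in the second phase is at most what it would be for the exact value
of `A`, up to rounding. -/
theorem lintegral_secondRuns_le {home : Fin n ≃ α} (hhome : IsLinExt home) (hn : 2 ≤ n) {t : ℕ}
    (hco : ∀ β : ℝ, 0 < β → β ≤ n → Coalesces home t β) {ε δ A : ℝ} (hε0 : 0 < ε) (hε1 : ε ≤ 1)
    (hδ0 : 0 < δ) (hδ1 : δ < 1) (hA : A = Real.log (numLinExt n α)) :
    ∫⁻ ω, (runs₂ ε δ (tpaLog home t (runs₁ δ) ω) : ENNReal) ∂(phaseMeasure α) ≤
      ENNReal.ofReal (2 * (A + √A + 2) * runFactor ε δ + 1) := by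
  have hD := runFactor_pos hε0 hε1 hδ0 hδ1
  have hA0 : 0 ≤ A := hA ▸ Real.log_natCast_nonneg _
  set D := runFactor ε δ
  have h1 : ∀ ω : PhaseTape α, (runs₂ ε δ (tpaLog home t (runs₁ δ) ω) : ENNReal) ≤
      ENNReal.ofReal (4 * D + 1) + ENNReal.ofReal (2 * D) *
        (ENNReal.ofReal (tpaLog home t (runs₁ δ) ω) +
          ENNReal.ofReal √(tpaLog home t (runs₁ δ) ω)) := by
    intro ω
    have h0 := tpaLog_nonneg home t (runs₁ δ) ω
    set b := tpaLog home t (runs₁ δ) ω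
    rw [← ENNReal.ofReal_add h0 (Real.sqrt_nonneg _), ← ENNReal.ofReal_mul (by positivity),
      ← ENNReal.ofReal_add (by positivity) (by positivity), ← ENNReal.ofReal_natCast, runs₂_eq]
    refine ENNReal.ofReal_le_ofReal ((Nat.ceil_lt_add_one (by positivity)).le.trans (le_of_eq ?_))
    ring
  refine (lintegral_mono h1).trans ?_
  rw [lintegral_add_left measurable_const, lintegral_const_mul' _ _ ENNReal.ofReal_ne_top,
    lintegral_add_left (measurable_tpaLog home t _).ennreal_ofReal, lintegral_const, measure_univ,
    mul_one]
  refine (add_le_add_right (mul_le_mul_right (add_le_add (lintegral_tpaLog_le hhome hn hco _)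
    (lintegral_sqrt_tpaLog_le hhome hn hco _)) _) _).trans (le_of_eq ?_)
  rw [← hA, ← ENNReal.ofReal_add hA0 (Real.sqrt_nonneg _), ← ENNReal.ofReal_mul (by positivity),
    ← ENNReal.ofReal_add (by positivity) (by positivity)]
  congr 1
  ring

/-- The expected cost of the algorithm is the expected cost of a sample times the expected number of
samples in a run times the expected number of runs. -/
theorem lintegral_totalCost_le {home : Fin n ≃ α} (hhome : IsLinExt home) (hn : 2 ≤ n) {t : ℕ}
    (hco : ∀ β : ℝ, 0 < β → β ≤ n → Coalesces home t β) {ε δ A : ℝ} (hε0 : 0 < ε) (hε1 : ε ≤ 1)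
    (hδ0 : 0 < δ) (hδ1 : δ < 1) (hA : A = Real.log (numLinExt n α)) (w : ℝ → StepTape → ENNReal)
    (hw : Measurable (Function.uncurry w)) {c : ℝ} (hc0 : 0 ≤ c) (hc : ∀ β : ℝ, 0 < β → β ≤ n →
      ∫⁻ τ, generateCost home t (w β) β τ ∂blocksMeasure ≤ ENNReal.ofReal c) :
    ∫⁻ ω, totalCost home t ε δ w ω ∂(tapeMeasure α) ≤ ENNReal.ofReal (c * ((1 + A) *
      ((2 * Real.log (2 / δ) + 1) + (2 * (A + √A + 2) * runFactor ε δ + 1)))) := by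
  have hD := runFactor_pos hε0 hε1 hδ0 hδ1
  have hA0 : 0 ≤ A := hA ▸ Real.log_natCast_nonneg _
  have hlog := log_two_div_pos hδ0 hδ1
  set E := ∫⁻ ω, runCost home t w ω ∂(runMeasure α) with hE
  have hEle : E ≤ ENNReal.ofReal (c * (1 + A)) := by
    rw [ENNReal.ofReal_mul hc0, hA]
    exact lintegral_runCost_le hhome hn hco w hw _ hc
  have hm₁ : Measurable fun ω : Tape α => tpaCost home t (runs₁ δ) w ω.1 := by
    have h := (measurable_tpaCost home t (runs₁ δ) w hw).comp
      (measurable_fst : Measurable fun ω : Tape α => ω.1)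
    exact h
  have hm₂ : Measurable fun ω : Tape α => tpaCost home t (secondRuns home t ε δ ω) w ω.2 := by
    have hm : Measurable fun p : ℕ × PhaseTape α => tpaCost home t p.1 w p.2 :=
      measurable_from_prod_countable_right fun r => measurable_tpaCost home t r w hw
    have h := hm.comp (((measurable_secondRuns home t ε δ).comp
            (measurable_fst : Measurable fun ω : Tape α => ω.1)).prodMk
            (measurable_snd : Measurable fun ω : Tape α => ω.2))
    exact h
  have h1 : ∫⁻ ω, tpaCost home t (runs₁ δ) w ω.1 ∂(tapeMeasure α) = runs₁ δ * E := by
    rw [← lintegral_tpaCost home t (runs₁ δ) w hw]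
    exact measurePreserving_fst.lintegral_comp (measurable_tpaCost home t (runs₁ δ) w hw)
  have h2 : ∫⁻ ω, tpaCost home t (secondRuns home t ε δ ω) w ω.2 ∂(tapeMeasure α) =
      (∫⁻ ω, (runs₂ ε δ (tpaLog home t (runs₁ δ) ω) : ENNReal) ∂(phaseMeasure α)) * E := by
    rw [tapeMeasure, lintegral_prod _ hm₂.aemeasurable]
    have h3 : ∀ ω₁ : PhaseTape α, ∫⁻ ω₂, tpaCost home t (secondRuns home t ε δ (ω₁, ω₂)) w ω₂
        ∂(phaseMeasure α) = (runs₂ ε δ (tpaLog home t (runs₁ δ) ω₁) : ENNReal) * E :=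
      fun ω₁ => lintegral_tpaCost home t (runs₂ ε δ (tpaLog home t (runs₁ δ) ω₁)) w hw
    simp_rw [h3]
    refine lintegral_mul_const _ ?_
    have h := (measurable_from_top (f := fun k : ℕ => (k : ENNReal))).comp
      (measurable_secondRuns (α := α) home t ε δ)
    exact h
  have hr₁ : (runs₁ δ : ENNReal) ≤ ENNReal.ofReal (2 * Real.log (2 / δ) + 1) := by
    rw [← ENNReal.ofReal_natCast]
    exact ENNReal.ofReal_le_ofReal (Nat.ceil_lt_add_one (by positivity)).le
  unfold totalCost
  rw [lintegral_add_left hm₁, h1, h2, ← add_mul]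
  refine (mul_le_mul' (add_le_add hr₁
    (lintegral_secondRuns_le hhome hn hco hε0 hε1 hδ0 hδ1 hA)) hEle).trans (le_of_eq ?_)
  rw [← ENNReal.ofReal_add (by positivity) (by positivity), ← ENNReal.ofReal_mul (by positivity)]
  congr 1
  ring

end TwoPhases

/-! ### The number of steps and numerical estimates -/

section Numerics

/-- The number of steps in the first block of the coupling from the past: the bounding chain has
relaxation time at most `0.82 (n - 1) (n² - n + 1)`, and `ln n + 2` relaxation times leave a
symbol `θ` with probability at most `e⁻²`. -/
def initialSteps (n : ℕ) : ℕ :=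
  max 1 ⌈0.82 * ((n - 1 : ℕ) : ℝ) * ((n : ℝ) ^ 2 - n + 1) * (Real.log n + 2)⌉₊

theorem exp_neg_two_le : Real.exp (-2) ≤ 0.1354 := by
  have h1 : (2.7182 : ℝ) ≤ Real.exp 1 := by linarith [Real.exp_one_gt_d9]
  have h2 : Real.exp 2 = Real.exp 1 ^ 2 := by rw [← Real.exp_nat_mul]; norm_num
  rw [Real.exp_neg, h2]
  have h3 : (2.7182 : ℝ) ^ 2 ≤ Real.exp 1 ^ 2 := by gcongr
  refine (inv_anti₀ (by norm_num) h3).trans (by norm_num)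

/-- Block `j` lasts at least `(ln n + 2) 2 ^ j` relaxation times; `ln n` of them compensate the
factor `n - 1`, and at least `2 · 2 ^ j` are left. -/
theorem eigenVal_pow_initialSteps_le (n : ℕ) (hn : 2 ≤ n) (j : ℕ) :
    ((n - 1 : ℕ) : ℝ) * eigenVal n ^ blockLength (initialSteps n) j ≤ 0.1354 ^ 2 ^ j := by
  have hn' : (2 : ℝ) ≤ n := by exact_mod_cast hn
  have hm : (1 : ℝ) ≤ (n - 1 : ℕ) := by exact_mod_cast (by omega : 1 ≤ n - 1)
  have hl : 0 ≤ Real.log n := Real.log_natCast_nonneg n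
  have h2j : (1 : ℝ) ≤ 2 ^ j := one_le_pow₀ (by norm_num)
  set T := initialSteps n with hT
  set l := Real.log n with hldef
  set gap := 1 - eigenVal n with hgap
  have hgap' : gap = (1 - Real.cos (Real.pi / (2 * n - 1))) / (n - 1 : ℕ) := by
    rw [hgap, eigenVal]; ring
  have hTle : 0.82 * ((n - 1 : ℕ) : ℝ) * ((n : ℝ) ^ 2 - n + 1) * (l + 2) ≤ T := by
    refine (Nat.le_ceil _).trans ?_
    rw [hT, initialSteps]
    exact_mod_cast le_max_right _ _
  have hcos : 0 ≤ 1 - Real.cos (Real.pi / (2 * n - 1)) :=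
    sub_nonneg.2 (Real.cos_le_one _)
  have hgapT : l + 2 ≤ gap * T := by
    have h1 := one_le_gap n hn
    have hgap0 : 0 ≤ gap := by rw [hgap']; positivity
    refine le_trans ?_ (mul_le_mul_of_nonneg_left hTle hgap0)
    have h2 : gap * (0.82 * ((n - 1 : ℕ) : ℝ) * ((n : ℝ) ^ 2 - n + 1) * (l + 2)) =
        (0.82 * ((n : ℝ) ^ 2 - n + 1) * (1 - Real.cos (Real.pi / (2 * n - 1)))) * (l + 2) := by
      rw [hgap']; field_simp
    rw [h2]
    nlinarith
  have hpow : eigenVal n ^ blockLength T j ≤ Real.exp (-((l + 2) * 2 ^ j)) := by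
    have h1 : eigenVal n ≤ Real.exp (-gap) := by
      have := Real.add_one_le_exp (-gap)
      have h3 : -gap + 1 = eigenVal n := by rw [hgap]; ring
      linarith
    refine (pow_le_pow_left₀ (eigenVal_nonneg n hn) h1 _).trans ?_
    rw [← Real.exp_nat_mul]
    refine Real.exp_le_exp.2 ?_
    rw [blockLength]
    push_cast
    nlinarith [mul_le_mul_of_nonneg_right hgapT (by positivity : (0 : ℝ) ≤ 2 ^ j)]
  have hexp : ((n - 1 : ℕ) : ℝ) ≤ Real.exp l := by
    rw [hldef, Real.exp_log (by linarith), Nat.cast_sub (by omega)]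
    simp
  calc ((n - 1 : ℕ) : ℝ) * eigenVal n ^ blockLength T j
      ≤ Real.exp l * Real.exp (-((l + 2) * 2 ^ j)) :=
        mul_le_mul hexp hpow (pow_nonneg (eigenVal_nonneg n hn) _) (Real.exp_pos _).le
    _ ≤ Real.exp (-2) ^ 2 ^ j := by
        rw [← Real.exp_add, ← Real.exp_nat_mul]
        refine Real.exp_le_exp.2 ?_
        push_cast
        nlinarith
    _ ≤ 0.1354 ^ 2 ^ j := pow_le_pow_left₀ (Real.exp_pos _).le exp_neg_two_le _

/-- The expected number of steps in a sample, in units of the length of the first block: apart from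
the first term the series is dominated by a geometric one, as `2 j + 1 ≤ 2 ^ (j + 1) - 1`. -/
theorem tsum_block_le :
    ∑' j : ℕ, 2 ^ j * ENNReal.ofReal 0.1354 ^ (2 ^ j - 1) ≤ ENNReal.ofReal 1.2815 := by
  set q := ENNReal.ofReal 0.1354 with hq
  have hq1 : q ≤ 1 := by rw [hq, ← ENNReal.ofReal_one]; exact ENNReal.ofReal_le_ofReal (by norm_num)
  have h1 : ∀ j : ℕ, (2 : ENNReal) ^ (j + 1) * q ^ (2 ^ (j + 1) - 1) ≤
      2 * q * (2 * q ^ 2) ^ j := by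
    intro j
    have h2 : 2 * j + 1 ≤ 2 ^ (j + 1) - 1 := by
      have : j + 1 ≤ 2 ^ j := Nat.lt_two_pow_self
      rw [pow_succ]; omega
    calc (2 : ENNReal) ^ (j + 1) * q ^ (2 ^ (j + 1) - 1) ≤ 2 ^ (j + 1) * q ^ (2 * j + 1) :=
          mul_le_mul_right (pow_le_pow_right_of_le_one' hq1 h2) _
      _ = 2 * q * (2 * q ^ 2) ^ j := by ring
  rw [tsum_eq_zero_add' ENNReal.summable]
  refine (add_le_add_right (ENNReal.tsum_le_tsum h1) _).trans ?_
  rw [ENNReal.tsum_mul_left, ENNReal.tsum_geometric]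
  have h3 : (2 : ENNReal) * q = ENNReal.ofReal 0.2708 := by
    rw [hq, ← ENNReal.ofReal_ofNat 2, ← ENNReal.ofReal_mul (by norm_num)]; norm_num
  have h4 : (1 : ENNReal) - 2 * q ^ 2 = ENNReal.ofReal (1 - 2 * 0.1354 ^ 2) := by
    rw [hq, ← ENNReal.ofReal_pow (by norm_num), ← ENNReal.ofReal_ofNat 2,
      ← ENNReal.ofReal_mul (by norm_num), ← ENNReal.ofReal_one,
      ← ENNReal.ofReal_sub _ (by norm_num)]
  rw [h3, h4, ← ENNReal.ofReal_inv_of_pos (by norm_num), ← ENNReal.ofReal_mul (by norm_num)]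
  simp only [pow_zero, Nat.sub_self, mul_one]
  rw [← ENNReal.ofReal_one, ← ENNReal.ofReal_add (by norm_num) (by norm_num)]
  exact ENNReal.ofReal_le_ofReal (by norm_num)

/-- As a convex function of `1 / x`, the logarithm lies above its tangent at `x = m`. -/
theorem log_tangent_le {m x : ℝ} (hm : 0 < m) (hx : 0 < x) :
    Real.log m + 1 - m / x ≤ Real.log x := by
  have h := Real.one_sub_inv_le_log_of_pos (div_pos hx hm)
  rw [Real.log_div hx.ne' hm.ne', inv_div] at h
  linarith

/-- The tangents at `4` and `8` suffice for `n < 10`, the tangent at `16` for larger `n`. -/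
theorem initialSteps_le_of_three_le (n : ℕ) (hn : 3 ≤ n) :
    (initialSteps n : ℝ) ≤ 1.298 * ((n : ℝ) ^ 3 * Real.log n) := by
  have hn' : (3 : ℝ) ≤ n := by exact_mod_cast hn
  have hl0 : 0 ≤ Real.log n := Real.log_natCast_nonneg n
  have hcast : ((n - 1 : ℕ) : ℝ) = n - 1 := by rw [Nat.cast_sub (by omega)]; simp
  have hp : 0 < (n : ℝ) ^ 2 - n + 1 := by nlinarith
  have hn1 : (0 : ℝ) < n - 1 := by linarith
  have hceil : (initialSteps n : ℝ) ≤
      0.82 * ((n : ℝ) - 1) * ((n : ℝ) ^ 2 - n + 1) * (Real.log n + 2) + 1 := by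
    rw [initialSteps, hcast, max_eq_right]
    · exact (Nat.ceil_lt_add_one (by positivity)).le
    · exact Nat.ceil_pos.2 (by positivity)
  refine hceil.trans ?_
  have h2 := Real.log_two_gt_d9
  rcases le_or_gt 10 n with h10 | h10
  · have hn10 : (10 : ℝ) ≤ n := by exact_mod_cast h10
    have ht := log_tangent_le (m := 16) (x := n) (by norm_num) (by linarith)
    have h16 : Real.log 16 = 4 * Real.log 2 := by
      rw [show (16 : ℝ) = 2 ^ 4 by norm_num, Real.log_pow]; norm_num
    have hl : 3.7725 - 16 / n ≤ Real.log n := by linarith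
    have hX : 0 ≤ 1.298 * (n : ℝ) ^ 3 - 0.82 * (n - 1) * (n ^ 2 - n + 1) := by
      nlinarith [sq_nonneg (n : ℝ)]
    have hmul := mul_le_mul_of_nonneg_right hl hX
    have hpoly : 1.64 * ((n : ℝ) - 1) * (n ^ 2 - n + 1) + 1 ≤
        (3.7725 - 16 / n) * (1.298 * (n : ℝ) ^ 3 - 0.82 * (n - 1) * (n ^ 2 - n + 1)) := by
      have hn0 : (0 : ℝ) < n := by linarith
      rw [show (3.7725 - 16 / (n : ℝ)) = (3.7725 * n - 16) / n by field_simp, div_mul_eq_mul_div,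
        le_div_iff₀ hn0]
      obtain ⟨y, hy, hy0⟩ : ∃ y : ℝ, (n : ℝ) = 10 + y ∧ 0 ≤ y := ⟨n - 10, by ring, by linarith⟩
      rw [hy]
      have := pow_nonneg hy0 2
      have := pow_nonneg hy0 3
      have := pow_nonneg hy0 4
      nlinarith
    linarith
  · have h4 : Real.log 4 = 2 * Real.log 2 := by
      rw [show (4 : ℝ) = 2 ^ 2 by norm_num, Real.log_pow]; norm_num
    have h8 : Real.log 8 = 3 * Real.log 2 := by
      rw [show (8 : ℝ) = 2 ^ 3 by norm_num, Real.log_pow]; norm_num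
    have ht4 := log_tangent_le (m := 4) (x := n) (by norm_num) (by linarith)
    have ht8 := log_tangent_le (m := 8) (x := n) (by norm_num) (by linarith)
    rw [h4] at ht4
    rw [h8] at ht8
    clear hceil hcast hp hn1 hl0 hn'
    interval_cases n <;> norm_num at ht4 ht8 ⊢ <;> linarith

theorem initialSteps_two : (initialSteps 2 : ℝ) = 7 := by
  have h1 := Real.log_two_gt_d9
  have h2 := Real.log_two_lt_d9
  have : ⌈0.82 * ((2 - 1 : ℕ) : ℝ) * (((2 : ℕ) : ℝ) ^ 2 - (2 : ℕ) + 1) *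
      (Real.log (2 : ℕ) + 2)⌉₊ = 7 := by
    rw [Nat.ceil_eq_iff (by norm_num)]
    norm_num
    constructor <;> linarith
  rw [initialSteps, this]
  norm_num

/-- The expected number of steps in a sample. -/
theorem initialSteps_mul_le (n : ℕ) (hn : 2 ≤ n) :
    1.2815 * (initialSteps n : ℝ) ≤ 1.67 * ((n : ℝ) ^ 3 * Real.log n) := by
  rcases hn.eq_or_lt with rfl | hn3
  · have := Real.log_two_gt_d9
    rw [initialSteps_two]
    norm_num
    linarith
  · have h1 := initialSteps_le_of_three_le n hn3
    have h2 : 0 ≤ (n : ℝ) ^ 3 * Real.log n := mul_nonneg (by positivity) (Real.log_natCast_nonneg n)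
    linarith

theorem le_two_pow_of_ceil_logb {n K : ℕ} (hn : 2 ≤ n) (hK : ⌈Real.logb 2 n⌉ = (K : ℤ)) :
    n ≤ 2 ^ K ∧ 1 ≤ K := by
  have h0 : (0 : ℝ) < n := by exact_mod_cast (by omega : 0 < n)
  have h1 : Real.logb 2 n ≤ K := by exact_mod_cast Int.ceil_le.1 hK.le
  constructor
  · have h2 := (Real.logb_le_iff_le_rpow (by norm_num) h0).1 h1
    rw [Real.rpow_natCast] at h2
    exact_mod_cast h2
  · by_contra hlt
    have hK0 : K = 0 := by omega
    have h2 : (0 : ℝ) < Real.logb 2 n := Real.logb_pos (by norm_num) (by exact_mod_cast hn)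
    rw [hK0] at h1
    simp only [Nat.cast_zero] at h1
    linarith

/-- The expected number of random bits in a sample. For `n ≥ 3` a step needs at most `K + 5 - 4 / 2
^ K ≤ 1.25 (K + 3)` bits on average; for `n = 2`, where the bound on the number of steps is weaker,
it needs at most `K + 3`. -/
theorem initialSteps_mul_bits_le {n K : ℕ} (hn : 2 ≤ n) (hnK : n ≤ 2 ^ K) (hK : 1 ≤ K) :
    1.2815 * (initialSteps n : ℝ) * (K + ((n : ℝ) - 2) * (2 * 2⁻¹ ^ K) + 3) ≤
      2.08 * ((n : ℝ) ^ 3 * Real.log n) * (K + 3) := by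
  have hK' : (1 : ℝ) ≤ K := by exact_mod_cast hK
  rcases hn.eq_or_lt with rfl | hn3
  · have := Real.log_two_gt_d9
    rw [initialSteps_two]
    norm_num
    nlinarith
  · have h1 := initialSteps_le_of_three_le n hn3
    have h2 : 0 ≤ (n : ℝ) ^ 3 * Real.log n := mul_nonneg (by positivity) (Real.log_natCast_nonneg n)
    have hp : (0 : ℝ) < 2 ^ K := by positivity
    have hnK' : (n : ℝ) ≤ 2 ^ K := by exact_mod_cast hnK
    have hinv : (2 : ℝ)⁻¹ ^ K * 2 ^ K = 1 := by rw [← mul_pow]; norm_num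
    have hstep : (K : ℝ) + ((n : ℝ) - 2) * (2 * 2⁻¹ ^ K) + 3 ≤ K + 5 - 4 * 2⁻¹ ^ K := by
      have : ((n : ℝ) - 2) * (2 * 2⁻¹ ^ K) ≤ (2 ^ K - 2) * (2 * 2⁻¹ ^ K) := by gcongr
      nlinarith
    have hquart : (K : ℝ) + 5 - 4 * 2⁻¹ ^ K ≤ 1.25 * (K + 3) := by
      rcases le_or_gt 5 K with h5 | h5
      · have : (5 : ℝ) ≤ K := by exact_mod_cast h5
        have : (0 : ℝ) < 2⁻¹ ^ K := by positivity
        linarith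
      · clear hnK hnK' hinv hstep hp
        interval_cases K <;> norm_num
    calc 1.2815 * (initialSteps n : ℝ) * (K + ((n : ℝ) - 2) * (2 * 2⁻¹ ^ K) + 3)
        ≤ 1.2815 * (1.298 * ((n : ℝ) ^ 3 * Real.log n)) * (1.25 * (K + 3)) := by
          have := hstep.trans hquart
          have h3 : (0 : ℝ) ≤ (n : ℝ) - 2 := by
            have : (2 : ℝ) ≤ n := by exact_mod_cast hn
            linarith
          gcongr
      _ ≤ 2.08 * ((n : ℝ) ^ 3 * Real.log n) * (K + 3) := by
        nlinarith [mul_nonneg h2 (by linarith : (0 : ℝ) ≤ (K : ℝ) + 3)]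

theorem nine_le_runFactor {ε δ : ℝ} (hε0 : 0 < ε) (hε1 : ε ≤ 1) (hδ0 : 0 < δ) (hδ1 : δ < 1) :
    9 ≤ runFactor ε δ := by
  have hxx := sq_sub_cube_pos hε0 hε1
  have hx := log_one_add_pos hε0
  set x := Real.log (1 + ε)
  have h4 : 1.386 ≤ Real.log (4 / δ) := by
    have h1 : Real.log 4 ≤ Real.log (4 / δ) :=
      Real.log_le_log (by norm_num) (by rw [le_div_iff₀ hδ0]; linarith)
    have h2 : Real.log 4 = 2 * Real.log 2 := by
      rw [show (4 : ℝ) = 2 ^ 2 by norm_num, Real.log_pow]; norm_num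
    linarith [Real.log_two_gt_d9]
  -- `x² - x³` is largest at `x = 2 / 3`
  have h27 : x ^ 2 - x ^ 3 ≤ 4 / 27 := by
    have : 4 / 27 - (x ^ 2 - x ^ 3) = (x - 2 / 3) ^ 2 * (x + 1 / 3) := by ring
    nlinarith [mul_nonneg (sq_nonneg (x - 2 / 3)) (by linarith : 0 ≤ x + 1 / 3)]
  rw [runFactor, ← div_eq_inv_mul, le_div_iff₀ hxx]
  linarith

/-- The slack between the constants `2.08 · 2` and `4.3` absorbs the rounding of the numbers of
runs, as `runFactor` and `ln (2 / δ)` are bounded below. -/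
theorem runs_le_bitBound {ε δ A : ℝ} (hε0 : 0 < ε) (hε1 : ε ≤ 1) (hδ0 : 0 < δ) (hδ1 : δ < 1)
    (hA : 0 ≤ A) :
    2.08 * ((2 * Real.log (2 / δ) + 1) + (2 * (A + √A + 2) * runFactor ε δ + 1)) ≤
      4.3 * (2 * Real.log (2 / δ) + (A + 3 * √(2 * A) + 2) * runFactor ε δ) := by
  have hD := nine_le_runFactor hε0 hε1 hδ0 hδ1
  have h2 : 0.693 ≤ Real.log (2 / δ) := by
    have h1 : Real.log 2 ≤ Real.log (2 / δ) :=
      Real.log_le_log (by norm_num) (by rw [le_div_iff₀ hδ0]; linarith)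
    linarith [Real.log_two_gt_d9]
  have hs : √A ≤ √(2 * A) := Real.sqrt_le_sqrt (by linarith)
  have hs0 := Real.sqrt_nonneg A
  nlinarith [mul_nonneg hA (by linarith : 0 ≤ runFactor ε δ),
    mul_nonneg (by linarith : 0 ≤ √(2 * A) - √A) (by linarith : 0 ≤ runFactor ε δ),
    mul_nonneg hs0 (by linarith : 0 ≤ runFactor ε δ)]

theorem runFactor_le {ε δ : ℝ} (hε0 : 0 < ε) (hε1 : ε ≤ 1) (hδ0 : 0 < δ) (hδ1 : δ ≤ 1 / 2) :
    runFactor ε δ ≤ 40 * ((ε ^ 2)⁻¹ * Real.log δ⁻¹) := by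
  have hxx := sq_sub_cube_pos hε0 hε1
  have hx2 := log_one_add_le hε0 hε1
  have h2 := Real.log_two_lt_d9
  have hl : Real.log 2 ≤ Real.log δ⁻¹ := by
    refine Real.log_le_log (by norm_num) ?_
    rw [le_inv_comm₀ (by norm_num) hδ0]; linarith
  have hl0 : 0 ≤ Real.log δ⁻¹ := by linarith [Real.log_two_gt_d9]
  have hxε : ε / 2 ≤ Real.log (1 + ε) := by
    refine le_trans ?_ (Real.one_sub_inv_le_log_of_pos (by linarith : 0 < 1 + ε))
    rw [div_le_iff₀ (by norm_num), show (1 - (1 + ε)⁻¹) * 2 = 2 * ε / (1 + ε) by field_simp; ring,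
      le_div_iff₀ (by linarith)]
    nlinarith
  have h4 : Real.log (4 / δ) ≤ 3 * Real.log δ⁻¹ := by
    rw [div_eq_mul_inv, Real.log_mul (by norm_num) (inv_pos.2 hδ0).ne',
      show (4 : ℝ) = 2 ^ 2 by norm_num, Real.log_pow]
    push_cast
    linarith
  have hlow : 0.3 / 4 * ε ^ 2 ≤ Real.log (1 + ε) ^ 2 - Real.log (1 + ε) ^ 3 := by
    have h5 : Real.log (1 + ε) ^ 2 - Real.log (1 + ε) ^ 3 =
      Real.log (1 + ε) ^ 2 * (1 - Real.log (1 + ε)) := by ring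
    have h6 : (ε / 2) ^ 2 ≤ Real.log (1 + ε) ^ 2 := by gcongr
    rw [h5]
    nlinarith [mul_le_mul h6 (by linarith : (0.3 : ℝ) ≤ 1 - Real.log (1 + ε)) (by norm_num)
      (sq_nonneg (Real.log (1 + ε)))]
  rw [runFactor, ← div_eq_inv_mul, div_le_iff₀ hxx]
  have h7 : 40 * ((ε ^ 2)⁻¹ * Real.log δ⁻¹) * (0.3 / 4 * ε ^ 2) = 3 * Real.log δ⁻¹ := by
    have hε : (ε ^ 2)⁻¹ * ε ^ 2 = 1 := inv_mul_cancel₀ (by positivity)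
    linear_combination 3 * Real.log δ⁻¹ * hε
  have h8 : 0 ≤ 40 * ((ε ^ 2)⁻¹ * Real.log δ⁻¹) := by positivity
  linarith [mul_le_mul_of_nonneg_left hlow h8]

/-- For `L(P) ≥ 2` and `δ ≤ 1 / 2` the lower-order terms are bounded by multiples of the leading
one. -/
theorem runs_le_log_sq {ε δ A : ℝ} (hε0 : 0 < ε) (hε1 : ε ≤ 1) (hδ0 : 0 < δ) (hδ1 : δ ≤ 1 / 2)
    (hA : Real.log 2 ≤ A) :
    (1 + A) * ((2 * Real.log (2 / δ) + 1) + (2 * (A + √A + 2) * runFactor ε δ + 1)) ≤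
      2000 * (A ^ 2 * ((ε ^ 2)⁻¹ * Real.log δ⁻¹)) := by
  have hD := runFactor_le hε0 hε1 hδ0 hδ1
  have hD0 := runFactor_pos hε0 hε1 hδ0 (by linarith : δ < 1)
  have hl2 := Real.log_two_gt_d9
  have hl : Real.log 2 ≤ Real.log δ⁻¹ := by
    refine Real.log_le_log (by norm_num) ?_
    rw [le_inv_comm₀ (by norm_num) hδ0]; linarith
  have hlog : Real.log (2 / δ) = Real.log 2 + Real.log δ⁻¹ := by
    rw [div_eq_mul_inv, Real.log_mul (by norm_num) (inv_pos.2 hδ0).ne']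
  have hA0 : 0 ≤ A := by linarith
  set Y := (ε ^ 2)⁻¹ * Real.log δ⁻¹ with hY
  have hYl : Real.log δ⁻¹ ≤ Y := by
    have : 1 ≤ (ε ^ 2)⁻¹ := (one_le_inv₀ (by positivity)).2 (by nlinarith)
    rw [hY]
    nlinarith
  have hY0 : 0.69 ≤ Y := by linarith
  have hsq : √A ≤ (1 + A) / 2 := by
    have h0 := Real.sq_sqrt (by linarith : 0 ≤ A)
    nlinarith [sq_nonneg (√A - 1)]
  have h1 : 1 + A ≤ 2.5 * A := by linarith
  have h2 : A + √A + 2 ≤ 5.2 * A := by linarith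
  have h3 : 2 * (A + √A + 2) * runFactor ε δ ≤ 2 * (5.2 * A) * (40 * Y) := by gcongr
  have h4 : 2 * Real.log (2 / δ) + 1 + 1 ≤ 15 * (A * Y) := by
    have : 0.69 * Y ≤ A * Y := by gcongr; linarith
    rw [hlog]
    linarith
  have hAY : 0 ≤ A * Y := mul_nonneg hA0 (by linarith)
  calc (1 + A) * ((2 * Real.log (2 / δ) + 1) + (2 * (A + √A + 2) * runFactor ε δ + 1))
      ≤ (1 + A) * (431 * (A * Y)) := by
        refine mul_le_mul_of_nonneg_left ?_ (by linarith)
        linarith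
    _ ≤ 2.5 * A * (431 * (A * Y)) := by gcongr
    _ ≤ 2000 * (A ^ 2 * Y) := by nlinarith [mul_nonneg (by linarith : 0 ≤ A) hAY]

end Numerics

/-! ### The expected cost of the algorithm -/

section Final

variable {n : ℕ} {α : Type*} [PartialOrder α] [Fintype α]

theorem blockMeasure_initialSteps_le {home : Fin n ≃ α} (hhome : IsLinExt home) (hn : 2 ≤ n)
    (β : ℝ) (j : ℕ) :
    blockMeasure {τ | ¬ ∀ i, boundRun home β τ (blockLength (initialSteps n) j) i ≠ none} ≤
      ENNReal.ofReal 0.1354 ^ 2 ^ j := by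
  refine (blockMeasure_theta_le hhome hn β _).trans ?_
  rw [← ENNReal.ofReal_pow (by norm_num)]
  exact ENNReal.ofReal_le_ofReal (eigenVal_pow_initialSteps_le n hn j)

/-- With the chosen number of steps, the coupling from the past ends almost surely, for every `β`.
-/
theorem coalesces_initialSteps {home : Fin n ≃ α} (hhome : IsLinExt home) (hn : 2 ≤ n) (β : ℝ) :
    Coalesces home (initialSteps n) β := by
  have hq : ENNReal.ofReal 0.1354 < 1 := by
    rw [← ENNReal.ofReal_one]; exact (ENNReal.ofReal_lt_ofReal_iff one_pos).2 (by norm_num)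
  refine tendsto_of_tendsto_of_tendsto_of_le_of_le tendsto_const_nhds
    (ENNReal.tendsto_pow_atTop_nhds_zero_of_lt_one hq) (fun _ => zero_le) fun J => ?_
  refine (blocksMeasure_blockDrawn_le home _ β _
    (blockMeasure_initialSteps_le hhome hn β) J).trans ?_
  exact pow_le_pow_right_of_le_one' hq.le (by have : J < 2 ^ J := Nat.lt_two_pow_self; omega)

theorem lintegral_generateCost_initialSteps_le {home : Fin n ≃ α} (hhome : IsLinExt home)
    (hn : 2 ≤ n) (β : ℝ) (w : StepTape → ENNReal) (hw : Measurable w) :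
    ∫⁻ τ, generateCost home (initialSteps n) w β τ ∂blocksMeasure ≤
      ENNReal.ofReal (1.2815 * initialSteps n) * ∫⁻ x, w x ∂stepMeasure := by
  refine (lintegral_generateCost_le home _ β _ (blockMeasure_initialSteps_le hhome hn β) w
    hw).trans (mul_le_mul_left ?_ _)
  rw [ENNReal.ofReal_mul (by norm_num), mul_comm, ENNReal.ofReal_natCast]
  exact mul_le_mul_left tsum_block_le _

/-- The bound on the expected running time. -/
theorem lintegral_totalSteps_le {home : Fin n ≃ α} (hhome : IsLinExt home) (hn : 2 ≤ n) {ε δ : ℝ}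
    (hε0 : 0 < ε) (hε1 : ε ≤ 1) (hδ0 : 0 < δ) (hδ1 : δ ≤ 1 / 2) (hL : 2 ≤ numLinExt n α) :
    ∫⁻ ω, totalSteps home (initialSteps n) ε δ ω ∂(tapeMeasure α) ≤
      ENNReal.ofReal (4000 * ((n : ℝ) ^ 3 * Real.log n * Real.log (numLinExt n α) ^ 2 *
        (ε ^ 2)⁻¹ * Real.log δ⁻¹)) := by
  have hX : 0 ≤ (n : ℝ) ^ 3 * Real.log n := mul_nonneg (by positivity) (Real.log_natCast_nonneg n)
  have hA : Real.log 2 ≤ Real.log (numLinExt n α) :=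
    Real.log_le_log (by norm_num) (by exact_mod_cast hL)
  refine (lintegral_totalCost_le hhome hn (fun β _ _ => coalesces_initialSteps hhome hn β) hε0 hε1
    hδ0 (by linarith) rfl (fun _ _ => 1) measurable_const
    (c := 1.67 * ((n : ℝ) ^ 3 * Real.log n)) (by positivity) fun β _ _ => ?_).trans
    (ENNReal.ofReal_le_ofReal ?_)
  · refine (lintegral_generateCost_initialSteps_le hhome hn β _ measurable_const).trans ?_
    rw [lintegral_const, measure_univ, mul_one, mul_one]
    exact ENNReal.ofReal_le_ofReal (initialSteps_mul_le n hn)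
  · have h := mul_le_mul_of_nonneg_left (runs_le_log_sq hε0 hε1 hδ0 hδ1 hA)
      (by positivity : 0 ≤ 1.67 * ((n : ℝ) ^ 3 * Real.log n))
    have hl0 : 0 ≤ Real.log δ⁻¹ := Real.log_nonneg (by
      rw [one_le_inv₀ hδ0]; linarith)
    have h0 : 0 ≤ (n : ℝ) ^ 3 * Real.log n *
        (Real.log (numLinExt n α) ^ 2 * ((ε ^ 2)⁻¹ * Real.log δ⁻¹)) := by positivity
    linarith

/-- The bound on the expected number of random bits. -/
theorem lintegral_totalBits_le {home : Fin n ≃ α} (hhome : IsLinExt home) (hn : 2 ≤ n) {ε δ : ℝ}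
    (hε0 : 0 < ε) (hε1 : ε ≤ 1) (hδ0 : 0 < δ) (hδ1 : δ < 1) :
    ∫⁻ ω, totalBits home (initialSteps n) ε δ ω ∂(tapeMeasure α) ≤
      ENNReal.ofReal (bitBound n (Real.log (numLinExt n α)) ε δ) := by
  have hX : 0 ≤ (n : ℝ) ^ 3 * Real.log n := mul_nonneg (by positivity) (Real.log_natCast_nonneg n)
  have hA : 0 ≤ Real.log (numLinExt n α) := Real.log_natCast_nonneg _
  have hn' : (2 : ℝ) ≤ n := by exact_mod_cast hn
  obtain ⟨K, hK⟩ : ∃ K : ℕ, ⌈Real.logb 2 n⌉ = (K : ℤ) :=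
    Int.eq_ofNat_of_zero_le (Int.ceil_nonneg (Real.logb_nonneg (by norm_num) (by linarith)))
  obtain ⟨hnK, hK1⟩ := le_two_pow_of_ceil_logb hn hK
  have hm : Measurable (Function.uncurry fun (β : ℝ) (x : StepTape) => stepBits n β x) :=
    measurable_stepBits n
  refine (lintegral_totalCost_le hhome hn (fun β _ _ => coalesces_initialSteps hhome hn β) hε0 hε1
    hδ0 hδ1 rfl (fun β => stepBits n β) hm
    (c := 2.08 * ((n : ℝ) ^ 3 * Real.log n) * (K + 3)) (by positivity) fun β _ _ => ?_).trans
    (ENNReal.ofReal_le_ofReal ?_)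
  · have hmβ : Measurable (stepBits n β) := by
      have h := hm.comp (measurable_const (a := β).prodMk measurable_id :
        Measurable fun x : StepTape => (β, x))
      exact h
    refine (lintegral_generateCost_initialSteps_le hhome hn β _ hmβ).trans ?_
    refine (mul_le_mul_right (lintegral_stepBits_le n K hn β) _).trans ?_
    have hconv : (K : ENNReal) + ((n - 2 : ℕ) : ENNReal) * (2 * 2⁻¹ ^ K) + 1 + 2 =
        ENNReal.ofReal (K + ((n : ℝ) - 2) * (2 * 2⁻¹ ^ K) + 3) := by
      have h2 : (0 : ℝ) ≤ (n : ℝ) - 2 := by linarith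
      rw [ENNReal.ofReal_add (by positivity) (by norm_num), ENNReal.ofReal_add (by positivity)
        (by positivity), ENNReal.ofReal_mul h2, ENNReal.ofReal_mul (by norm_num),
        ENNReal.ofReal_pow (by norm_num), ENNReal.ofReal_inv_of_pos (by norm_num),
        ENNReal.ofReal_sub _ (by norm_num), ENNReal.ofReal_natCast, ENNReal.ofReal_natCast,
        add_assoc]
      norm_num
    rw [hconv, ← ENNReal.ofReal_mul (by positivity)]
    exact ENNReal.ofReal_le_ofReal (initialSteps_mul_bits_le hn hnK hK1)
  · have h := mul_le_mul_of_nonneg_left (runs_le_bitBound hε0 hε1 hδ0 hδ1 hA)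
      (by positivity : 0 ≤ (n : ℝ) ^ 3 * Real.log n * (K + 3) *
        (1 + Real.log (numLinExt n α)))
    have hcast : ((⌈Real.logb 2 n⌉ : ℤ) : ℝ) = K := by rw [hK]; simp
    have hb : bitBound n (Real.log (numLinExt n α)) ε δ = (n : ℝ) ^ 3 * Real.log n * (K + 3) *
        (1 + Real.log (numLinExt n α)) * (4.3 * (2 * Real.log (2 / δ) + (Real.log (numLinExt n α) +
          3 * √(2 * Real.log (numLinExt n α)) + 2) * runFactor ε δ)) := by
      rw [bitBound, hcast, runFactor]; ring
    rw [hb]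
    refine le_trans (le_of_eq ?_) h
    ring

end Final

end

end LinExt

theorem mainTheorem1 :
    ∃ t : ℕ → ℕ, ∃ C : ℝ, (∀ n, 0 < t n) ∧ 0 < C ∧
      ∀ (n : ℕ), 2 ≤ n → ∀ (α : Type*) [Fintype α] [PartialOrder α] (home : Fin n ≃ α),
        LinExt.IsLinExt home → ∀ ε δ : ℝ, 0 < ε → ε ≤ 1 → 0 < δ → δ < 1 →
          1 - δ ≤ (LinExt.tapeMeasure α).real
              {ω | (1 + ε)⁻¹ ≤ LinExt.estimate home (t n) ε δ ω / LinExt.numLinExt n α ∧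
                LinExt.estimate home (t n) ε δ ω / LinExt.numLinExt n α ≤ 1 + ε} ∧
          ∫⁻ ω, LinExt.totalBits home (t n) ε δ ω ∂(LinExt.tapeMeasure α) ≤
            ENNReal.ofReal (LinExt.bitBound n (Real.log (LinExt.numLinExt n α)) ε δ) ∧
          (2 ≤ LinExt.numLinExt n α → δ ≤ 1 / 2 →
            ∫⁻ ω, LinExt.totalSteps home (t n) ε δ ω ∂(LinExt.tapeMeasure α) ≤
              ENNReal.ofReal (C * ((n : ℝ) ^ 3 * Real.log n *
                Real.log (LinExt.numLinExt n α) ^ 2 * (ε ^ 2)⁻¹ * Real.log δ⁻¹))) := by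
  refine ⟨LinExt.initialSteps, 4000, fun n => ?_, by norm_num, ?_⟩
  · exact lt_of_lt_of_le one_pos (le_max_left _ _)
  · intro n hn α _ _ home hhome ε δ hε0 hε1 hδ0 hδ1
    exact ⟨LinExt.estimate_accurate hhome hn
      (fun β _ _ => LinExt.coalesces_initialSteps hhome hn β) hε0 hε1 hδ0 hδ1,
      LinExt.lintegral_totalBits_le hhome hn hε0 hε1 hδ0 hδ1,
      fun hL hδ2 => LinExt.lintegral_totalSteps_le hhome hn hε0 hε1 hδ0 hδ2 hL⟩
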